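/- Let $M,N_1,N_2$ be finite-dimensional smooth manifolds (Hausdorff, second countable, of constant dimension) with $\dim M\ge 1$ and $\dim N_2\ge 1$. Let $J^k(M,N)$ denote the manifold of $k$-jets $j^k_x(s)$ of smooth local maps $s:M\to N$, with its Cartan distribution $\mathcal C^k$: at $\theta\in J^k(M,N)$ over $x$, $\mathcal C^k_\theta$ is the span of the tangent spaces at $\theta$ of the graphs $\{j^k_z(s)\}$ of all local maps $s$ with $j^k_x(s)=\theta$. Let $$J^{k_1,k_2}(M,N_1\times N_2)=J^{k_1}(M,N_1)\times_M J^{k_2}(M,N_2)$$ be the mixed jet space, with projections $\pi_i$ to $J^{k_i}(M,N_i)$ and the distribution $\mathcal C^{k_1,k_2}=(d\pi_1)^{-1}(\mathcal C^{k_1})\cap(d\pi_2)^{-1}(\mathcal C^{k_2})$. A Lie transformation of a (pure or mixed) jet space is a diffeomorphism of that space onto itself which preserves this distribution. A transformation $f$ of a jet space (or of $M\times N_2=J^0(M,N_2)$) has the prolongation $f^{(l)}=g$ if $g$ is a transformation of the jet space with all orders raised by $l$ which covers $f$ and, when $l>0$, satisfies: for all smooth local maps $s$ near $x$ there is a smooth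 local map $t$ near $x'$ such that $f$ maps the graph of the jet prolongation of $s$ near $x$ into the graph of the jet prolongation of $t$ (taking the point over $x$ to the point over $x'$), and $g$ maps the jet of $s$ at $x$ to the jet of $t$ at $x'$. 1. Let $k_1<k_2$. Every Lie transformation $F$ of $J^{k_1,k_2}(M,N_1\times N_2)$ is the prolongation $F_0^{(k_1)}$ of a Lie transformation $F_0$ of $J^{0,k_2-k_1}(M,N_1\times N_2)$. 2. Let $k\ge 1$ and let $N_1$ be connected. Under the identification $J^{0,k}(M,N_1\times N_2)=N_1\times J^k(M,N_2)$, every Lie transformation $F_0$ of $J^{0,k}(M,N_1\times N_2)$ has the form $$F_0\bigl(y,j_x^k(s)\bigr)=\bigl(Y(y,j_x^k(s)),\,g(j_x^k(s))\bigr)$$ with a smooth map $Y:N_1\times J^k(M,N_2)\to N_1$ and a Lie transformation $g$ of $J^k(M,N_2)$, where - if $\dim N_2=1$, then $g=f^{(k-1)}$ for a contact transformation $f:J^1(M,N_2)\to J^1(M,N_2)$, i.e. a Lie transformation of $J^1(M,N_2)$; - if $\dim N_2>1$, then $g=f^{(k)}$ for a point transformation $f$, i.e. a diffeomorphism $f:M\times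 N_2\to M\times N_2$. -/

import Mathlib

open Set Filter Function
open scoped Topology Manifold ContDiff

noncomputable section

namespace JetSpace

section Calculus

variable {E F G : Type*} [NormedAddCommGroup E] [NormedSpace ℝ E] [NormedAddCommGroup F]
  [NormedSpace ℝ F] [NormedAddCommGroup G] [NormedSpace ℝ G]

variable (E F) in
/-- The space of symmetric continuous `i`-linear maps from `E` to `F`. -/
def SymMul (i : ℕ) : Submodule ℝ (E [×i]→L[ℝ] F) where
  carrier := {p | ∀ (σ : Equiv.Perm (Fin i)) (v : Fin i → E), p (v ∘ σ) = p v}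
  add_mem' := by
    intro a b ha hb σ v
    simp [ha σ v, hb σ v]
  zero_mem' := by intro σ v; simp
  smul_mem' := by
    intro c a ha σ v
    simp [ha σ v]

instance (i : ℕ) : NormedAddCommGroup (SymMul E F i) := inferInstance

instance (i : ℕ) : NormedSpace ℝ (SymMul E F i) := inferInstance

/-- Symmetrization of a multilinear map. It is the identity on symmetric maps. -/
def symmetrize {i : ℕ} (p : E [×i]→L[ℝ] F) : E [×i]→L[ℝ] F :=
  ((i.factorial : ℝ)⁻¹) • ∑ σ : Equiv.Perm (Fin i), p.domDomCongr σ

theorem symmetrize_apply {i : ℕ} (p : E [×i]→L[ℝ] F) (v : Fin i → E) :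
    symmetrize p v = ((i.factorial : ℝ)⁻¹) • ∑ σ : Equiv.Perm (Fin i), p (v ∘ σ) := by
  simp [symmetrize, Function.comp_def]

theorem symmetrize_mem {i : ℕ} (p : E [×i]→L[ℝ] F) : symmetrize p ∈ SymMul E F i := by
  intro τ v
  rw [symmetrize_apply, symmetrize_apply]
  congr 1
  exact Fintype.sum_equiv (Equiv.mulLeft τ) _ _ (fun σ => by
    simp [Function.comp_assoc, Equiv.Perm.coe_mul])

theorem symmetrize_of_mem {i : ℕ} {p : E [×i]→L[ℝ] F} (hp : p ∈ SymMul E F i) :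
    symmetrize p = p := by
  ext v
  rw [symmetrize_apply, Finset.sum_congr rfl (fun σ _ => hp σ v)]
  simp only [Finset.sum_const, Finset.card_univ, Fintype.card_perm, Fintype.card_fin]
  rw [← Nat.cast_smul_eq_nsmul ℝ, smul_smul, inv_mul_cancel₀ (by positivity), one_smul]

variable (E F) in
/-- Symmetrization as a continuous linear projection. -/
def symProj (i : ℕ) : (E [×i]→L[ℝ] F) →L[ℝ] SymMul E F i :=
  ContinuousLinearMap.codRestrict
    (((i.factorial : ℝ)⁻¹) • ∑ σ : Equiv.Perm (Fin i),
      (ContinuousMultilinearMap.domDomCongrₗᵢ ℝ E F σ).toContinuousLinearEquiv.toContinuousLinearMap)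
    (SymMul E F i) (by
      intro p
      convert! symmetrize_mem p
      ext v
      simp only [symmetrize_apply, smul_apply, sum_apply]
      rfl)

theorem coe_symProj {i : ℕ} (p : E [×i]→L[ℝ] F) : (symProj E F i p : E [×i]→L[ℝ] F) = symmetrize p := by
  ext v
  simp only [symProj, symmetrize_apply, ContinuousLinearMap.coe_codRestrict_apply,
    smul_apply, sum_apply]
  rfl

theorem symProj_coe {i : ℕ} (p : SymMul E F i) : symProj E F i p = p :=
  Subtype.ext ((coe_symProj _).trans (symmetrize_of_mem p.2))

/-- Higher derivatives of smooth functions are symmetric. -/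
theorem iteratedFDeriv_mem_symMul (n : ℕ) {f : E → F} {x : E} (hf : ContDiffAt ℝ n f x) :
    iteratedFDeriv ℝ n f x ∈ SymMul E F n := by
  induction n generalizing x with
  | zero =>
    intro σ v
    congr 1
    ext i
    exact i.elim0
  | succ n ih =>
    intro σ
    have hσ : σ ∈ Submonoid.closure (Set.range fun i : Fin n ↦ Equiv.swap i.castSucc i.succ) := by
      rw [Equiv.Perm.mclosure_swap_castSucc_succ]; trivial
    induction hσ using Submonoid.closure_induction with
    | one => intro v; rfl
    | mul a b _ _ ha hb =>
      intro v
      rw [Equiv.Perm.coe_mul, ← Function.comp_assoc, hb, ha]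
    | mem a ha =>
      obtain ⟨i, rfl⟩ := ha
      intro v
      have hev : ∀ᶠ y in 𝓝 x, ContDiffAt ℝ (n + 1 : ℕ) f y := hf.eventually (by simp)
      have hd : DifferentiableAt ℝ (iteratedFDeriv ℝ n f) x := by
        refine ContDiffAt.differentiableAt (n := 1)
          (hf.iteratedFDeriv_right (m := 1) (i := n) ?_) one_ne_zero
        push_cast; rw [add_comm]
      rcases n with _ | n
      · exact i.elim0
      · by_cases hi : i = 0
        · subst hi
          have hd2 : ContDiffAt ℝ 2 (iteratedFDeriv ℝ n f) x :=
            hf.iteratedFDeriv_right (m := 2) (i := n) (by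
              push_cast; rw [← one_add_one_eq_two, add_comm, add_assoc])
          have hsym := hd2.isSymmSndFDerivAt (by simp)
          have key : ∀ w : Fin (n + 2) → E, iteratedFDeriv ℝ (n + 1 + 1) f x w =
              fderiv ℝ (fderiv ℝ (iteratedFDeriv ℝ n f)) x (w 0) (w 1) (Fin.tail (Fin.tail w)) := by
            intro w
            rw [iteratedFDeriv_succ_apply_left, iteratedFDeriv_succ_eq_comp_left]
            have h := LinearIsometryEquiv.comp_fderiv (𝕜 := ℝ)
              (continuousMultilinearCurryLeftEquiv ℝ (fun _ : Fin (n + 1) => E) F).symm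
              (f := fderiv ℝ (iteratedFDeriv ℝ n f)) (x := x)
            exact congrArg (fun L => L (w 0) (Fin.tail w)) h
          rw [key, key, ← hsym.eq]
          have e0 : (v ∘ Equiv.swap (0 : Fin (n+1)).castSucc (0 : Fin (n+1)).succ) 0 = v 1 := by
            simp
          have e1 : (v ∘ Equiv.swap (0 : Fin (n+1)).castSucc (0 : Fin (n+1)).succ) 1 = v 0 := by
            simp
          rw [e0, e1]
          congr 1
        · obtain ⟨j, rfl⟩ := Fin.exists_succ_eq.2 hi
          rw [iteratedFDeriv_succ_apply_left, iteratedFDeriv_succ_apply_left]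
          set τ := Equiv.swap j.castSucc j.succ with hτ
          have e0 : (v ∘ Equiv.swap j.succ.castSucc j.succ.succ) 0 = v 0 := by
            simp only [Function.comp_apply]
            rw [Equiv.swap_apply_of_ne_of_ne]
            · simp [Fin.ext_iff]
            · simp [Fin.ext_iff]
          have e1 : Fin.tail (v ∘ Equiv.swap j.succ.castSucc j.succ.succ) = Fin.tail v ∘ τ := by
            ext l
            simp only [Fin.tail, Function.comp_apply, hτ, ← Fin.succ_castSucc]
            rw [← (Fin.succ_injective (n + 1)).swap_apply]
          rw [e0, e1]
          have hAB : (fun y => iteratedFDeriv ℝ (n + 1) f y (Fin.tail v ∘ τ)) =ᶠ[𝓝 x]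
              fun y => iteratedFDeriv ℝ (n + 1) f y (Fin.tail v) := by
            filter_upwards [hev] with y hy
            exact ih (hy.of_le (by norm_cast; omega)) τ _
          have := hAB.fderiv_eq (𝕜 := ℝ)
          have h2 : ∀ w : Fin (n + 1) → E, fderiv ℝ (fun y => iteratedFDeriv ℝ (n + 1) f y w) x (v 0)
              = fderiv ℝ (iteratedFDeriv ℝ (n + 1) f) x (v 0) w := by
            intro w
            have h3 := ((ContinuousMultilinearMap.apply ℝ (fun _ : Fin (n + 1) => E) F w).hasFDerivAt.comp x
              hd.hasFDerivAt).fderiv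
            have h4 := congrArg (fun L => L (v 0)) h3
            simpa [Function.comp_def] using h4
          rw [← h2, ← h2, this]

instance (k : ℕ) : NormedAddCommGroup (∀ i : Fin (k + 1), SymMul E F i) :=
  Pi.normedAddCommGroup

instance (k : ℕ) : NormedSpace ℝ (∀ i : Fin (k + 1), SymMul E F i) := Pi.normedSpace

variable (E F) in
/-- The coordinate space of `k`-jets of maps from `E` to `F`: a point of `E` together with the
values of all derivatives of order at most `k`. -/
abbrev JetCoord (k : ℕ) : Type _ := E × (∀ i : Fin (k + 1), SymMul E F i)

/-- The derivatives up to order `k` of `f` at `x`. -/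
def derivs (k : ℕ) (f : E → F) (x : E) : ∀ i : Fin (k + 1), SymMul E F i :=
  fun i => symProj E F i (iteratedFDeriv ℝ i f x)

/-- The polynomial of degree at most `k` with prescribed derivatives `p` at `x`. -/
def taylorPoly {k : ℕ} (x : E) (p : ∀ i : Fin (k + 1), SymMul E F i) (z : E) : F :=
  ∑ i : Fin (k + 1), ((Nat.factorial i : ℝ)⁻¹) • (p i : E [×i]→L[ℝ] F) (fun _ => z - x)

/-- Extension by zero of a finite family of symmetric multilinear maps to a series. -/
def toSeries {k : ℕ} (p : ∀ i : Fin (k + 1), SymMul E F i) : FormalMultilinearSeries ℝ E F :=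
  fun n => if h : n < k + 1 then (p ⟨n, h⟩ : E [×n]→L[ℝ] F) else 0

theorem toSeries_coe {k : ℕ} (p : ∀ i : Fin (k + 1), SymMul E F i) (i : Fin (k + 1)) :
    toSeries p i = p i := dif_pos i.2

theorem contDiff_taylorPoly {k : ℕ} (x : E) (p : ∀ i : Fin (k + 1), SymMul E F i) :
    ContDiff ℝ ∞ (taylorPoly x p) := by
  unfold taylorPoly
  refine ContDiff.sum fun i _ => ContDiff.const_smul _ ?_
  exact (ContinuousMultilinearMap.contDiff _).comp (contDiff_pi.2 fun _ => contDiff_id.sub contDiff_const)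

theorem hasFPowerSeries_taylorPoly {k : ℕ} (x : E) (p : ∀ i : Fin (k + 1), SymMul E F i) :
    HasFPowerSeriesOnBall (taylorPoly x p)
      (fun n => ((Nat.factorial n : ℝ)⁻¹) • toSeries p n) x ⊤ where
  r_le := by
    refine (FormalMultilinearSeries.radius_eq_top_of_forall_image_add_eq_zero _ (k + 1) ?_).ge
    intro n
    have : toSeries p (n + (k + 1)) = 0 := dif_neg (by omega)
    simp only [this, smul_zero]
  r_pos := by simp
  hasSum := by
    intro y _
    have : taylorPoly x p (x + y) = ∑ n ∈ Finset.range (k + 1),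
        (((Nat.factorial n : ℝ)⁻¹) • toSeries p n) (fun _ => y) := by
      rw [Finset.sum_range]
      unfold taylorPoly
      refine Finset.sum_congr rfl fun i _ => ?_
      rw [toSeries_coe]
      simp
    rw [this]
    refine hasSum_sum_of_ne_finset_zero fun n hn => ?_
    simp only [Finset.mem_range] at hn
    have : toSeries p n = 0 := dif_neg (by omega)
    simp [this]

theorem iteratedFDeriv_taylorPoly [CompleteSpace F] {k : ℕ} (x : E)
    (p : ∀ i : Fin (k + 1), SymMul E F i) (i : Fin (k + 1)) :
    iteratedFDeriv ℝ i (taylorPoly x p) x = p i := by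
  ext v
  rw [(hasFPowerSeries_taylorPoly x p).iteratedFDeriv_eq_sum_of_completeSpace]
  rw [toSeries_coe]
  conv_rhs => rw [← symmetrize_of_mem (p i).2, symmetrize_apply]
  rw [Finset.smul_sum]
  rfl

theorem taylorPoly_self {k : ℕ} (x : E) (p : ∀ i : Fin (k + 1), SymMul E F i) :
    taylorPoly x p x = (p 0).1 0 := by
  unfold taylorPoly
  rw [Fin.sum_univ_succ, Finset.sum_eq_zero, add_zero]
  · simp only [Fin.val_zero, Nat.factorial_zero, Nat.cast_one, inv_one, one_smul]
    exact congrArg _ (Subsingleton.elim _ _)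
  · intro i _
    rw [ContinuousMultilinearMap.map_coord_zero _ (0 : Fin (i + 1)) (by simp)]
    simp

theorem derivs_taylorPoly [CompleteSpace F] {k : ℕ} (x : E)
    (p : ∀ i : Fin (k + 1), SymMul E F i) : derivs k (taylorPoly x p) x = p := by
  ext1 i
  rw [derivs, iteratedFDeriv_taylorPoly, symProj_coe]

theorem derivs_eq_iff {k : ℕ} {f g : E → F} {x y : E} (hf : ContDiffAt ℝ ∞ f x)
    (hg : ContDiffAt ℝ ∞ g y) :
    derivs k f x = derivs k g y ↔ ∀ i ≤ k, iteratedFDeriv ℝ i f x = iteratedFDeriv ℝ i g y := by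
  have hf' : ∀ i : ℕ, symmetrize (iteratedFDeriv ℝ i f x) = iteratedFDeriv ℝ i f x := fun i =>
    symmetrize_of_mem (iteratedFDeriv_mem_symMul i (hf.of_le (by exact_mod_cast le_top)))
  have hg' : ∀ i : ℕ, symmetrize (iteratedFDeriv ℝ i g y) = iteratedFDeriv ℝ i g y := fun i =>
    symmetrize_of_mem (iteratedFDeriv_mem_symMul i (hg.of_le (by exact_mod_cast le_top)))
  constructor
  · intro h i hi
    have := congrArg Subtype.val (congrFun h ⟨i, Nat.lt_succ_of_le hi⟩)
    simpa [derivs, coe_symProj, hf', hg'] using this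
  · intro h
    ext1 i
    simp only [derivs]
    rw [h i (Nat.lt_succ_iff.1 i.2)]

theorem toSeries_derivs {k : ℕ} {f : E → F} {x : E} (hf : ContDiffAt ℝ ∞ f x) {n : ℕ}
    (hn : n ≤ k) : toSeries (derivs k f x) n = iteratedFDeriv ℝ n f x := by
  simp only [toSeries, Nat.lt_succ_of_le hn, dite_true, derivs, coe_symProj]
  exact symmetrize_of_mem (iteratedFDeriv_mem_symMul n (hf.of_le (by exact_mod_cast le_top)))

theorem taylorComp_congr {q q' : FormalMultilinearSeries ℝ F G} {p p' : FormalMultilinearSeries ℝ E F}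
    {n : ℕ} (hq : ∀ i ≤ n, q i = q' i) (hp : ∀ i ≤ n, p i = p' i) :
    q.taylorComp p n = q'.taylorComp p' n := by
  unfold FormalMultilinearSeries.taylorComp
  refine Finset.sum_congr rfl fun c _ => ?_
  unfold FormalMultilinearSeries.compAlongOrderedFinpartition
  rw [hq _ c.length_le]
  congr 1
  ext1 m
  exact hp _ (c.partSize_le m)

/-- The derivatives of a composition, in terms of derivatives of the factors. -/
theorem iteratedFDeriv_comp_eq {k : ℕ} {g : F → G} {f : E → F} {x : E} (hg : ContDiffAt ℝ ∞ g (f x))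
    (hf : ContDiffAt ℝ ∞ f x) {i : ℕ} (hi : i ≤ k) :
    iteratedFDeriv ℝ i (g ∘ f) x =
      (ftaylorSeries ℝ g (f x)).taylorComp (toSeries (derivs k f x)) i := by
  rw [iteratedFDeriv_comp hg hf (by exact_mod_cast le_top)]
  refine taylorComp_congr (fun _ _ => rfl) fun j hj => ?_
  rw [toSeries_derivs hf (hj.trans hi)]
  rfl

/-- Smooth dependence of `taylorComp` on its arguments. -/
theorem contDiffAt_taylorComp [CompleteSpace G] {W : Type*} [NormedAddCommGroup W] [NormedSpace ℝ W]
    {q : W → FormalMultilinearSeries ℝ F G} {p : W → FormalMultilinearSeries ℝ E F} {w : W} {n : ℕ}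
    (hq : ∀ i ≤ n, ContDiffAt ℝ ∞ (fun w => q w i) w)
    (hp : ∀ i ≤ n, ContDiffAt ℝ ∞ (fun w => p w i) w) :
    ContDiffAt ℝ ∞ (fun w => (q w).taylorComp (p w) n) w := by
  unfold FormalMultilinearSeries.taylorComp
  refine ContDiffAt.sum fun c _ => ?_
  have h1 : ContDiffAt ℝ ∞ (fun w => (q w c.length, fun m => p w (c.partSize m))) w :=
    (hq _ c.length_le).prodMk (contDiffAt_pi.2 fun m => hp _ (c.partSize_le m))
  have h2 := ((c.compAlongOrderedFinpartitionL ℝ E F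
    G).analyticOnNhd_uncurry_of_multilinear (s := Set.univ) _ (mem_univ
      (q w c.length, fun m => p w (c.partSize m)))).contDiffAt (n := ∞)
  exact h2.comp w h1

end Calculus

section Core

theorem isManifold_of_core {H J : Type*} [NormedAddCommGroup H] [NormedSpace ℝ H]
    (c : ChartedSpaceCore H J)
    (hc : ∀ e ∈ c.atlas, ∀ e' ∈ c.atlas,
      ContDiffOn ℝ ∞ (e.symm.trans e') (e.symm.trans e').source) :
    @IsManifold ℝ _ H _ _ H _ 𝓘(ℝ, H) ∞ J c.toTopologicalSpace c.toChartedSpace := by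
  let _ := c.toTopologicalSpace
  let _ := c.toChartedSpace
  refine isManifold_of_contDiffOn _ _ _ ?_
  intro e e' he he'
  obtain ⟨_, ⟨e₁, rfl⟩, he⟩ := he
  obtain ⟨_, ⟨h₁, rfl⟩, he⟩ := he
  obtain ⟨_, ⟨e₂, rfl⟩, he'⟩ := he'
  obtain ⟨_, ⟨h₂, rfl⟩, he'⟩ := he'
  obtain rfl := Set.mem_singleton_iff.1 he
  obtain rfl := Set.mem_singleton_iff.1 he'
  simp only [modelWithCornersSelf_coe, modelWithCornersSelf_coe_symm, Function.comp_id,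
    Function.id_comp, Set.preimage_id, Set.range_id, Set.inter_univ]
  exact hc e₁ h₁ e₂ h₂

end Core


section Jets

variable {E : Type*} [NormedAddCommGroup E] [NormedSpace ℝ E]
  {M : Type*} [TopologicalSpace M] [ChartedSpace E M]
  {F : Type*} [NormedAddCommGroup F] [NormedSpace ℝ F]
  {N : Type*} [TopologicalSpace N] [ChartedSpace F N]

variable (E F) in
/-- The map `s` is smooth on a neighbourhood of `x`. -/
def SmoothNear (s : M → N) (x : M) : Prop :=
  ∀ᶠ z in 𝓝 x, ContMDiffAt 𝓘(ℝ, E) 𝓘(ℝ, F) ∞ s z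

variable (E F) in
/-- The expression of `s` in the chart of `M` at `a` and the chart of `N` at `b`. -/
def localRep (a : M) (b : N) (s : M → N) : E → F :=
  chartAt F b ∘ s ∘ (chartAt E a).symm

variable (E F) in
/-- Maps smooth near `x` have the same `k`-jet at `x` if they have the same value at `x`, and all
their derivatives at `x` up to order `k`, computed in charts, agree. -/
def jetSetoid (k : ℕ) (x : M) : Setoid {s : M → N // SmoothNear E F s x} where
  r s t := s.1 x = t.1 x ∧ ∀ i ≤ k,
    iteratedFDeriv ℝ i (localRep E F x (s.1 x) s.1) (chartAt E x x) =
      iteratedFDeriv ℝ i (localRep E F x (t.1 x) t.1) (chartAt E x x)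
  iseqv :=
    { refl := fun _ => ⟨rfl, fun _ _ => rfl⟩
      symm := fun h => ⟨h.1.symm, fun i hi => (h.2 i hi).symm⟩
      trans := fun h h' => ⟨h.1.trans h'.1, fun i hi => (h.2 i hi).trans (h'.2 i hi)⟩ }

variable (E M F N) in
/-- The space `J^k(M, N)` of `k`-jets of maps from `M` to `N`, where `M` is modelled on `E` and
`N` is modelled on `F`. -/
structure Jet (k : ℕ) where
  /-- the point of `M` at which the jet is taken -/
  base : M
  /-- the equivalence class of local maps -/
  cls : Quotient (jetSetoid E F k base : Setoid {s : M → N // SmoothNear E F s base})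

/-- The target point `s x` of the jet of `s` at `x`. -/
def Jet.value {k : ℕ} (θ : Jet E M F N k) : N :=
  Quotient.lift (fun s : {s : M → N // SmoothNear E F s θ.base} => s.1 θ.base)
    (fun _ _ h => And.left h) θ.cls

theorem smoothNear_const (y : N) (x : M) : SmoothNear E F (fun _ : M => y) x :=
  Eventually.of_forall fun _ => contMDiffAt_const

variable (E F) in
open scoped Classical in
/-- The `k`-jet at `x` of a map `s : M → N` which is smooth near `x`
(with the `k`-jet of a constant map as a dummy value if `s` is not smooth near `x`). -/
def jetOf (k : ℕ) (s : M → N) (x : M) : Jet E M F N k :=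
  ⟨x, Quotient.mk _ (if h : SmoothNear E F s x then ⟨s, h⟩ else ⟨fun _ => s x, smoothNear_const _ _⟩)⟩

/-- A local map representing a jet. -/
def Jet.rep {k : ℕ} (θ : Jet E M F N k) : M → N := θ.cls.out.1

theorem Jet.smoothNear_rep {k : ℕ} (θ : Jet E M F N k) : SmoothNear E F θ.rep θ.base :=
  θ.cls.out.2

theorem Jet.jetOf_rep {k : ℕ} (θ : Jet E M F N k) : jetOf E F k θ.rep θ.base = θ := by
  unfold jetOf
  rw [dif_pos θ.smoothNear_rep]
  have : (⟨θ.rep, θ.smoothNear_rep⟩ : {s : M → N // SmoothNear E F s θ.base}) = θ.cls.out := rfl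
  rw [this, Quotient.out_eq]

@[simp] theorem jetOf_base (k : ℕ) (s : M → N) (x : M) : (jetOf E F k s x).base = x := rfl

@[simp] theorem jetOf_value (k : ℕ) (s : M → N) (x : M) : (jetOf E F k s x).value = s x := by
  by_cases h : SmoothNear E F s x
  · simp only [jetOf, dif_pos h]
    rfl
  · simp only [jetOf, dif_neg h]
    rfl

theorem jetOf_eq_iff {k : ℕ} {s t : M → N} {x : M} (hs : SmoothNear E F s x)
    (ht : SmoothNear E F t x) :
    jetOf E F k s x = jetOf E F k t x ↔ s x = t x ∧ ∀ i ≤ k,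
      iteratedFDeriv ℝ i (localRep E F x (s x) s) (chartAt E x x) =
        iteratedFDeriv ℝ i (localRep E F x (t x) t) (chartAt E x x) := by
  unfold jetOf
  rw [dif_pos hs, dif_pos ht]
  simp only [Jet.mk.injEq, heq_eq_eq, true_and]
  exact Quotient.eq (r := jetSetoid E F k x)

theorem Jet.value_eq_rep {k : ℕ} (θ : Jet E M F N k) : θ.value = θ.rep θ.base := by
  conv_lhs => rw [← θ.jetOf_rep]
  rw [jetOf_value]

theorem localRep_of_chart {a : M} {b : N} {T : E → F} (hT : ContDiff ℝ ∞ T) {z : E}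
    (ha : z ∈ (chartAt E a).target) (hb : T z ∈ (chartAt F b).target) :
    localRep E F a b ((chartAt F b).symm ∘ T ∘ chartAt E a) =ᶠ[𝓝 z] T := by
  have h1 : ∀ᶠ y in 𝓝 z, y ∈ (chartAt E a).target := (chartAt E a).open_target.mem_nhds ha
  have h2 : ∀ᶠ y in 𝓝 z, T y ∈ (chartAt F b).target :=
    hT.continuous.continuousAt.eventually ((chartAt F b).open_target.mem_nhds hb)
  filter_upwards [h1, h2] with y hy hy'
  simp only [localRep, Function.comp_apply]
  rw [(chartAt E a).right_inv hy, (chartAt F b).right_inv hy']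

variable [IsManifold 𝓘(ℝ, E) ∞ M] [IsManifold 𝓘(ℝ, F) ∞ N]

theorem contDiffAt_chart_trans {a a' : M} {z : E} (hz : z ∈ (chartAt E a).target)
    (hz' : (chartAt E a).symm z ∈ (chartAt E a').source) :
    ContDiffAt ℝ ∞ (chartAt E a' ∘ (chartAt E a).symm) z := by
  rw [← contMDiffAt_iff_contDiffAt]
  exact ((contMDiffOn_chart (I := 𝓘(ℝ, E)) (n := ∞) (x := a')).contMDiffAt
    ((chartAt E a').open_source.mem_nhds hz')).comp z
    ((contMDiffOn_chart_symm (I := 𝓘(ℝ, E)) (n := ∞) (x := a)).contMDiffAt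
      ((chartAt E a).open_target.mem_nhds hz))

theorem contDiffAt_localRep {a : M} {b : N} {s : M → N} {x : M}
    (hs : ContMDiffAt 𝓘(ℝ, E) 𝓘(ℝ, F) ∞ s x)
    (ha : x ∈ (chartAt E a).source) (hb : s x ∈ (chartAt F b).source) :
    ContDiffAt ℝ ∞ (localRep E F a b s) (chartAt E a x) := by
  rw [← contMDiffAt_iff_contDiffAt]
  have hx : (chartAt E a).symm (chartAt E a x) = x := (chartAt E a).left_inv ha
  have h1 := (contMDiffOn_chart_symm (I := 𝓘(ℝ, E)) (n := ∞) (x := a)).contMDiffAt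
      ((chartAt E a).open_target.mem_nhds ((chartAt E a).map_source ha))
  have h2 : ContMDiffAt 𝓘(ℝ, E) 𝓘(ℝ, F) ∞ s ((chartAt E a).symm (chartAt E a x)) := by rwa [hx]
  have h3 : ContMDiffAt 𝓘(ℝ, F) 𝓘(ℝ, F) ∞ (chartAt F b)
      (s ((chartAt E a).symm (chartAt E a x))) := by
    rw [hx]
    exact (contMDiffOn_chart (I := 𝓘(ℝ, F)) (n := ∞) (x := b)).contMDiffAt
      ((chartAt F b).open_source.mem_nhds hb)
  exact ContMDiffAt.comp _ h3 (ContMDiffAt.comp _ h2 h1)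

/-- The map with given Taylor coefficients in the charts at `a` and `b` is smooth. -/
theorem contMDiffAt_of_chart {a : M} {b : N} {T : E → F} (hT : ContDiff ℝ ∞ T) {x : M}
    (ha : x ∈ (chartAt E a).source) (hb : T (chartAt E a x) ∈ (chartAt F b).target) :
    ContMDiffAt 𝓘(ℝ, E) 𝓘(ℝ, F) ∞ ((chartAt F b).symm ∘ T ∘ chartAt E a) x := by
  have h1 := (contMDiffOn_chart (I := 𝓘(ℝ, E)) (n := ∞) (x := a)).contMDiffAt
      ((chartAt E a).open_source.mem_nhds ha)
  have h2 : ContMDiffAt 𝓘(ℝ, E) 𝓘(ℝ, F) ∞ T (chartAt E a x) := hT.contDiffAt.contMDiffAt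
  have h3 := (contMDiffOn_chart_symm (I := 𝓘(ℝ, F)) (n := ∞) (x := b)).contMDiffAt
      ((chartAt F b).open_target.mem_nhds hb)
  exact ContMDiffAt.comp x h3 (h2.comp x h1)

theorem smoothNear_of_chart {a : M} {b : N} {T : E → F} (hT : ContDiff ℝ ∞ T) {x : M}
    (ha : x ∈ (chartAt E a).source) (hb : T (chartAt E a x) ∈ (chartAt F b).target) :
    SmoothNear E F ((chartAt F b).symm ∘ T ∘ chartAt E a) x := by
  have h1 : ∀ᶠ z in 𝓝 x, z ∈ (chartAt E a).source := (chartAt E a).open_source.mem_nhds ha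
  have h2 : ∀ᶠ z in 𝓝 x, T (chartAt E a z) ∈ (chartAt F b).target :=
    (hT.continuous.continuousAt.comp ((chartAt E a).continuousAt ha)).eventually
      ((chartAt F b).open_target.mem_nhds hb)
  filter_upwards [h1, h2] with z hz hz'
  exact contMDiffAt_of_chart hT hz hz'

theorem derivs_congr {k : ℕ} {f g : E → F} {x : E} (h : f =ᶠ[𝓝 x] g) :
    derivs k f x = derivs k g x := by
  ext1 i
  simp only [derivs]
  rw [(h.iteratedFDeriv ℝ i).eq_of_nhds]

/-- Change of coordinates in the space of jets. -/
def jetTrans (k : ℕ) (a a' : M) (b b' : N) (w : JetCoord E F k) : JetCoord E F k :=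
  ((chartAt E a' ∘ (chartAt E a).symm) w.1, fun i => symProj E F i
    (((ftaylorSeries ℝ (chartAt F b' ∘ (chartAt F b).symm) ((w.2 0).1 0)).taylorComp
      ((toSeries w.2).taylorComp (ftaylorSeries ℝ (chartAt E a ∘ (chartAt E a').symm)
        ((chartAt E a' ∘ (chartAt E a).symm) w.1)))) i))

theorem derivs_zero (k : ℕ) (f : E → F) (x : E) : (derivs k f x 0).1 0 = f x := by
  simp only [derivs, coe_symProj]
  rw [symmetrize_of_mem]
  · exact iteratedFDeriv_zero_apply _
  · intro σ v
    congr 1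
    ext i
    exact i.elim0

theorem jetTrans_derivs {k : ℕ} {a a' : M} {b b' : N} {s : M → N} {x : M}
    (hs : ContMDiffAt 𝓘(ℝ, E) 𝓘(ℝ, F) ∞ s x)
    (ha : x ∈ (chartAt E a).source) (ha' : x ∈ (chartAt E a').source)
    (hb : s x ∈ (chartAt F b).source) (hb' : s x ∈ (chartAt F b').source) :
    jetTrans k a a' b b' (chartAt E a x, derivs k (localRep E F a b s) (chartAt E a x)) =
      (chartAt E a' x, derivs k (localRep E F a' b' s) (chartAt E a' x)) := by
  have hx : (chartAt E a' ∘ (chartAt E a).symm) (chartAt E a x) = chartAt E a' x := by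
    simp [(chartAt E a).left_inv ha]
  have hx' : (chartAt E a ∘ (chartAt E a').symm) (chartAt E a' x) = chartAt E a x := by
    simp [(chartAt E a').left_inv ha']
  have hev : localRep E F a' b' s =ᶠ[𝓝 (chartAt E a' x)]
      (chartAt F b' ∘ (chartAt F b).symm) ∘ (localRep E F a b s ∘
        (chartAt E a ∘ (chartAt E a').symm)) := by
    have hc := (chartAt E a').continuousAt_symm ((chartAt E a').map_source ha')
    have h0 : (chartAt E a').symm (chartAt E a' x) = x := (chartAt E a').left_inv ha'
    have h1 : ∀ᶠ y in 𝓝 (chartAt E a' x), (chartAt E a').symm y ∈ (chartAt E a).source :=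
      hc.eventually ((chartAt E a).open_source.mem_nhds (by rwa [h0]))
    have h2 : ∀ᶠ y in 𝓝 (chartAt E a' x), s ((chartAt E a').symm y) ∈ (chartAt F b).source := by
      have hsc : ContinuousAt s ((chartAt E a').symm (chartAt E a' x)) := by
        rw [h0]; exact hs.continuousAt
      exact (hsc.comp hc).eventually ((chartAt F b).open_source.mem_nhds (by
        simpa [h0] using hb))
    filter_upwards [h1, h2] with y hy1 hy2
    simp only [localRep, Function.comp_apply]
    rw [(chartAt E a).left_inv hy1, (chartAt F b).left_inv hy2]
  have hsx : localRep E F a b s (chartAt E a x) = chartAt F b (s x) := by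
    simp [localRep, (chartAt E a).left_inv ha]
  refine Prod.ext hx ?_
  rw [derivs_congr hev]
  ext1 i
  simp only [jetTrans, derivs_zero]
  rw [hx]
  simp only [derivs]
  congr 1
  have hσ : ContDiffAt ℝ ∞ (chartAt E a ∘ (chartAt E a').symm) (chartAt E a' x) :=
    contDiffAt_chart_trans ((chartAt E a').map_source ha') (by
      rwa [(chartAt E a').left_inv ha'])
  have hf : ContDiffAt ℝ ∞ (localRep E F a b s)
      ((chartAt E a ∘ (chartAt E a').symm) (chartAt E a' x)) := by
    rw [hx']; exact contDiffAt_localRep hs ha hb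
  have hτ : ContDiffAt ℝ ∞ (chartAt F b' ∘ (chartAt F b).symm) ((localRep E F a b s ∘
        (chartAt E a ∘ (chartAt E a').symm)) (chartAt E a' x)) := by
    rw [Function.comp_apply, hx', hsx]
    exact contDiffAt_chart_trans ((chartAt F b).map_source hb) (by
      rwa [(chartAt F b).left_inv hb])
  rw [iteratedFDeriv_comp hτ (hf.comp _ hσ) (by exact_mod_cast le_top),
    Function.comp_apply, hx']
  refine taylorComp_congr (fun _ _ => rfl) fun j hj => ?_
  rw [show ftaylorSeries ℝ (localRep E F a b s ∘ (chartAt E a ∘ (chartAt E a').symm))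
    (chartAt E a' x) j = iteratedFDeriv ℝ j (localRep E F a b s ∘ (chartAt E a ∘
      (chartAt E a').symm)) (chartAt E a' x) from rfl]
  rw [iteratedFDeriv_comp hf hσ (by exact_mod_cast le_top), hx']
  refine taylorComp_congr (fun l hl => ?_) (fun _ _ => rfl)
  rw [← hx', toSeries_derivs hf (hl.trans (hj.trans (Nat.lt_succ_iff.1 i.2)))]
  rfl

theorem contDiffAt_jetTrans [CompleteSpace F] {k : ℕ} {a a' : M} {b b' : N} {w : JetCoord E F k}
    (ha : w.1 ∈ (chartAt E a).target) (ha' : (chartAt E a).symm w.1 ∈ (chartAt E a').source)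
    (hb : (w.2 0).1 0 ∈ (chartAt F b).target)
    (hb' : (chartAt F b).symm ((w.2 0).1 0) ∈ (chartAt F b').source) :
    ContDiffAt ℝ ∞ (jetTrans k a a' b b' : JetCoord E F k → JetCoord E F k) w := by
  have h1 : ContDiffAt ℝ ∞ (fun w : JetCoord E F k => (chartAt E a' ∘ (chartAt E a).symm) w.1) w :=
    (contDiffAt_chart_trans ha ha').comp w contDiffAt_fst
  have hco : ∀ i : Fin (k + 1), ContDiff ℝ ∞ (fun w : JetCoord E F k => (w.2 i).1) := fun i =>
    (SymMul E F i).subtypeL.contDiff.comp (contDiff_pi.1 contDiff_snd i)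
  have h0 : ContDiff ℝ ∞ (fun w : JetCoord E F k => (w.2 0).1 0) :=
    (ContinuousMultilinearMap.apply ℝ (fun _ : Fin ((0 : Fin (k + 1)) : ℕ) => E) F 0).contDiff.comp (hco 0)
  refine h1.prodMk (contDiffAt_pi.2 fun i => (symProj E F i).contDiff.contDiffAt.comp w ?_)
  refine contDiffAt_taylorComp (fun j _ => ?_) fun j _ => contDiffAt_taylorComp (fun l _ => ?_) fun l _ => ?_
  · exact ContDiffAt.comp w ((contDiffAt_chart_trans hb hb').iteratedFDeriv_right
      (m := ∞) (i := j) le_rfl) h0.contDiffAt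
  · by_cases hl : l < k + 1
    · simp only [toSeries, dif_pos hl]
      exact (hco ⟨l, hl⟩).contDiffAt
    · simp only [toSeries, dif_neg hl]
      exact contDiffAt_const
  · refine ContDiffAt.comp w (ContDiffAt.iteratedFDeriv_right
      (m := ∞) (i := l) (n := ∞) ?_ le_rfl) h1
    refine contDiffAt_chart_trans ((chartAt E a').map_source ha') ?_
    simp only [Function.comp_apply]
    rw [(chartAt E a').left_inv ha']
    exact (chartAt E a).map_target ha

theorem derivs_chart_eq {k : ℕ} {a : M} {b : N} {s t : M → N} {x : M}
    (hs : SmoothNear E F s x) (ht : SmoothNear E F t x)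
    (ha : x ∈ (chartAt E a).source) (hb : s x ∈ (chartAt F b).source)
    (h : jetOf E F k s x = jetOf E F k t x) :
    derivs k (localRep E F a b s) (chartAt E a x) =
      derivs k (localRep E F a b t) (chartAt E a x) := by
  have hs' := hs.self_of_nhds
  have ht' := ht.self_of_nhds
  obtain ⟨h0, h1⟩ := (jetOf_eq_iff hs ht).1 h
  have hxs := mem_chart_source E x
  have hys := mem_chart_source F (s x)
  have e1 := jetTrans_derivs (k := k) hs' hxs ha hys hb
  have e2 := jetTrans_derivs (k := k) (b := s x) (b' := b) ht' hxs ha (by rw [← h0]; exact hys)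
    (by rwa [← h0])
  rw [← h0] at h1
  have := (derivs_eq_iff (contDiffAt_localRep hs' hxs hys)
    (contDiffAt_localRep ht' hxs (by rw [← h0]; exact hys))).2 h1
  rw [this, e2] at e1
  exact (congrArg Prod.snd e1).symm

theorem jetOf_eq_of_derivs_chart {k : ℕ} {a : M} {b : N} {s t : M → N} {x : M}
    (hs : SmoothNear E F s x) (ht : SmoothNear E F t x)
    (ha : x ∈ (chartAt E a).source) (hb : s x ∈ (chartAt F b).source)
    (hb' : t x ∈ (chartAt F b).source)
    (h : derivs k (localRep E F a b s) (chartAt E a x) =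
      derivs k (localRep E F a b t) (chartAt E a x)) :
    jetOf E F k s x = jetOf E F k t x := by
  have hs' := hs.self_of_nhds
  have ht' := ht.self_of_nhds
  have h0 : s x = t x := by
    have h2 : localRep E F a b s (chartAt E a x) = localRep E F a b t (chartAt E a x) := by
      rw [← derivs_zero k (localRep E F a b s), ← derivs_zero k (localRep E F a b t), h]
    simp only [localRep, Function.comp_apply, (chartAt E a).left_inv ha] at h2
    exact (chartAt F b).injOn hb hb' h2
  have hxs := mem_chart_source E x
  have hys := mem_chart_source F (s x)
  have hyt : t x ∈ (chartAt F (s x)).source := by rw [← h0]; exact hys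
  have e1 := jetTrans_derivs (k := k) hs' ha hxs hb hys
  have e2 := jetTrans_derivs (k := k) ht' ha hxs hb' hyt
  rw [h, e2] at e1
  refine (jetOf_eq_iff hs ht).2 ⟨h0, ?_⟩
  rw [← h0]
  exact (derivs_eq_iff (contDiffAt_localRep hs' hxs hys)
    (contDiffAt_localRep ht' hxs hyt)).1 (congrArg Prod.snd e1).symm

variable [FiniteDimensional ℝ F]

/-- The chart of the jet space defined by charts of `M` and `N`: its coordinates are those of the
base point and the derivatives, up to order `k`, of the coordinate expression of the map. -/
def jetChart (k : ℕ) (a : M) (b : N) : PartialEquiv (Jet E M F N k) (JetCoord E F k) where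
  toFun θ := (chartAt E a θ.base, derivs k (localRep E F a b θ.rep) (chartAt E a θ.base))
  invFun w := jetOf E F k ((chartAt F b).symm ∘ taylorPoly w.1 w.2 ∘ chartAt E a)
    ((chartAt E a).symm w.1)
  source := {θ | θ.base ∈ (chartAt E a).source ∧ θ.value ∈ (chartAt F b).source}
  target := {w | w.1 ∈ (chartAt E a).target ∧ (w.2 0).1 0 ∈ (chartAt F b).target}
  map_source' := by
    rintro θ ⟨h1, h2⟩
    refine ⟨(chartAt E a).map_source h1, ?_⟩
    rw [derivs_zero]
    simp only [localRep, Function.comp_apply]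
    rw [(chartAt E a).left_inv h1, ← θ.value_eq_rep]
    exact (chartAt F b).map_source h2
  map_target' := by
    rintro w ⟨h1, h2⟩
    refine ⟨(chartAt E a).map_target h1, ?_⟩
    rw [jetOf_value]
    simp only [Function.comp_apply]
    rw [(chartAt E a).right_inv h1, taylorPoly_self]
    exact (chartAt F b).map_target h2
  left_inv' := by
    have := FiniteDimensional.complete ℝ F
    rintro θ ⟨h1, h2⟩
    simp only
    rw [(chartAt E a).left_inv h1]
    conv_rhs => rw [← θ.jetOf_rep]
    have h3 : θ.rep θ.base ∈ (chartAt F b).source := by rwa [← θ.value_eq_rep]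
    have hT := contDiff_taylorPoly (chartAt E a θ.base)
      (derivs k (localRep E F a b θ.rep) (chartAt E a θ.base))
    have hTv : taylorPoly (chartAt E a θ.base)
        (derivs k (localRep E F a b θ.rep) (chartAt E a θ.base)) (chartAt E a θ.base) =
          chartAt F b (θ.rep θ.base) := by
      rw [taylorPoly_self, derivs_zero]
      simp only [localRep, Function.comp_apply, (chartAt E a).left_inv h1]
    have hb : taylorPoly (chartAt E a θ.base)
        (derivs k (localRep E F a b θ.rep) (chartAt E a θ.base)) (chartAt E a θ.base) ∈
          (chartAt F b).target := by
      rw [hTv]; exact (chartAt F b).map_source h3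
    refine jetOf_eq_of_derivs_chart (a := a) (b := b) (smoothNear_of_chart hT h1 hb)
      θ.smoothNear_rep h1 ?_ h3 ?_
    · exact (chartAt F b).map_target hb
    · rw [derivs_congr (localRep_of_chart hT ((chartAt E a).map_source h1) hb), derivs_taylorPoly]
  right_inv' := by
    have := FiniteDimensional.complete ℝ F
    rintro w ⟨h1, h2⟩
    have hT := contDiff_taylorPoly w.1 w.2
    have hxs := (chartAt E a).map_target h1
    have hb : taylorPoly w.1 w.2 (chartAt E a ((chartAt E a).symm w.1)) ∈ (chartAt F b).target := by
      rwa [(chartAt E a).right_inv h1, taylorPoly_self]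
    have hb' : taylorPoly w.1 w.2 w.1 ∈ (chartAt F b).target := by rwa [taylorPoly_self]
    have hsm := smoothNear_of_chart hT hxs hb
    refine Prod.ext ((chartAt E a).right_inv h1) ?_
    have h3 := derivs_chart_eq (a := a) (b := b) hsm (Jet.smoothNear_rep (jetOf E F k
      ((chartAt F b).symm ∘ taylorPoly w.1 w.2 ∘ chartAt E a) ((chartAt E a).symm w.1))) hxs
      ((chartAt F b).map_target hb) (Jet.jetOf_rep _).symm
    simp only [jetOf_base] at h3 ⊢
    rw [← h3, (chartAt E a).right_inv h1, derivs_congr (localRep_of_chart hT h1 hb'),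
      derivs_taylorPoly]

theorem jetChart_jetOf {k : ℕ} {a : M} {b : N} {s : M → N} {x : M}
    (hs : SmoothNear E F s x) (ha : x ∈ (chartAt E a).source) (hb : s x ∈ (chartAt F b).source) :
    jetChart k a b (jetOf E F k s x) =
      (chartAt E a x, derivs k (localRep E F a b s) (chartAt E a x)) := by
  refine Prod.ext rfl ?_
  exact (derivs_chart_eq hs (Jet.smoothNear_rep (jetOf E F k s x)) ha hb
    (Jet.jetOf_rep _).symm).symm

theorem jetChart_trans_source (k : ℕ) (a a' : M) (b b' : N) :
    ((jetChart k a b).symm.trans (jetChart k a' b') :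
      PartialEquiv (JetCoord E F k) (JetCoord E F k)).source =
    {w | w.1 ∈ ((chartAt E a).symm.trans (chartAt E a')).source ∧
      (w.2 0).1 0 ∈ ((chartAt F b).symm.trans (chartAt F b')).source} := by
  ext w
  simp only [PartialEquiv.trans_source, PartialEquiv.symm_source, jetChart, PartialEquiv.coe_symm_mk,
    Set.mem_inter_iff, Set.mem_ofPred_eq, Set.mem_preimage, jetOf_base, jetOf_value,
    Function.comp_apply, OpenPartialHomeomorph.trans_source, OpenPartialHomeomorph.symm_source]
  constructor
  · rintro ⟨⟨h1, h2⟩, h3, h4⟩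
    rw [(chartAt E a).right_inv h1, taylorPoly_self] at h4
    exact ⟨⟨h1, h3⟩, h2, h4⟩
  · rintro ⟨⟨h1, h3⟩, h2, h4⟩
    refine ⟨⟨h1, h2⟩, h3, ?_⟩
    rwa [(chartAt E a).right_inv h1, taylorPoly_self]

theorem jetChart_trans_eq {k : ℕ} {a a' : M} {b b' : N} :
    EqOn ((jetChart k a b).symm.trans (jetChart k a' b') :
      PartialEquiv (JetCoord E F k) (JetCoord E F k)) (jetTrans k a a' b b')
      ((jetChart k a b).symm.trans (jetChart k a' b') :
      PartialEquiv (JetCoord E F k) (JetCoord E F k)).source := by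
  intro w hw
  have hw1 : w ∈ (jetChart k a b).target := hw.1
  have hw2 : (jetChart k a b).symm w ∈ (jetChart k a' b').source := hw.2
  have hw3 := (jetChart k a b).map_target hw1
  set θ := (jetChart k a b).symm w with hθ
  have e : jetChart k a b θ = w := (jetChart k a b).right_inv hw1
  rw [PartialEquiv.coe_trans, Function.comp_apply, ← hθ, ← e]
  refine (jetTrans_derivs θ.smoothNear_rep.self_of_nhds hw3.1 hw2.1 ?_ ?_).symm
  · rw [← θ.value_eq_rep]; exact hw3.2
  · rw [← θ.value_eq_rep]; exact hw2.2

theorem isOpen_jetChart_trans_source (k : ℕ) (a a' : M) (b b' : N) :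
    IsOpen ((jetChart k a b).symm.trans (jetChart k a' b') :
      PartialEquiv (JetCoord E F k) (JetCoord E F k)).source := by
  rw [jetChart_trans_source]
  have h0 : Continuous (fun w : JetCoord E F k => (w.2 0).1 0) :=
    (ContinuousMultilinearMap.apply ℝ (fun _ : Fin ((0 : Fin (k + 1)) : ℕ) => E) F 0).continuous.comp
      (continuous_subtype_val.comp ((continuous_apply 0).comp continuous_snd))
  exact (((chartAt E a).symm.trans (chartAt E a')).open_source.preimage continuous_fst).inter
    (((chartAt F b).symm.trans (chartAt F b')).open_source.preimage h0)

theorem contDiffOn_jetChart_trans (k : ℕ) (a a' : M) (b b' : N) :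
    ContDiffOn ℝ ∞ ((jetChart k a b).symm.trans (jetChart k a' b') :
      PartialEquiv (JetCoord E F k) (JetCoord E F k))
      ((jetChart k a b).symm.trans (jetChart k a' b') :
      PartialEquiv (JetCoord E F k) (JetCoord E F k)).source := by
  have := FiniteDimensional.complete ℝ F
  refine ContDiffOn.congr ?_ jetChart_trans_eq
  intro w hw
  rw [jetChart_trans_source] at hw
  exact (contDiffAt_jetTrans hw.1.1 hw.1.2 hw.2.1 hw.2.2).contDiffWithinAt

variable (E M F N) in
/-- The smooth atlas of the jet space. -/
def jetCore (k : ℕ) : ChartedSpaceCore (JetCoord E F k) (Jet E M F N k) where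
  atlas := Set.range fun c : M × N => jetChart k c.1 c.2
  chartAt θ := jetChart k θ.base θ.value
  mem_chart_source θ := ⟨mem_chart_source E θ.base, mem_chart_source F θ.value⟩
  chart_mem_atlas θ := ⟨(θ.base, θ.value), rfl⟩
  open_source := by
    rintro _ _ ⟨c, rfl⟩ ⟨c', rfl⟩
    exact isOpen_jetChart_trans_source ..
  continuousOn_toFun := by
    rintro _ _ ⟨c, rfl⟩ ⟨c', rfl⟩
    exact (contDiffOn_jetChart_trans k c.1 c'.1 c.2 c'.2).continuousOn

instance (k : ℕ) : TopologicalSpace (Jet E M F N k) := (jetCore E M F N k).toTopologicalSpace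

instance (k : ℕ) : ChartedSpace (JetCoord E F k) (Jet E M F N k) := (jetCore E M F N k).toChartedSpace

instance (k : ℕ) : IsManifold 𝓘(ℝ, JetCoord E F k) ∞ (Jet E M F N k) := by
  refine isManifold_of_core (jetCore E M F N k) ?_
  rintro _ ⟨c, rfl⟩ _ ⟨c', rfl⟩
  exact contDiffOn_jetChart_trans k c.1 c'.1 c.2 c'.2

end Jets

section MixedJets

variable {E : Type*} [NormedAddCommGroup E] [NormedSpace ℝ E]
  {M : Type*} [TopologicalSpace M] [ChartedSpace E M]
  {F₁ : Type*} [NormedAddCommGroup F₁] [NormedSpace ℝ F₁]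
  {N₁ : Type*} [TopologicalSpace N₁] [ChartedSpace F₁ N₁]
  {F₂ : Type*} [NormedAddCommGroup F₂] [NormedSpace ℝ F₂]
  {N₂ : Type*} [TopologicalSpace N₂] [ChartedSpace F₂ N₂]

variable (E M F₁ N₁ F₂ N₂) in
/-- The mixed jet space `J^{k₁,k₂}(M, N₁ × N₂) = J^{k₁}(M, N₁) ×_M J^{k₂}(M, N₂)`. -/
@[ext]
structure MixedJet (k₁ k₂ : ℕ) where
  /-- the component in `J^{k₁}(M, N₁)`, i.e. the projection `π₁` -/
  fst : Jet E M F₁ N₁ k₁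
  /-- the component in `J^{k₂}(M, N₂)`, i.e. the projection `π₂` -/
  snd : Jet E M F₂ N₂ k₂
  base_eq : fst.base = snd.base

/-- The point of `M` over which a mixed jet lies. -/
def MixedJet.base {k₁ k₂ : ℕ} (θ : MixedJet E M F₁ N₁ F₂ N₂ k₁ k₂) : M := θ.fst.base

variable (E F₁ F₂) in
/-- The mixed jet at `x` of a pair of maps. -/
def mixedJetOf (k₁ k₂ : ℕ) (s₁ : M → N₁) (s₂ : M → N₂) (x : M) :
    MixedJet E M F₁ N₁ F₂ N₂ k₁ k₂ :=
  ⟨jetOf E F₁ k₁ s₁ x, jetOf E F₂ k₂ s₂ x, rfl⟩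

variable (E F₁ F₂) in
/-- The coordinate space of mixed jets: a point of `E` and the values of all derivatives of order
at most `k₁` of a map to `F₁` and of order at most `k₂` of a map to `F₂`. -/
abbrev MixedCoord (k₁ k₂ : ℕ) : Type _ :=
  E × ((∀ i : Fin (k₁ + 1), SymMul E F₁ i) × (∀ i : Fin (k₂ + 1), SymMul E F₂ i))

/-- The projection of a jet to a jet of lower order. -/
def Jet.trunc {a b : ℕ} (_ : a ≤ b) (θ : Jet E M F₁ N₁ b) : Jet E M F₁ N₁ a :=
  jetOf E F₁ a θ.rep θ.base

theorem Jet.trunc_jetOf {a b : ℕ} (h : a ≤ b) {s : M → N₁} {x : M} (hs : SmoothNear E F₁ s x) :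
    (jetOf E F₁ b s x).trunc h = jetOf E F₁ a s x := by
  have h1 := (jetOf_eq_iff (Jet.smoothNear_rep (jetOf E F₁ b s x)) hs).1 (Jet.jetOf_rep _)
  exact (jetOf_eq_iff (Jet.smoothNear_rep (jetOf E F₁ b s x)) hs).2
    ⟨h1.1, fun i hi => h1.2 i (hi.trans h)⟩

/-- The projection of a mixed jet to a mixed jet of lower order. -/
def MixedJet.trunc {a₁ a₂ b₁ b₂ : ℕ} (h₁ : a₁ ≤ b₁) (h₂ : a₂ ≤ b₂)
    (θ : MixedJet E M F₁ N₁ F₂ N₂ b₁ b₂) : MixedJet E M F₁ N₁ F₂ N₂ a₁ a₂ :=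
  ⟨θ.fst.trunc h₁, θ.snd.trunc h₂, θ.base_eq⟩

theorem jetOf_zero_value (θ : Jet E M F₁ N₁ 0) :
    jetOf E F₁ 0 (fun _ => θ.value) θ.base = θ := by
  conv_rhs => rw [← θ.jetOf_rep]
  refine (jetOf_eq_iff (smoothNear_const _ _) θ.smoothNear_rep).2 ⟨θ.value_eq_rep, ?_⟩
  intro i hi
  obtain rfl : i = 0 := by omega
  ext v
  simp [localRep, θ.value_eq_rep]

variable (E M F₁ N₁ F₂ N₂) in
/-- The identification `J^{0,k}(M, N₁ × N₂) = N₁ × J^k(M, N₂)`. -/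
def mixedZeroEquiv (k : ℕ) : MixedJet E M F₁ N₁ F₂ N₂ 0 k ≃ N₁ × Jet E M F₂ N₂ k where
  toFun θ := (θ.fst.value, θ.snd)
  invFun w := ⟨jetOf E F₁ 0 (fun _ => w.1) w.2.base, w.2, rfl⟩
  left_inv θ := by
    ext1
    · change jetOf E F₁ 0 (fun _ => θ.fst.value) θ.snd.base = θ.fst
      rw [← θ.base_eq, jetOf_zero_value]
    · rfl
  right_inv w := by simp

variable [IsManifold 𝓘(ℝ, E) ∞ M] [IsManifold 𝓘(ℝ, F₁) ∞ N₁] [IsManifold 𝓘(ℝ, F₂) ∞ N₂]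
  [FiniteDimensional ℝ F₁] [FiniteDimensional ℝ F₂]

/-- The chart of the mixed jet space defined by charts of `M`, `N₁` and `N₂`. -/
def mixedChart (k₁ k₂ : ℕ) (a : M) (b₁ : N₁) (b₂ : N₂) :
    PartialEquiv (MixedJet E M F₁ N₁ F₂ N₂ k₁ k₂) (MixedCoord E F₁ F₂ k₁ k₂) where
  toFun θ := (chartAt E a θ.base, (jetChart k₁ a b₁ θ.fst).2, (jetChart k₂ a b₂ θ.snd).2)
  invFun w := ⟨(jetChart k₁ a b₁).symm (w.1, w.2.1), (jetChart k₂ a b₂).symm (w.1, w.2.2), rfl⟩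
  source := {θ | θ.fst ∈ (jetChart k₁ a b₁).source ∧ θ.snd ∈ (jetChart k₂ a b₂).source}
  target := {w | (w.1, w.2.1) ∈ (jetChart k₁ a b₁).target ∧
    (w.1, w.2.2) ∈ (jetChart k₂ a b₂).target}
  map_source' := by
    rintro θ ⟨h1, h2⟩
    refine ⟨(jetChart k₁ a b₁).map_source h1, ?_⟩
    have := (jetChart k₂ a b₂).map_source h2
    simp only [MixedJet.base, θ.base_eq]
    exact this
  map_target' := by
    rintro w ⟨h1, h2⟩
    exact ⟨(jetChart k₁ a b₁).map_target h1, (jetChart k₂ a b₂).map_target h2⟩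
  left_inv' := by
    rintro θ ⟨h1, h2⟩
    ext1
    · exact (jetChart k₁ a b₁).left_inv h1
    · simp only [MixedJet.base, θ.base_eq]
      exact (jetChart k₂ a b₂).left_inv h2
  right_inv' := by
    rintro w ⟨h1, h2⟩
    have e1 : jetChart k₁ a b₁ ((jetChart k₁ a b₁).symm (w.1, w.2.1)) = (w.1, w.2.1) :=
      (jetChart k₁ a b₁).right_inv h1
    have e2 : jetChart k₂ a b₂ ((jetChart k₂ a b₂).symm (w.1, w.2.2)) = (w.1, w.2.2) :=
      (jetChart k₂ a b₂).right_inv h2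
    have e3 := congrArg Prod.snd e1
    have e4 := congrArg Prod.snd e2
    exact Prod.ext (congrArg Prod.fst e1 : _) (Prod.ext e3 e4)

theorem mixedChart_trans_source (k₁ k₂ : ℕ) (a a' : M) (b₁ b₁' : N₁) (b₂ b₂' : N₂) :
    ((mixedChart k₁ k₂ a b₁ b₂).symm.trans (mixedChart k₁ k₂ a' b₁' b₂') :
      PartialEquiv (MixedCoord E F₁ F₂ k₁ k₂) (MixedCoord E F₁ F₂ k₁ k₂)).source =
    {w | (w.1, w.2.1) ∈ ((jetChart k₁ a b₁).symm.trans (jetChart k₁ a' b₁') :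
        PartialEquiv (JetCoord E F₁ k₁) (JetCoord E F₁ k₁)).source ∧
      (w.1, w.2.2) ∈ ((jetChart k₂ a b₂).symm.trans (jetChart k₂ a' b₂') :
        PartialEquiv (JetCoord E F₂ k₂) (JetCoord E F₂ k₂)).source} := by
  ext w
  exact and_and_and_comm

theorem isOpen_mixedChart_trans_source (k₁ k₂ : ℕ) (a a' : M) (b₁ b₁' : N₁) (b₂ b₂' : N₂) :
    IsOpen ((mixedChart k₁ k₂ a b₁ b₂).symm.trans (mixedChart k₁ k₂ a' b₁' b₂') :
      PartialEquiv (MixedCoord E F₁ F₂ k₁ k₂) (MixedCoord E F₁ F₂ k₁ k₂)).source := by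
  rw [mixedChart_trans_source]
  exact ((isOpen_jetChart_trans_source k₁ a a' b₁ b₁').preimage (by fun_prop)).inter
    ((isOpen_jetChart_trans_source k₂ a a' b₂ b₂').preimage (by fun_prop))

theorem contDiffOn_mixedChart_trans (k₁ k₂ : ℕ) (a a' : M) (b₁ b₁' : N₁) (b₂ b₂' : N₂) :
    ContDiffOn ℝ ∞ ((mixedChart k₁ k₂ a b₁ b₂).symm.trans (mixedChart k₁ k₂ a' b₁' b₂') :
      PartialEquiv (MixedCoord E F₁ F₂ k₁ k₂) (MixedCoord E F₁ F₂ k₁ k₂))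
      ((mixedChart k₁ k₂ a b₁ b₂).symm.trans (mixedChart k₁ k₂ a' b₁' b₂') :
      PartialEquiv (MixedCoord E F₁ F₂ k₁ k₂) (MixedCoord E F₁ F₂ k₁ k₂)).source := by
  rw [mixedChart_trans_source]
  have p1 : ContDiff ℝ ∞ (fun w : MixedCoord E F₁ F₂ k₁ k₂ => ((w.1, w.2.1) : JetCoord E F₁ k₁)) :=
    contDiff_fst.prodMk (contDiff_fst.comp contDiff_snd)
  have p2 : ContDiff ℝ ∞ (fun w : MixedCoord E F₁ F₂ k₁ k₂ => ((w.1, w.2.2) : JetCoord E F₂ k₂)) :=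
    contDiff_fst.prodMk (contDiff_snd.comp contDiff_snd)
  have h1 := (contDiffOn_jetChart_trans k₁ a a' b₁ b₁').comp p1.contDiffOn
    (s := {w : MixedCoord E F₁ F₂ k₁ k₂ | (w.1, w.2.1) ∈ ((jetChart k₁ a b₁).symm.trans
        (jetChart k₁ a' b₁') : PartialEquiv (JetCoord E F₁ k₁) (JetCoord E F₁ k₁)).source ∧
      (w.1, w.2.2) ∈ ((jetChart k₂ a b₂).symm.trans (jetChart k₂ a' b₂') :
        PartialEquiv (JetCoord E F₂ k₂) (JetCoord E F₂ k₂)).source}) (fun w hw => hw.1)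
  have h2 := (contDiffOn_jetChart_trans k₂ a a' b₂ b₂').comp p2.contDiffOn
    (s := {w : MixedCoord E F₁ F₂ k₁ k₂ | (w.1, w.2.1) ∈ ((jetChart k₁ a b₁).symm.trans
        (jetChart k₁ a' b₁') : PartialEquiv (JetCoord E F₁ k₁) (JetCoord E F₁ k₁)).source ∧
      (w.1, w.2.2) ∈ ((jetChart k₂ a b₂).symm.trans (jetChart k₂ a' b₂') :
        PartialEquiv (JetCoord E F₂ k₂) (JetCoord E F₂ k₂)).source}) (fun w hw => hw.2)
  exact (contDiff_fst.comp_contDiffOn h1).prodMk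
    ((contDiff_snd.comp_contDiffOn h1).prodMk (contDiff_snd.comp_contDiffOn h2))

variable (E M F₁ N₁ F₂ N₂) in
/-- The smooth atlas of the mixed jet space. -/
def mixedCore (k₁ k₂ : ℕ) :
    ChartedSpaceCore (MixedCoord E F₁ F₂ k₁ k₂) (MixedJet E M F₁ N₁ F₂ N₂ k₁ k₂) where
  atlas := Set.range fun c : M × N₁ × N₂ => mixedChart k₁ k₂ c.1 c.2.1 c.2.2
  chartAt θ := mixedChart k₁ k₂ θ.base θ.fst.value θ.snd.value
  mem_chart_source θ := ⟨⟨mem_chart_source E θ.fst.base, mem_chart_source F₁ θ.fst.value⟩,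
    ⟨by rw [← θ.base_eq]; exact mem_chart_source E θ.fst.base, mem_chart_source F₂ θ.snd.value⟩⟩
  chart_mem_atlas θ := ⟨(θ.base, θ.fst.value, θ.snd.value), rfl⟩
  open_source := by
    rintro _ _ ⟨c, rfl⟩ ⟨c', rfl⟩
    exact isOpen_mixedChart_trans_source k₁ k₂ c.1 c'.1 c.2.1 c'.2.1 c.2.2 c'.2.2
  continuousOn_toFun := by
    rintro _ _ ⟨c, rfl⟩ ⟨c', rfl⟩
    exact (contDiffOn_mixedChart_trans k₁ k₂ c.1 c'.1 c.2.1 c'.2.1 c.2.2 c'.2.2).continuousOn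

instance (k₁ k₂ : ℕ) : TopologicalSpace (MixedJet E M F₁ N₁ F₂ N₂ k₁ k₂) :=
  (mixedCore E M F₁ N₁ F₂ N₂ k₁ k₂).toTopologicalSpace

instance (k₁ k₂ : ℕ) :
    ChartedSpace (MixedCoord E F₁ F₂ k₁ k₂) (MixedJet E M F₁ N₁ F₂ N₂ k₁ k₂) :=
  (mixedCore E M F₁ N₁ F₂ N₂ k₁ k₂).toChartedSpace

instance (k₁ k₂ : ℕ) :
    IsManifold 𝓘(ℝ, MixedCoord E F₁ F₂ k₁ k₂) ∞ (MixedJet E M F₁ N₁ F₂ N₂ k₁ k₂) := by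
  refine isManifold_of_core (mixedCore E M F₁ N₁ F₂ N₂ k₁ k₂) ?_
  rintro _ ⟨c, rfl⟩ _ ⟨c', rfl⟩
  exact contDiffOn_mixedChart_trans k₁ k₂ c.1 c'.1 c.2.1 c'.2.1 c.2.2 c'.2.2

end MixedJets

section Cartan

variable {E : Type*} [NormedAddCommGroup E] [NormedSpace ℝ E]
  {M : Type*} [TopologicalSpace M] [ChartedSpace E M] [IsManifold 𝓘(ℝ, E) ∞ M]
  {F₁ : Type*} [NormedAddCommGroup F₁] [NormedSpace ℝ F₁] [FiniteDimensional ℝ F₁]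
  {N₁ : Type*} [TopologicalSpace N₁] [ChartedSpace F₁ N₁] [IsManifold 𝓘(ℝ, F₁) ∞ N₁]
  {F₂ : Type*} [NormedAddCommGroup F₂] [NormedSpace ℝ F₂] [FiniteDimensional ℝ F₂]
  {N₂ : Type*} [TopologicalSpace N₂] [ChartedSpace F₂ N₂] [IsManifold 𝓘(ℝ, F₂) ∞ N₂]

/-- The Cartan distribution `C^k` on `J^k(M, N₂)`: at a jet `θ` over `x`, it is spanned by the
tangent spaces at `θ` of the graphs of all jet prolongations `z ↦ j^k_z s` with `j^k_x s = θ`. -/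
def Jet.cartan {k : ℕ} (θ : Jet E M F₂ N₂ k) :
    Submodule ℝ (TangentSpace 𝓘(ℝ, JetCoord E F₂ k) θ) :=
  Submodule.span ℝ {v | ∃ s : M → N₂, SmoothNear E F₂ s θ.base ∧ jetOf E F₂ k s θ.base = θ ∧
    ∃ ξ : TangentSpace 𝓘(ℝ, E) θ.base,
      v = mfderiv 𝓘(ℝ, E) 𝓘(ℝ, JetCoord E F₂ k) (jetOf E F₂ k s) θ.base ξ}

/-- The Cartan distribution `C^{k₁,k₂} = (dπ₁)⁻¹(C^{k₁}) ∩ (dπ₂)⁻¹(C^{k₂})` on the mixed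
jet space. -/
def MixedJet.cartan {k₁ k₂ : ℕ} (θ : MixedJet E M F₁ N₁ F₂ N₂ k₁ k₂) :
    Submodule ℝ (TangentSpace 𝓘(ℝ, MixedCoord E F₁ F₂ k₁ k₂) θ) :=
  (θ.fst.cartan.comap (mfderiv 𝓘(ℝ, MixedCoord E F₁ F₂ k₁ k₂) 𝓘(ℝ, JetCoord E F₁ k₁)
      (MixedJet.fst : MixedJet E M F₁ N₁ F₂ N₂ k₁ k₂ → Jet E M F₁ N₁ k₁) θ).toLinearMap) ⊓
    (θ.snd.cartan.comap (mfderiv 𝓘(ℝ, MixedCoord E F₁ F₂ k₁ k₂) 𝓘(ℝ, JetCoord E F₂ k₂)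
      (MixedJet.snd : MixedJet E M F₁ N₁ F₂ N₂ k₁ k₂ → Jet E M F₂ N₂ k₂) θ).toLinearMap)

variable (E M F₂ N₂) in
/-- Diffeomorphisms of `J^k(M, N₂)`. -/
abbrev JetDiffeo (k : ℕ) : Type _ :=
  Jet E M F₂ N₂ k ≃ₘ⟮𝓘(ℝ, JetCoord E F₂ k), 𝓘(ℝ, JetCoord E F₂ k)⟯ Jet E M F₂ N₂ k

variable (E M F₁ N₁ F₂ N₂) in
/-- Diffeomorphisms of `J^{k₁,k₂}(M, N₁ × N₂)`. -/
abbrev MixedJetDiffeo (k₁ k₂ : ℕ) : Type _ :=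
  MixedJet E M F₁ N₁ F₂ N₂ k₁ k₂
    ≃ₘ⟮𝓘(ℝ, MixedCoord E F₁ F₂ k₁ k₂), 𝓘(ℝ, MixedCoord E F₁ F₂ k₁ k₂)⟯
      MixedJet E M F₁ N₁ F₂ N₂ k₁ k₂

/-- A Lie transformation of `J^k(M, N₂)`: a diffeomorphism preserving the Cartan distribution.
For `k = 1` and `dim N₂ = 1` these are the contact transformations. -/
def IsLie {k : ℕ} (f : JetDiffeo E M F₂ N₂ k) : Prop :=
  ∀ θ, θ.cartan.map (mfderiv 𝓘(ℝ, JetCoord E F₂ k) 𝓘(ℝ, JetCoord E F₂ k) f θ).toLinearMap =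
    (f θ).cartan

/-- A Lie transformation of `J^{k₁,k₂}(M, N₁ × N₂)`: a diffeomorphism preserving the Cartan
distribution. -/
def IsMixedLie {k₁ k₂ : ℕ} (f : MixedJetDiffeo E M F₁ N₁ F₂ N₂ k₁ k₂) : Prop :=
  ∀ θ, θ.cartan.map (mfderiv 𝓘(ℝ, MixedCoord E F₁ F₂ k₁ k₂)
    𝓘(ℝ, MixedCoord E F₁ F₂ k₁ k₂) f θ).toLinearMap = (f θ).cartan

/-- `g : J^b → J^b` is the prolongation `f^{(b-a)}` of `f : J^a → J^a`: it covers `f` and, if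
`a < b`, for every `s` the transformation `f` maps the graph of `j^a s` near `j^a_x s` into the
graph of `j^a t` for some local map `t`, and `g` maps `j^b_x s` to the `b`-jet of `t`. -/
def IsProlongation {a b : ℕ} (h : a ≤ b) (f : Jet E M F₂ N₂ a → Jet E M F₂ N₂ a)
    (g : Jet E M F₂ N₂ b → Jet E M F₂ N₂ b) : Prop :=
  (∀ θ, (g θ).trunc h = f (θ.trunc h)) ∧
  (a < b → ∀ (x : M) (s : M → N₂), SmoothNear E F₂ s x →
    ∃ t : M → N₂, SmoothNear E F₂ t (f (jetOf E F₂ a s x)).base ∧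
      (∀ᶠ z in 𝓝 x, f (jetOf E F₂ a s z) = jetOf E F₂ a t (f (jetOf E F₂ a s z)).base) ∧
      g (jetOf E F₂ b s x) = jetOf E F₂ b t (f (jetOf E F₂ a s x)).base)

/-- `g : J^{b₁,b₂} → J^{b₁,b₂}` is the prolongation of `f : J^{a₁,a₂} → J^{a₁,a₂}`
(of order `b₁ - a₁ = b₂ - a₂`). -/
def IsMixedProlongation {a₁ a₂ b₁ b₂ : ℕ} (h₁ : a₁ ≤ b₁) (h₂ : a₂ ≤ b₂)
    (f : MixedJet E M F₁ N₁ F₂ N₂ a₁ a₂ → MixedJet E M F₁ N₁ F₂ N₂ a₁ a₂)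
    (g : MixedJet E M F₁ N₁ F₂ N₂ b₁ b₂ → MixedJet E M F₁ N₁ F₂ N₂ b₁ b₂) : Prop :=
  (∀ θ, (g θ).trunc h₁ h₂ = f (θ.trunc h₁ h₂)) ∧
  (a₁ < b₁ → ∀ (x : M) (s₁ : M → N₁) (s₂ : M → N₂), SmoothNear E F₁ s₁ x → SmoothNear E F₂ s₂ x →
    ∃ (t₁ : M → N₁) (t₂ : M → N₂),
      SmoothNear E F₁ t₁ (f (mixedJetOf E F₁ F₂ a₁ a₂ s₁ s₂ x)).base ∧
      SmoothNear E F₂ t₂ (f (mixedJetOf E F₁ F₂ a₁ a₂ s₁ s₂ x)).base ∧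
      (∀ᶠ z in 𝓝 x, f (mixedJetOf E F₁ F₂ a₁ a₂ s₁ s₂ z) =
        mixedJetOf E F₁ F₂ a₁ a₂ t₁ t₂ (f (mixedJetOf E F₁ F₂ a₁ a₂ s₁ s₂ z)).base) ∧
      g (mixedJetOf E F₁ F₂ b₁ b₂ s₁ s₂ x) =
        mixedJetOf E F₁ F₂ b₁ b₂ t₁ t₂ (f (mixedJetOf E F₁ F₂ a₁ a₂ s₁ s₂ x)).base)

/-- `g : J^k(M, N₂) → J^k(M, N₂)` is the lift `f^{(k)}` of the point transformation
`f : M × N₂ → M × N₂`: it covers `f` and, if `0 < k`, for every `s` the transformation `f` maps the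
graph of `s` near `(x, s x)` into the graph of some local map `t`, and `g` maps `j^k_x s` to the
`k`-jet of `t`. -/
def IsPointLift {k : ℕ} (f : M × N₂ → M × N₂) (g : Jet E M F₂ N₂ k → Jet E M F₂ N₂ k) : Prop :=
  (∀ θ, ((g θ).base, (g θ).value) = f (θ.base, θ.value)) ∧
  (0 < k → ∀ (x : M) (s : M → N₂), SmoothNear E F₂ s x →
    ∃ t : M → N₂, SmoothNear E F₂ t (f (x, s x)).1 ∧
      (∀ᶠ z in 𝓝 x, (f (z, s z)).2 = t (f (z, s z)).1) ∧
      g (jetOf E F₂ k s x) = jetOf E F₂ k t (f (x, s x)).1)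

end Cartan

end JetSpace

end

/-! A Lie transformation preserves every object that can be built from the Cartan distribution
alone, and the projections between jet spaces are such objects. In jet coordinates the Cartan
distribution of order `a` is the kernel of the vector-valued form `θ` with components `dp_i -
p_{i+1} ⌟ dx`, `i < a`, whose coefficients are linear in the coordinates. If a map `G` preserves
`ker θ`, then `G*θ = L θ`, and `L` intertwines the restrictions of `dθ` to the kernels
(`exists_intertwining`). Three invariants result.

The derived distribution lowers both orders by one, truncated at zero (`PreservesNear.lower`). This
rests on the fact that contractions span the symmetric maps (`span_contract`). The Cauchy
characteristics of order `(0, a)`, `a > 0`, are the vertical vectors over `J^a(M, N₂)`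
(`PreservesNear.sndVertical`). If `dim N₂ > 1`, the vectors of rank at most one in order `(0, 1)`
span the vertical vectors over `J^0(M, N₂)` (`PreservesNear.sndVertical_zero`). For `dim N₂ = 1`
every vector has rank at most one, so this last step fails, and this leaves room for contact
transformations.

For the first claim put `d = k₂ - k₁ > 0`. After `k₁` derivations the order is `(0, d)`. Its
characteristics, intersected with the distribution of order `(1, d + 1)`, are the vertical vectors
over `J^{0,d}`. Thus the transformation permutes the fibres over `J^{0,d}` and descends to it
(`exists_descent`). The image of the graph of a jet prolongation is tangent to the Cartan
distribution, and it is transversal to the fibres over `M` since Cartan vectors without horizontal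
part are vertical over `J^{0,d}`. Such a submanifold is again the graph of a jet prolongation
(`exists_eq_derivs`), which gives the prolongation property.

For the second claim the same is done for `J^{0,k} → J^j(M, N₂)` with `j = k` and `j = 1`, and with
`j = 0` if `dim N₂ > 1`. The fibres contain `N₁` as a factor, so its connectedness is needed to pass
from vertical vectors to fibres. -/

noncomputable section

namespace JetSpace

set_option linter.unusedSectionVars false

/-! ### Contraction of symmetric multilinear maps. -/

section CoordinateAlgebra

variable {E F : Type*} [NormedAddCommGroup E] [NormedSpace ℝ E] [NormedAddCommGroup F]
  [NormedSpace ℝ F]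

variable (E F) in
/-- Contraction of a symmetric multilinear map with a vector. -/
def contract (i : ℕ) : SymMul E F (i + 1) →L[ℝ] E →L[ℝ] SymMul E F i :=
  (ContinuousLinearMap.compL ℝ E (E [×i]→L[ℝ] F) (SymMul E F i) (symProj E F i)) ∘L
    (continuousMultilinearCurryLeftEquiv ℝ (fun _ : Fin (i + 1) => E)
      F).toContinuousLinearEquiv.toContinuousLinearMap ∘L (SymMul E F (i + 1)).subtypeL

/-- A permutation of the last `i` slots extends to all `i + 1` slots by fixing the first. Hence
`symProj` in `contract` changes nothing and only lands the result in the subtype. -/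
theorem curryLeft_mem_symMul {i : ℕ} {p : E [×(i + 1)]→L[ℝ] F} (hp : p ∈ SymMul E F (i + 1))
    (ξ : E) : p.curryLeft ξ ∈ SymMul E F i := by
  intro σ v
  have h := hp (Equiv.Perm.decomposeFin.symm (0, σ)) (Fin.cons ξ v : Fin (i + 1) → E)
  rw [ContinuousMultilinearMap.curryLeft_apply, ContinuousMultilinearMap.curryLeft_apply, ← h]
  congr 1
  ext j
  refine Fin.cases ?_ (fun j => ?_) j <;> simp

theorem contract_eq_symProj {i : ℕ} (p : SymMul E F (i + 1)) (ξ : E) :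
    contract E F i p ξ = symProj E F i (p.1.curryLeft ξ) := rfl

theorem contract_apply {i : ℕ} (p : SymMul E F (i + 1)) (ξ : E) (v : Fin i → E) :
    (contract E F i p ξ).1 v = p.1 (Fin.cons ξ v) := by
  rw [contract_eq_symProj, coe_symProj, symmetrize_of_mem (curryLeft_mem_symMul p.2 ξ)]
  rfl

/-- By symmetry the vector may equally be inserted in the last slot. Inserting one vector in front
and the other at the end makes double contractions commute. -/
theorem contract_snoc {i : ℕ} (p : SymMul E F (i + 1)) (ξ : E) (v : Fin i → E) :
    (contract E F i p ξ).1 v = p.1 (Fin.snoc v ξ) := by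
  rw [contract_apply, Fin.snoc_eq_cons_rotate]
  exact (p.2 (finRotate (i + 1)) _).symm

theorem symMul_ext {i : ℕ} {p q : SymMul E F i} (h : ∀ v, p.1 v = q.1 v) : p = q :=
  Subtype.ext (ContinuousMultilinearMap.ext h)

/-- A symmetric multilinear map is twice contracted in any order. -/
theorem contract_comm {i : ℕ} (p : SymMul E F (i + 2)) (ξ η : E) :
    contract E F i (contract E F (i + 1) p ξ) η = contract E F i (contract E F (i + 1) p η) ξ := by
  refine symMul_ext fun v => ?_
  rw [contract_apply, contract_snoc, contract_snoc, contract_apply, Fin.cons_snoc_eq_snoc_cons]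

variable (E) in
/-- The symmetric map `v ↦ (∏ λ (v i)) • y`. -/
def powForm (i : ℕ) (l : E →L[ℝ] ℝ) (y : F) : SymMul E F i :=
  ⟨((ContinuousMultilinearMap.mkPiAlgebra ℝ (Fin i) ℝ).compContinuousLinearMap
    fun _ => l).smulRight y, by
    intro σ v
    simp only [ContinuousMultilinearMap.smulRight_apply,
      ContinuousMultilinearMap.compContinuousLinearMap_apply,
      ContinuousMultilinearMap.mkPiAlgebra_apply, Function.comp_apply]
    rw [Equiv.prod_comp σ (fun j => l (v j))]⟩

theorem powForm_apply (i : ℕ) (l : E →L[ℝ] ℝ) (y : F) (v : Fin i → E) :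
    (powForm E i l y).1 v = (∏ j, l (v j)) • y := rfl

theorem contract_powForm (i : ℕ) (l : E →L[ℝ] ℝ) (y : F) (ξ : E) :
    contract E F i (powForm E (i + 1) l y) ξ = l ξ • powForm E i l y := by
  refine symMul_ext fun v => ?_
  rw [contract_apply, powForm_apply]
  simp [Fin.prod_univ_succ, powForm_apply, mul_smul]

/-- A power of a functional not vanishing at `ξ` contracts to a nonzero multiple of a lower power.
This forces characteristic vectors to have no horizontal part. -/
theorem exists_contract_ne_zero [Nontrivial F] (i : ℕ) {ξ : E} (hξ : ξ ≠ 0) :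
    ∃ p : SymMul E F (i + 1), contract E F i p ξ ≠ 0 := by
  obtain ⟨l, hl⟩ := exists_dual_vector ℝ ξ (norm_ne_zero_iff.2 hξ)
  obtain ⟨y, hy⟩ := exists_ne (0 : F)
  have hlξ : l ξ ≠ 0 := by
    rw [hl.2]; simpa using hξ
  refine ⟨powForm E (i + 1) l y, fun h => ?_⟩
  rw [contract_powForm] at h
  have h2 := congrArg (fun q : SymMul E F i => q.1 (fun _ => ξ)) h
  simp only [Submodule.coe_smul, smul_apply, powForm_apply] at h2
  simp [hlξ, hy] at h2

theorem eq_zero_of_contract_eq_zero {i : ℕ} {p : SymMul E F (i + 1)}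
    (h : ∀ ξ, contract E F i p ξ = 0) : p = 0 := by
  refine symMul_ext fun v => ?_
  have := congrArg (fun q : SymMul E F i => q.1 (Fin.tail v)) (h (v 0))
  simpa [contract_apply] using this

/-- The derivative of the derivatives of a function. -/
theorem hasFDerivAt_derivs {k : ℕ} {f : E → F} {x : E} (hf : ContDiffAt ℝ ∞ f x)
    (i : Fin (k + 1)) (j : ℕ) (hj : i + 1 ≤ j) :
    HasFDerivAt (fun y => derivs k f y i)
      (contract E F i (derivs j f x ⟨i + 1, Nat.lt_succ_of_le hj⟩)) x := by
  have hd : DifferentiableAt ℝ (iteratedFDeriv ℝ i f) x :=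
    (hf.iteratedFDeriv_right (m := 1) (i := i) (by exact_mod_cast le_top)).differentiableAt
      one_ne_zero
  have h := (symProj E F i).hasFDerivAt.comp x hd.hasFDerivAt
  convert! h using 1
  ext1 ξ
  rw [contract_eq_symProj]
  simp only [derivs, coe_symProj]
  rw [symmetrize_of_mem (iteratedFDeriv_mem_symMul _ (hf.of_le (by exact_mod_cast le_top)))]
  rw [ContinuousLinearMap.comp_apply]
  congr 1

theorem contDiffAt_derivs {k : ℕ} {f : E → F} {x : E} (hf : ContDiffAt ℝ ∞ f x) :
    ContDiffAt ℝ ∞ (derivs k f) x :=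
  contDiffAt_pi.2 fun i => (symProj E F i).contDiff.contDiffAt.comp x
    (hf.iteratedFDeriv_right (m := ∞) (i := i) le_rfl)

/-- Euler's identity: both sides are the derivative of `t ↦ f (t • x)` at `t = 1`. -/
theorem fderiv_homogeneous {f : E → F} {n : ℕ} (hf : Differentiable ℝ f)
    (hh : ∀ (t : ℝ) x, f (t • x) = t ^ n • f x) (x : E) : fderiv ℝ f x x = (n : ℝ) • f x := by
  have h1 : HasDerivAt (fun t : ℝ => f (t • x)) (fderiv ℝ f x x) 1 := by
    have h3 : HasDerivAt (fun t : ℝ => t • x) x 1 := by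
      simpa using (hasDerivAt_id (1 : ℝ)).smul_const x
    have h2 := (hf ((1 : ℝ) • x)).hasFDerivAt.comp_hasDerivAt (1 : ℝ) h3
    simpa [Function.comp_def] using h2
  have h4 : HasDerivAt (fun t : ℝ => f (t • x)) ((n : ℝ) • f x) 1 := by
    simp only [hh]
    simpa using (hasDerivAt_pow n (1 : ℝ)).smul_const (f x)
  exact h1.unique h4

theorem iteratedFDeriv_smul_const_fun {f : E → F} (hf : ContDiff ℝ ∞ f) (c : ℝ) (i : ℕ) (x : E) :
    iteratedFDeriv ℝ i (fun y => c • f y) x = c • iteratedFDeriv ℝ i f x :=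
  iteratedFDeriv_const_smul_apply (hf.of_le (by exact_mod_cast le_top)).contDiffAt

/-- Every symmetric multilinear map is a combination of contractions. -/
theorem span_contract [FiniteDimensional ℝ E] [Nontrivial E] [CompleteSpace F] (i : ℕ) :
    Submodule.span ℝ {q : SymMul E F i | ∃ r ξ, q = contract E F i r ξ} = ⊤ := by
  rw [eq_top_iff]
  rintro q -
  -- `f` is the homogeneous polynomial of degree `i` with `i`-th derivative `q`. By Euler, `∑ ∂_j
  -- (x_j f) = (n + i) f` with `n = dim E`. Differentiating this `i` times at `0` exhibits `q` as a
  -- combination of contractions.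
  let p : ∀ j : Fin (i + 1), SymMul E F j := Function.update 0 (Fin.last i) q
  set f : E → F := taylorPoly 0 p with hf
  have hfs : ContDiff ℝ ∞ f := contDiff_taylorPoly 0 p
  have hfd : Differentiable ℝ f := hfs.differentiable (by simp)
  have hfx : ∀ x, f x = ((Nat.factorial i : ℝ)⁻¹) • q.1 (fun _ => x) := by
    intro x
    rw [hf]
    unfold taylorPoly
    rw [Finset.sum_eq_single (Fin.last i)]
    · simp only [p, Function.update_self, sub_zero]
      rfl
    · intro j _ hj
      simp [p, Function.update_of_ne hj]
    · simp
  have hhom : ∀ (t : ℝ) x, f (t • x) = t ^ i • f x := by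
    intro t x
    rw [hfx, hfx, smul_comm]
    congr 1
    have := q.1.map_smul_univ (fun _ => t) (fun _ => x)
    simpa using this
  have hfi : iteratedFDeriv ℝ i f 0 = q.1 := by
    have := iteratedFDeriv_taylorPoly 0 p (Fin.last i)
    simp only [p, Function.update_self] at this
    exact this
  let b := Module.finBasis ℝ E
  let l : Fin (Module.finrank ℝ E) → E →L[ℝ] ℝ := fun j => LinearMap.toContinuousLinearMap (b.coord j)
  let g : Fin (Module.finrank ℝ E) → E → F := fun j x => l j x • f x
  have hg : ∀ j, ContDiff ℝ ∞ (g j) := fun j => (l j).contDiff.smul hfs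
  -- `r j` is the derivative of order `i + 1` of `x_j f`; contracting it with `b j` gives the `i`-th
  -- derivative of `∂_j (x_j f)`.
  let r : Fin (Module.finrank ℝ E) → SymMul E F (i + 1) := fun j =>
    ⟨iteratedFDeriv ℝ (i + 1) (g j) 0, iteratedFDeriv_mem_symMul _
      ((hg j).of_le (by exact_mod_cast le_top)).contDiffAt⟩
  have hr : ∀ j v, (contract E F i (r j) (b j)).1 v =
      iteratedFDeriv ℝ i (fun x => fderiv ℝ (g j) x (b j)) 0 v := by
    intro j v
    rw [contract_snoc]
    change iteratedFDeriv ℝ (i + 1) (g j) 0 _ = _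
    rw [iteratedFDeriv_succ_apply_right]
    have h1 : ContDiffAt ℝ i (fderiv ℝ (g j)) 0 :=
      ((hg j).fderiv_right (m := ∞) le_rfl).contDiffAt.of_le (by exact_mod_cast le_top)
    have h2 := (ContinuousLinearMap.apply ℝ F (b j)).iteratedFDeriv_comp_left h1 (i := i) le_rfl
    have h3 := congrArg (fun L => L v) h2
    simp only [Fin.init_snoc, Fin.snoc_last]
    exact h3.symm
  have hsum : (fun x => ∑ j, fderiv ℝ (g j) x (b j)) =
      fun x => ((Module.finrank ℝ E : ℝ) + i) • f x := by
    ext x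
    have : ∀ j, fderiv ℝ (g j) x (b j) = l j x • fderiv ℝ f x (b j) + f x := by
      intro j
      have h1 := ((l j).hasFDerivAt (x := x)).smul (hfd x).hasFDerivAt
      rw [show g j = fun x => l j x • f x from rfl]
      have h2 : fderiv ℝ (fun x => l j x • f x) x = _ := h1.fderiv
      rw [h2]
      simp [l]
    simp only [this, Finset.sum_add_distrib, add_smul, Finset.sum_const, Finset.card_univ,
      Fintype.card_fin]
    rw [← fderiv_homogeneous hfd hhom x, add_comm]
    congr 1
    · simp [Nat.cast_smul_eq_nsmul]
    · conv_rhs => rw [← b.sum_repr x]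
      rw [b.sum_repr x]
      conv_rhs => enter [2]; rw [← b.sum_repr x]
      rw [map_sum]
      simp [l]
  have hsumr : ∑ j, contract E F i (r j) (b j) = ((Module.finrank ℝ E : ℝ) + i) • q := by
    refine symMul_ext fun v => ?_
    rw [AddSubmonoidClass.coe_finsetSum, sum_apply]
    simp only [hr]
    have h1 : iteratedFDeriv ℝ i (fun x => ∑ j, fderiv ℝ (g j) x (b j)) 0 =
        ∑ j, iteratedFDeriv ℝ i (fun x => fderiv ℝ (g j) x (b j)) 0 := by
      have h2 : ∀ j ∈ Finset.univ, ContDiff ℝ i (fun x => fderiv ℝ (g j) x (b j)) := fun j _ =>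
        (((hg j).fderiv_right (m := ∞) le_rfl).clm_apply (contDiff_const (c := b j))).of_le
          (by exact_mod_cast le_top)
      rw [iteratedFDeriv_sum h2]
      simp
    rw [← sum_apply, ← h1, hsum, iteratedFDeriv_smul_const_fun hfs, hfi]
    rfl
  -- For `i = 0` this needs `E` to be nonzero.
  have hpos : ((Module.finrank ℝ E : ℝ) + i) ≠ 0 := by
    have : 0 < Module.finrank ℝ E := Module.finrank_pos
    positivity
  have : q = ((Module.finrank ℝ E : ℝ) + i)⁻¹ • ∑ j, contract E F i (r j) (b j) := by
    rw [hsumr, smul_smul, inv_mul_cancel₀ hpos, one_smul]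
  rw [this]
  exact Submodule.smul_mem _ _ (Submodule.sum_mem _ fun j _ => Submodule.subset_span ⟨_, _, rfl⟩)

end CoordinateAlgebra

/-! ### Invariants of the kernel of a form with linear coefficients. -/

section Intertwining

variable {H Q : Type*} [NormedAddCommGroup H] [NormedSpace ℝ H] [NormedAddCommGroup Q]
  [NormedSpace ℝ Q] {A : H →L[ℝ] Q} {B : H →L[ℝ] H →L[ℝ] Q} {σ : Q →L[ℝ] H} {G : H → H} {w : H}

/-- A local map preserving the kernels of the forms `θ_w = A - B w` intertwines the restrictions of
their exterior derivatives to these kernels. -/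
theorem exists_intertwining (hσ : ∀ w q, A (σ q) - B w (σ q) = q) (hG : ContDiffAt ℝ 2 G w)
    (hK : ∀ᶠ w' in 𝓝 w, ∀ v, A v = B w' v →
      A (fderiv ℝ G w' v) = B (G w') (fderiv ℝ G w' v)) :
    ∃ L : Q →L[ℝ] Q,
      (∀ v, A (fderiv ℝ G w v) - B (G w) (fderiv ℝ G w v) = L (A v - B w v)) ∧
      ∀ u v, A u = B w u → A v = B w v →
        B (fderiv ℝ G w v) (fderiv ℝ G w u) - B (fderiv ℝ G w u) (fderiv ℝ G w v) =
          L (B v u - B u v) := by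
  set D := fderiv ℝ G with hD
  have hGd : HasFDerivAt G (D w) w := (hG.differentiableAt (by simp)).hasFDerivAt
  have hDd : DifferentiableAt ℝ D w :=
    (hG.fderiv_right (m := 1) (by norm_num [one_add_one_eq_two])).differentiableAt one_ne_zero
  set D2 := fderiv ℝ D w with hD2
  have hD2d : HasFDerivAt D D2 w := hDd.hasFDerivAt
  have hsym : ∀ u v, D2 u v = D2 v u := fun u v => (hG.isSymmSndFDerivAt (by simp)).eq u v
  -- `Θ` is the pull-back under `G` of `θ_w = A - B w`. It vanishes on `ker θ`, and `v - σ (θ v)`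
  -- lies in that kernel, so `Θ = (Θ ∘ σ) ∘ θ`. The wanted `L` is `Θ w ∘ σ`.
  let Θ : H → H →L[ℝ] Q := fun w' => (A - B (G w')) ∘L D w'
  have hΘ1 : HasFDerivAt (fun w' => A - B (G w')) (-(B ∘L D w)) w := by
    convert! (hasFDerivAt_const A w).sub (B.hasFDerivAt.comp w hGd) using 1
    simp
  have hΘd := hΘ1.clm_comp hD2d
  have hΘker : ∀ᶠ w' in 𝓝 w, ∀ v, Θ w' v = Θ w' (σ (A v - B w' v)) := by
    filter_upwards [hK] with w' h v
    have h1 := h (v - σ (A v - B w' v)) (by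
      have := hσ w' (A v - B w' v)
      rw [map_sub A, map_sub (B w'), sub_eq_sub_iff_sub_eq_sub]
      exact this.symm)
    rw [← sub_eq_zero, ← map_sub]
    change A (D w' _) - B (G w') (D w' _) = 0
    rw [h1, sub_self]
  refine ⟨Θ w ∘L σ, fun v => hΘker.self_of_nhds v, fun u v hu hv => ?_⟩
  -- The identity `Θ v = Θ (σ (θ v))` is differentiated at `w` in the direction `u`. Since `θ_w v =
  -- 0`, the derivative of `Θ` drops out on the right. Antisymmetrising in `u` and `v` cancels the
  -- second derivative of `G` and leaves `dθ (u, v) = B v u - B u v`.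
  have key : ∀ u v, A v = B w v →
      A (D2 u v) - B (G w) (D2 u v) - B (D w u) (D w v) = -(Θ w (σ (B u v))) := by
    intro u v hv
    have h1 : HasFDerivAt (fun w' => Θ w' v) _ w := hΘd.clm_apply (hasFDerivAt_const v w)
    have h2 : HasFDerivAt (fun w' => σ (A v - B w' v)) (-(σ ∘L (B.flip v))) w := by
      have h3 : HasFDerivAt (fun w' => A v - B w' v) (-(B.flip v)) w := by
        convert! (hasFDerivAt_const (A v) w).sub (B.flip v).hasFDerivAt using 1
        simp
      convert! σ.hasFDerivAt.comp w h3 using 1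
      simp
    have h4 : HasFDerivAt (fun w' => Θ w' (σ (A v - B w' v))) _ w := hΘd.clm_apply h2
    have h5 : (fun w' => Θ w' v) =ᶠ[𝓝 w] fun w' => Θ w' (σ (A v - B w' v)) := by
      filter_upwards [hΘker] with w' h using h v
    have h6 := (h1.congr_of_eventuallyEq h5.symm).unique h4
    have h7 := congrArg (fun L => L u) h6
    simp only [hv, sub_self, map_zero] at h7
    simp at h7
    simpa [Θ, sub_eq_add_neg, add_comm] using h7
  have k1 := key u v hv
  have k2 := key v u hu
  rw [hsym v u] at k2
  have k3 : B (D w v) (D w u) - B (D w u) (D w v) = -(Θ w (σ (B u v))) - -(Θ w (σ (B v u))) := by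
    rw [← k1, ← k2]; abel
  rw [k3, map_sub]
  simp only [ContinuousLinearMap.comp_apply]
  abel

/-- The derived distribution is preserved. -/
theorem derived_preserved (hσ : ∀ w q, A (σ q) - B w (σ q) = q) (hG : ContDiffAt ℝ 2 G w)
    (hK : ∀ᶠ w' in 𝓝 w, ∀ v, A v = B w' v →
      A (fderiv ℝ G w' v) = B (G w') (fderiv ℝ G w' v))
    {S : Submodule ℝ Q}
    (h1 : S ≤ Submodule.span ℝ {q | ∃ u v, A u = B w u ∧ A v = B w v ∧ q = B v u - B u v})
    (h2 : ∀ u v, A u = B (G w) u → A v = B (G w) v → B v u - B u v ∈ S) {v : H}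
    (hv : A v - B w v ∈ S) :
    A (fderiv ℝ G w v) - B (G w) (fderiv ℝ G w v) ∈ S := by
  obtain ⟨L, hL1, hL2⟩ := exists_intertwining hσ hG hK
  rw [hL1]
  -- `L` sends values of `dθ` on the kernel at `w` to values of `dθ` on the kernel at `G w`, and
  -- these lie in `S`. As `S` is contained in the span of the former, `L` maps `S` into itself.
  have h3 : Submodule.span ℝ {q | ∃ u v, A u = B w u ∧ A v = B w v ∧ q = B v u - B u v} ≤
      S.comap L.toLinearMap := by
    rw [Submodule.span_le]
    rintro _ ⟨u, v, hu, hv, rfl⟩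
    change L _ ∈ S
    rw [← hL2 u v hu hv]
    exact h2 _ _ (hK.self_of_nhds u hu) (hK.self_of_nhds v hv)
  exact h3 (h1 hv)

/-- Vectors whose contraction with the exterior derivative has rank at most one are preserved. -/
theorem rank_one_preserved (hσ : ∀ w q, A (σ q) - B w (σ q) = q) (hG : ContDiffAt ℝ 2 G w)
    (hK : ∀ᶠ w' in 𝓝 w, ∀ v, A v = B w' v →
      A (fderiv ℝ G w' v) = B (G w') (fderiv ℝ G w' v))
    (hsurj : ∀ u', A u' = B (G w) u' → ∃ u, A u = B w u ∧ fderiv ℝ G w u = u')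
    {v : H} (hv : A v = B w v) (h : ∃ q, ∀ u, A u = B w u → ∃ c : ℝ, B v u - B u v = c • q) :
    ∃ q, ∀ u, A u = B (G w) u →
      ∃ c : ℝ, B (fderiv ℝ G w v) u - B u (fderiv ℝ G w v) = c • q := by
  obtain ⟨L, -, hL2⟩ := exists_intertwining hσ hG hK
  obtain ⟨q, hq⟩ := h
  refine ⟨L q, fun u' hu' => ?_⟩
  -- Every test vector at `G w` is the image of one at `w`, so the rank of the contraction cannot
  -- grow.
  obtain ⟨u, hu, rfl⟩ := hsurj u' hu'
  obtain ⟨c, hc⟩ := hq u hu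
  exact ⟨c, by rw [hL2 u v hu hv, hc, map_smul]⟩

/-- Cauchy characteristics are preserved. -/
theorem characteristic_preserved (hσ : ∀ w q, A (σ q) - B w (σ q) = q) (hG : ContDiffAt ℝ 2 G w)
    (hK : ∀ᶠ w' in 𝓝 w, ∀ v, A v = B w' v →
      A (fderiv ℝ G w' v) = B (G w') (fderiv ℝ G w' v))
    (hsurj : ∀ u', A u' = B (G w) u' → ∃ u, A u = B w u ∧ fderiv ℝ G w u = u')
    {v : H} (hv : A v = B w v) (h : ∀ u, A u = B w u → B v u = B u v)
    {u : H} (hu : A u = B (G w) u) : B (fderiv ℝ G w v) u = B u (fderiv ℝ G w v) := by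
  obtain ⟨L, -, hL2⟩ := exists_intertwining hσ hG hK
  obtain ⟨u, hu', rfl⟩ := hsurj u hu
  rw [← sub_eq_zero, hL2 u v hu' hv, h u hu', sub_self, map_zero]

end Intertwining

/-! ### The contact forms of pure jets in coordinates. -/

section CoordinateCartan

variable {E F F₁ F₂ : Type*} [NormedAddCommGroup E] [NormedSpace ℝ E] [NormedAddCommGroup F]
  [NormedSpace ℝ F] [NormedAddCommGroup F₁] [NormedSpace ℝ F₁] [NormedAddCommGroup F₂]
  [NormedSpace ℝ F₂] {a k : ℕ}

variable (E F) in
/-- The contact forms of order less than `a` are `formA - formB w`. -/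
def formA (h : a ≤ k) : JetCoord E F k →L[ℝ] (∀ i : Fin a, SymMul E F i) :=
  ContinuousLinearMap.pi fun i =>
    (ContinuousLinearMap.proj (R := ℝ) (φ := fun i : Fin (k + 1) => SymMul E F i)
      ⟨i, by omega⟩) ∘L ContinuousLinearMap.snd ℝ _ _

variable (E F) in
/-- The part of the contact forms which is linear in the coefficients. -/
def formB (h : a ≤ k) : JetCoord E F k →L[ℝ] JetCoord E F k →L[ℝ] (∀ i : Fin a, SymMul E F i) :=
  ∑ i : Fin a, (ContinuousLinearMap.compL ℝ (JetCoord E F k) (SymMul E F i)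
      (∀ i : Fin a, SymMul E F i)
      (ContinuousLinearMap.single ℝ (fun i : Fin a => SymMul E F i) i)) ∘L
    ((contract E F i ∘L (ContinuousLinearMap.proj (R := ℝ)
      (φ := fun i : Fin (k + 1) => SymMul E F i) ⟨i + 1, by omega⟩) ∘L
        ContinuousLinearMap.snd ℝ _ _).bilinearComp (ContinuousLinearMap.id ℝ _)
          (ContinuousLinearMap.fst ℝ _ _))

theorem formA_apply (h : a ≤ k) (v : JetCoord E F k) (i : Fin a) :
    formA E F h v i = v.2 ⟨i, by omega⟩ := rfl

theorem formB_apply (h : a ≤ k) (w v : JetCoord E F k) (i : Fin a) :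
    formB E F h w v i = contract E F i (w.2 ⟨i + 1, by omega⟩) v.1 := by
  simp only [formB, sum_apply, ContinuousLinearMap.comp_apply, ContinuousLinearMap.compL_apply,
    ContinuousLinearMap.single_apply, Finset.sum_apply]
  rw [Finset.sum_eq_single i]
  · rw [Pi.single_eq_same]; rfl
  · intro j _ hj
    rw [Pi.single_eq_of_ne (Ne.symm hj)]
  · simp

/-- The coordinate expression of the Cartan distribution of order `a`, pulled back to jets of
order `k`. -/
def coordCartan (h : a ≤ k) (w : JetCoord E F k) : Submodule ℝ (JetCoord E F k) :=
  (formA E F h - formB E F h w).ker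

/-- The equations are `dp_i = p_{i+1} ⌟ dx` for `i < a`; the entries of order at least `a` are free.
-/
theorem mem_coordCartan (h : a ≤ k) {w v : JetCoord E F k} :
    v ∈ coordCartan h w ↔ ∀ (i : ℕ) (hi : i < a),
      v.2 ⟨i, by omega⟩ = contract E F i (w.2 ⟨i + 1, by omega⟩) v.1 := by
  rw [coordCartan, LinearMap.mem_ker]
  change formA E F h v - formB E F h w v = 0 ↔ _
  rw [sub_eq_zero, funext_iff]
  simp only [formA_apply, formB_apply]
  exact ⟨fun h i hi => h ⟨i, hi⟩, fun h i => h i i.2⟩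

/-- The vector in the Cartan distribution with given horizontal part and given components of order
at least `a`. -/
def cartanLift (a : ℕ) {k : ℕ} (w : JetCoord E F k) (η : E) (q : ∀ i : Fin (k + 1), SymMul E F i) :
    JetCoord E F k :=
  -- The condition `i < k` only makes the index `i + 1` legitimate; it follows from `i < a` whenever
  -- `a ≤ k`.
  (η, fun i => if h : (i : ℕ) < a ∧ (i : ℕ) < k then
    contract E F i (w.2 ⟨i + 1, by omega⟩) η else q i)

theorem cartanLift_mem (h : a ≤ k) (w : JetCoord E F k) (η : E)
    (q : ∀ i : Fin (k + 1), SymMul E F i) : cartanLift a w η q ∈ coordCartan h w := by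
  rw [mem_coordCartan]
  intro i hi
  simp only [cartanLift]
  rw [dif_pos ⟨hi, by omega⟩]

theorem cartanLift_of_le (w : JetCoord E F k) (η : E) (q : ∀ i : Fin (k + 1), SymMul E F i)
    {i : Fin (k + 1)} (hi : a ≤ i) : (cartanLift a w η q).2 i = q i := by
  simp only [cartanLift]
  rw [dif_neg (by omega)]

theorem cartanLift_zero_of_lt (h : a ≤ k) (w : JetCoord E F k)
    (q : ∀ i : Fin (k + 1), SymMul E F i)
    {i : Fin (k + 1)} (hi : i < a) : (cartanLift a w 0 q).2 i = 0 := by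
  simp only [cartanLift]
  rw [dif_pos ⟨hi, by omega⟩, map_zero]

/-- The values of the contact forms which vanish on the derived distribution. -/
def topValues (E F : Type*) [NormedAddCommGroup E] [NormedSpace ℝ E] [NormedAddCommGroup F]
    [NormedSpace ℝ F] (a : ℕ) : Submodule ℝ (∀ i : Fin a, SymMul E F i) where
  carrier := {q | ∀ i : Fin a, (i : ℕ) + 1 < a → q i = 0}
  add_mem' := by
    intro p q hp hq i hi
    simp [hp i hi, hq i hi]
  zero_mem' := fun _ _ => rfl
  smul_mem' := by
    intro c q hq i hi
    simp [hq i hi]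

/-- Pairing a vertical vector with entry `r` of order `a` and the horizontal lift of `η`, the form
`dθ` takes the value `r ⌟ η` in the top slot. By `span_contract` these values fill that slot. -/
theorem topValues_le [FiniteDimensional ℝ E] [Nontrivial E] [CompleteSpace F] (h : a ≤ k)
    (w : JetCoord E F k)
    {P : Submodule ℝ (∀ i : Fin a, SymMul E F i)} (hP : ∀ (r : SymMul E F a) (η : E),
      formB E F h (cartanLift a w 0 (Pi.single ⟨a, by omega⟩ r)) (cartanLift a w η 0) ∈ P) :
    topValues E F a ≤ P := by
  intro q hq
  rcases a with _ | a
  · rw [Subsingleton.elim q 0]; exact P.zero_mem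
  · have h1 : q = Pi.single (Fin.last a) (q (Fin.last a)) := by
      ext1 i
      by_cases hi : i = Fin.last a
      · subst hi; simp
      · rw [Pi.single_eq_of_ne hi]
        have : (i : ℕ) ≠ a := fun h => hi (Fin.ext h)
        exact hq i (by omega)
    have h2 : (⊤ : Submodule ℝ (SymMul E F a)) ≤
        P.comap (LinearMap.single ℝ (fun i : Fin (a + 1) => SymMul E F i) (Fin.last a)) := by
      rw [← span_contract (E := E) (F := F) a, Submodule.span_le]
      rintro _ ⟨r, η, rfl⟩
      change Pi.single (Fin.last a) _ ∈ P
      convert hP r η using 1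
      ext1 i
      rw [formB_apply]
      by_cases hi : i = Fin.last a
      · subst hi
        rw [Pi.single_eq_same, cartanLift_of_le w 0 _ (by simp)]
        change _ = contract E F a (Pi.single (M := fun i : Fin (k + 1) => SymMul E F i)
          (⟨a + 1, by omega⟩ : Fin (k + 1)) r ⟨a + 1, by omega⟩) η
        rw [Pi.single_eq_same]
      · have : (i : ℕ) ≠ a := fun h => hi (Fin.ext h)
        rw [Pi.single_eq_of_ne hi, cartanLift_zero_of_lt h _ _ (by simp; omega), map_zero]
        rfl
    rw [h1]
    exact h2 trivial

/-- Below the top slot, both terms are double contractions of the same entry of `w` with the two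
horizontal parts, in opposite orders, and cancel. -/
theorem formB_sub_mem_topValues (h : a ≤ k) {w u v : JetCoord E F k} (hu : u ∈ coordCartan h w)
    (hv : v ∈ coordCartan h w) : formB E F h v u - formB E F h u v ∈ topValues E F a := by
  intro i hi
  rw [mem_coordCartan] at hu hv
  rw [Pi.sub_apply, formB_apply, formB_apply, hu _ hi, hv _ hi, contract_comm, sub_self]

/-- This identifies the derived distribution with the Cartan distribution of order `a - 1`. For `a =
0` both sides are vacuous. -/
theorem sub_mem_topValues_iff (h : a ≤ k) {w v : JetCoord E F k} :
    formA E F h v - formB E F h w v ∈ topValues E F a ↔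
      v ∈ coordCartan ((Nat.sub_le a 1).trans h) w := by
  rw [mem_coordCartan]
  constructor
  · intro h1 i hi
    have := h1 ⟨i, by omega⟩ (by simp; omega)
    rw [Pi.sub_apply, sub_eq_zero, formA_apply, formB_apply] at this
    exact this
  · intro h1 i hi
    rw [Pi.sub_apply, sub_eq_zero, formA_apply, formB_apply]
    exact h1 i (by omega)

end CoordinateCartan

/-! ### The contact forms of mixed jets and their three invariants. -/

section MixedCoordinates

variable {E F F₁ F₂ : Type*} [NormedAddCommGroup E] [NormedSpace ℝ E] [NormedAddCommGroup F]
  [NormedSpace ℝ F] [NormedAddCommGroup F₁] [NormedSpace ℝ F₁] [NormedAddCommGroup F₂]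
  [NormedSpace ℝ F₂] {a k a₁ a₂ k₁ k₂ : ℕ}

variable (E F₁ F₂) in
/-- The coordinates of the first component of a mixed jet. -/
def fstCoord (k₁ k₂ : ℕ) : MixedCoord E F₁ F₂ k₁ k₂ →L[ℝ] JetCoord E F₁ k₁ :=
  (ContinuousLinearMap.fst ℝ _ _).prod
    (ContinuousLinearMap.fst ℝ _ _ ∘L ContinuousLinearMap.snd ℝ _ _)

variable (E F₁ F₂) in
/-- The coordinates of the second component of a mixed jet. -/
def sndCoord (k₁ k₂ : ℕ) : MixedCoord E F₁ F₂ k₁ k₂ →L[ℝ] JetCoord E F₂ k₂ :=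
  (ContinuousLinearMap.fst ℝ _ _).prod
    (ContinuousLinearMap.snd ℝ _ _ ∘L ContinuousLinearMap.snd ℝ _ _)

@[simp] theorem fstCoord_apply (w : MixedCoord E F₁ F₂ k₁ k₂) :
    fstCoord E F₁ F₂ k₁ k₂ w = (w.1, w.2.1) := rfl

@[simp] theorem sndCoord_apply (w : MixedCoord E F₁ F₂ k₁ k₂) :
    sndCoord E F₁ F₂ k₁ k₂ w = (w.1, w.2.2) := rfl

/-- The coordinate expression of the Cartan distribution of mixed jets of order `(a₁, a₂)`, pulled
back to mixed jets of order `(k₁, k₂)`. -/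
def mixedCoordCartan (h₁ : a₁ ≤ k₁) (h₂ : a₂ ≤ k₂) (w : MixedCoord E F₁ F₂ k₁ k₂) :
    Submodule ℝ (MixedCoord E F₁ F₂ k₁ k₂) :=
  ((coordCartan h₁ (fstCoord E F₁ F₂ k₁ k₂ w)).comap (fstCoord E F₁ F₂ k₁ k₂).toLinearMap) ⊓
    ((coordCartan h₂ (sndCoord E F₁ F₂ k₁ k₂ w)).comap (sndCoord E F₁ F₂ k₁ k₂).toLinearMap)

theorem mem_mixedCoordCartan (h₁ : a₁ ≤ k₁) (h₂ : a₂ ≤ k₂) {w v : MixedCoord E F₁ F₂ k₁ k₂} :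
    v ∈ mixedCoordCartan h₁ h₂ w ↔
      ((v.1, v.2.1) : JetCoord E F₁ k₁) ∈ coordCartan h₁ (w.1, w.2.1) ∧
      ((v.1, v.2.2) : JetCoord E F₂ k₂) ∈ coordCartan h₂ (w.1, w.2.2) := Iff.rfl

variable (E F₁ F₂) in
/-- The contact forms of order less than `(a₁, a₂)` are `mixedA - mixedB w`. -/
def mixedA (h₁ : a₁ ≤ k₁) (h₂ : a₂ ≤ k₂) : MixedCoord E F₁ F₂ k₁ k₂ →L[ℝ]
    (∀ i : Fin a₁, SymMul E F₁ i) × (∀ i : Fin a₂, SymMul E F₂ i) :=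
  (formA E F₁ h₁ ∘L fstCoord E F₁ F₂ k₁ k₂).prod (formA E F₂ h₂ ∘L sndCoord E F₁ F₂ k₁ k₂)

variable (E F₁ F₂) in
/-- The part of the contact forms which is linear in the coefficients. -/
def mixedB (h₁ : a₁ ≤ k₁) (h₂ : a₂ ≤ k₂) :
    MixedCoord E F₁ F₂ k₁ k₂ →L[ℝ] MixedCoord E F₁ F₂ k₁ k₂ →L[ℝ]
      (∀ i : Fin a₁, SymMul E F₁ i) × (∀ i : Fin a₂, SymMul E F₂ i) :=
  (ContinuousLinearMap.compL ℝ (MixedCoord E F₁ F₂ k₁ k₂) _ _ (ContinuousLinearMap.inl ℝ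
      (∀ i : Fin a₁, SymMul E F₁ i) (∀ i : Fin a₂, SymMul E F₂ i))) ∘L
    ((formB E F₁ h₁).bilinearComp (fstCoord E F₁ F₂ k₁ k₂) (fstCoord E F₁ F₂ k₁ k₂)) +
  (ContinuousLinearMap.compL ℝ (MixedCoord E F₁ F₂ k₁ k₂) _ _ (ContinuousLinearMap.inr ℝ
      (∀ i : Fin a₁, SymMul E F₁ i) (∀ i : Fin a₂, SymMul E F₂ i))) ∘L
    ((formB E F₂ h₂).bilinearComp (sndCoord E F₁ F₂ k₁ k₂) (sndCoord E F₁ F₂ k₁ k₂))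

theorem mixedA_apply (h₁ : a₁ ≤ k₁) (h₂ : a₂ ≤ k₂) (v : MixedCoord E F₁ F₂ k₁ k₂) :
    mixedA E F₁ F₂ h₁ h₂ v = (formA E F₁ h₁ (v.1, v.2.1), formA E F₂ h₂ (v.1, v.2.2)) := rfl

theorem mixedB_apply (h₁ : a₁ ≤ k₁) (h₂ : a₂ ≤ k₂) (w v : MixedCoord E F₁ F₂ k₁ k₂) :
    mixedB E F₁ F₂ h₁ h₂ w v = (formB E F₁ h₁ (w.1, w.2.1) (v.1, v.2.1),
      formB E F₂ h₂ (w.1, w.2.2) (v.1, v.2.2)) := by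
  simp [mixedB]

theorem mem_mixedCoordCartan_iff_eq (h₁ : a₁ ≤ k₁) (h₂ : a₂ ≤ k₂)
    {w v : MixedCoord E F₁ F₂ k₁ k₂} :
    v ∈ mixedCoordCartan h₁ h₂ w ↔ mixedA E F₁ F₂ h₁ h₂ v = mixedB E F₁ F₂ h₁ h₂ w v := by
  rw [mem_mixedCoordCartan, mixedA_apply, mixedB_apply, Prod.mk.injEq, ← sub_eq_zero,
    ← sub_eq_zero (a := formA E F₂ h₂ _)]
  rfl

variable (E F) in
/-- Extension of a family of symmetric maps by zero. -/
def extendZero (a k : ℕ) : (∀ i : Fin a, SymMul E F i) →L[ℝ] (∀ i : Fin (k + 1), SymMul E F i) :=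
  ContinuousLinearMap.pi fun i => if h : (i : ℕ) < a then
    ContinuousLinearMap.proj (R := ℝ) (φ := fun i : Fin a => SymMul E F i) ⟨i, h⟩ else 0

theorem extendZero_of_lt {a k : ℕ} (q : ∀ i : Fin a, SymMul E F i) {i : Fin (k + 1)}
    (h : (i : ℕ) < a) : extendZero E F a k q i = q ⟨i, h⟩ := by
  simp [extendZero, h]

variable (E F₁ F₂) in
/-- A right inverse of the contact forms. -/
def mixedSection (a₁ a₂ k₁ k₂ : ℕ) :
    ((∀ i : Fin a₁, SymMul E F₁ i) × (∀ i : Fin a₂, SymMul E F₂ i)) →L[ℝ]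
      MixedCoord E F₁ F₂ k₁ k₂ :=
  (0 : _ →L[ℝ] E).prod ((extendZero E F₁ a₁ k₁).prodMap (extendZero E F₂ a₂ k₂))

theorem formA_extendZero (h : a ≤ k) (w : JetCoord E F k) (q : ∀ i : Fin a, SymMul E F i) :
    formA E F h (0, extendZero E F a k q) - formB E F h w (0, extendZero E F a k q) = q := by
  ext1 i
  rw [Pi.sub_apply, formA_apply, formB_apply, map_zero, sub_zero]
  exact extendZero_of_lt q i.2

/-- The section has no horizontal part, so `B w` vanishes on it and one map is a right inverse of
the contact forms at every point. It plays the role of `σ` in `exists_intertwining`. -/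
theorem mixedA_mixedSection (h₁ : a₁ ≤ k₁) (h₂ : a₂ ≤ k₂) (w : MixedCoord E F₁ F₂ k₁ k₂)
    (q : (∀ i : Fin a₁, SymMul E F₁ i) × (∀ i : Fin a₂, SymMul E F₂ i)) :
    mixedA E F₁ F₂ h₁ h₂ (mixedSection E F₁ F₂ a₁ a₂ k₁ k₂ q) -
      mixedB E F₁ F₂ h₁ h₂ w (mixedSection E F₁ F₂ a₁ a₂ k₁ k₂ q) = q := by
  rw [mixedA_apply, mixedB_apply]
  exact Prod.ext (formA_extendZero h₁ _ q.1) (formA_extendZero h₂ _ q.2)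

/-- Near `w`, the differential of `G` preserves the Cartan distribution of order `(a₁, a₂)`. -/
def PreservesNear (h₁ : a₁ ≤ k₁) (h₂ : a₂ ≤ k₂)
    (G : MixedCoord E F₁ F₂ k₁ k₂ → MixedCoord E F₁ F₂ k₁ k₂) (w : MixedCoord E F₁ F₂ k₁ k₂) :
    Prop :=
  ∀ᶠ w' in 𝓝 w, ∀ v ∈ mixedCoordCartan h₁ h₂ w', fderiv ℝ G w' v ∈ mixedCoordCartan h₁ h₂ (G w')

variable {G : MixedCoord E F₁ F₂ k₁ k₂ → MixedCoord E F₁ F₂ k₁ k₂}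
  {w : MixedCoord E F₁ F₂ k₁ k₂}

theorem PreservesNear.forms {h₁ : a₁ ≤ k₁} {h₂ : a₂ ≤ k₂} (hK : PreservesNear h₁ h₂ G w) :
    ∀ᶠ w' in 𝓝 w, ∀ v, mixedA E F₁ F₂ h₁ h₂ v = mixedB E F₁ F₂ h₁ h₂ w' v →
      mixedA E F₁ F₂ h₁ h₂ (fderiv ℝ G w' v) =
        mixedB E F₁ F₂ h₁ h₂ (G w') (fderiv ℝ G w' v) := by
  filter_upwards [hK] with w' h v hv
  exact (mem_mixedCoordCartan_iff_eq h₁ h₂).1 (h v ((mem_mixedCoordCartan_iff_eq h₁ h₂).2 hv))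

theorem zero_mem_coordCartan (h : a ≤ k) (w : JetCoord E F k) :
    (0 : JetCoord E F k) ∈ coordCartan h w := Submodule.zero_mem _

set_option maxHeartbeats 1000000 in
/-- The Cartan distribution of lower order is preserved. -/
theorem PreservesNear.lower [FiniteDimensional ℝ E] [Nontrivial E] [CompleteSpace F₁]
    [CompleteSpace F₂] {h₁ : a₁ ≤ k₁} {h₂ : a₂ ≤ k₂} (hK : PreservesNear h₁ h₂ G w)
    (hG : ContDiffAt ℝ 2 G w) {v : MixedCoord E F₁ F₂ k₁ k₂}
    (hv : v ∈ mixedCoordCartan ((Nat.sub_le a₁ 1).trans h₁) ((Nat.sub_le a₂ 1).trans h₂) w) :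
    fderiv ℝ G w v ∈
      mixedCoordCartan ((Nat.sub_le a₁ 1).trans h₁) ((Nat.sub_le a₂ 1).trans h₂) (G w) := by
  have key : ∀ w v : MixedCoord E F₁ F₂ k₁ k₂,
      v ∈ mixedCoordCartan ((Nat.sub_le a₁ 1).trans h₁) ((Nat.sub_le a₂ 1).trans h₂) w ↔
        mixedA E F₁ F₂ h₁ h₂ v - mixedB E F₁ F₂ h₁ h₂ w v ∈
          (topValues E F₁ a₁).prod (topValues E F₂ a₂) := by
    intro w v
    rw [mixedA_apply, mixedB_apply, Prod.mk_sub_mk, Submodule.mem_prod, mem_mixedCoordCartan]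
    exact and_congr (sub_mem_topValues_iff h₁).symm (sub_mem_topValues_iff h₂).symm
  rw [key] at hv ⊢
  refine @derived_preserved (MixedCoord E F₁ F₂ k₁ k₂)
    ((∀ i : Fin a₁, SymMul E F₁ i) × (∀ i : Fin a₂, SymMul E F₂ i)) _ _ _ _
    (mixedA E F₁ F₂ h₁ h₂) (mixedB E F₁ F₂ h₁ h₂) (mixedSection E F₁ F₂ a₁ a₂ k₁ k₂) G w
    (mixedA_mixedSection h₁ h₂) hG hK.forms
    ((topValues E F₁ a₁).prod (topValues E F₂ a₂)) ?_ ?_ v hv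
  -- The two components are produced separately: the horizontal lift of `η` is paired with a
  -- vertical vector whose entries lie in one component only.
  · rintro ⟨q₁, q₂⟩ ⟨hq₁, hq₂⟩
    have h3 : ((q₁, q₂) : (∀ i : Fin a₁, SymMul E F₁ i) × (∀ i : Fin a₂, SymMul E F₂ i)) =
      (q₁, 0) + (0, q₂) := by simp
    rw [h3]
    refine Submodule.add_mem _ ?_ ?_
    · refine topValues_le h₁ ((w.1, w.2.1) : JetCoord E F₁ k₁) (P := (Submodule.span ℝ _).comap
        (LinearMap.inl ℝ (∀ i : Fin a₁, SymMul E F₁ i) (∀ i : Fin a₂, SymMul E F₂ i)))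
        (fun r η => Submodule.subset_span ?_) hq₁
      refine ⟨(η, (cartanLift a₁ ((w.1, w.2.1) : JetCoord E F₁ k₁) η 0).2,
        (cartanLift a₂ ((w.1, w.2.2) : JetCoord E F₂ k₂) η 0).2),
        (0, (cartanLift a₁ ((w.1, w.2.1) : JetCoord E F₁ k₁) 0 (Pi.single ⟨a₁, by omega⟩ r)).2, 0),
        ?_, ?_, ?_⟩
      · rw [← mem_mixedCoordCartan_iff_eq]
        exact ⟨cartanLift_mem h₁ _ _ _, cartanLift_mem h₂ _ _ _⟩
      · rw [← mem_mixedCoordCartan_iff_eq]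
        exact ⟨cartanLift_mem h₁ _ _ _, zero_mem_coordCartan _ _⟩
      · rw [mixedB_apply, mixedB_apply]
        refine Prod.ext ?_ ?_
        · ext1 i
          simp [formB_apply, cartanLift]
        · ext1 i
          simp [formB_apply]
    · refine topValues_le h₂ ((w.1, w.2.2) : JetCoord E F₂ k₂) (P := (Submodule.span ℝ _).comap
        (LinearMap.inr ℝ (∀ i : Fin a₁, SymMul E F₁ i) (∀ i : Fin a₂, SymMul E F₂ i)))
        (fun r η => Submodule.subset_span ?_) hq₂
      refine ⟨(η, (cartanLift a₁ ((w.1, w.2.1) : JetCoord E F₁ k₁) η 0).2,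
        (cartanLift a₂ ((w.1, w.2.2) : JetCoord E F₂ k₂) η 0).2),
        (0, 0, (cartanLift a₂ ((w.1, w.2.2) : JetCoord E F₂ k₂) 0
          (Pi.single ⟨a₂, by omega⟩ r)).2), ?_, ?_, ?_⟩
      · rw [← mem_mixedCoordCartan_iff_eq]
        exact ⟨cartanLift_mem h₁ _ _ _, cartanLift_mem h₂ _ _ _⟩
      · rw [← mem_mixedCoordCartan_iff_eq]
        exact ⟨zero_mem_coordCartan _ _, cartanLift_mem h₂ _ _ _⟩
      · rw [mixedB_apply, mixedB_apply]
        refine Prod.ext ?_ ?_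
        · ext1 i
          simp [formB_apply]
        · ext1 i
          simp [formB_apply, cartanLift]
  · intro u v hu hv
    rw [← mem_mixedCoordCartan_iff_eq] at hu hv
    rw [mixedB_apply, mixedB_apply]
    exact ⟨formB_sub_mem_topValues h₁ hu.1 hv.1, formB_sub_mem_topValues h₂ hu.2 hv.2⟩

/-- The vertical vectors of the projection to jets of order `b` of the second component. -/
def sndVertical (k₁ k₂ b : ℕ) : Submodule ℝ (MixedCoord E F₁ F₂ k₁ k₂) where
  carrier := {v | v.1 = 0 ∧ ∀ i : Fin (k₂ + 1), (i : ℕ) ≤ b → v.2.2 i = 0}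
  add_mem' := by
    rintro u v ⟨h1, h2⟩ ⟨h3, h4⟩
    exact ⟨by simp [h1, h3], fun i hi => by simp [h2 i hi, h4 i hi]⟩
  zero_mem' := ⟨rfl, fun _ _ => rfl⟩
  smul_mem' := by
    rintro c v ⟨h1, h2⟩
    exact ⟨by simp [h1], fun i hi => by simp [h2 i hi]⟩

theorem mem_sndVertical {b : ℕ} {v : MixedCoord E F₁ F₂ k₁ k₂} :
    v ∈ sndVertical k₁ k₂ b ↔ v.1 = 0 ∧ ∀ i : Fin (k₂ + 1), (i : ℕ) ≤ b → v.2.2 i = 0 := Iff.rfl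

/-- Order `0` in the first component means no contact forms there, and the second component vanishes
in all orders below `a₂`. The bound `a₂ ≤ b + 1` covers the characteristics, `b = a₂`, and the
rank-one argument, `a₂ = 1` and `b = 0`. -/
theorem mem_mixedCoordCartan_of_sndVertical {b : ℕ} {h₁ : 0 ≤ k₁} {h₂ : a₂ ≤ k₂} (hb : a₂ ≤ b + 1)
    {v : MixedCoord E F₁ F₂ k₁ k₂} (hv : v ∈ sndVertical k₁ k₂ b) :
    v ∈ mixedCoordCartan h₁ h₂ w := by
  rw [mem_mixedCoordCartan]
  refine ⟨(mem_coordCartan _).2 fun i hi => absurd hi (Nat.not_lt_zero _),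
    (mem_coordCartan _).2 fun i hi => ?_⟩
  simp only
  rw [hv.1, map_zero]
  exact hv.2 _ (by simp; omega)

set_option maxHeartbeats 1000000 in
/-- The vertical vectors are the Cauchy characteristics of the Cartan distribution of order
`(0, a₂)`, hence they are preserved. -/
theorem PreservesNear.sndVertical [Nontrivial F₂] (ha : 0 < a₂) {h₁ : 0 ≤ k₁} {h₂ : a₂ ≤ k₂}
    (hK : PreservesNear h₁ h₂ G w) (hG : ContDiffAt ℝ 2 G w)
    (hsurj : ∀ u' ∈ mixedCoordCartan h₁ h₂ (G w), ∃ u ∈ mixedCoordCartan h₁ h₂ w,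
      fderiv ℝ G w u = u')
    {v : MixedCoord E F₁ F₂ k₁ k₂} (hv : v ∈ sndVertical k₁ k₂ a₂) :
    fderiv ℝ G w v ∈ sndVertical k₁ k₂ a₂ := by
  have hvK : v ∈ mixedCoordCartan h₁ h₂ w := mem_mixedCoordCartan_of_sndVertical (by omega) hv
  have hchar : ∀ u, mixedA E F₁ F₂ h₁ h₂ u = mixedB E F₁ F₂ h₁ h₂ w u →
      mixedB E F₁ F₂ h₁ h₂ v u = mixedB E F₁ F₂ h₁ h₂ u v := by
    intro u _
    rw [mixedB_apply, mixedB_apply]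
    refine Prod.ext (Subsingleton.elim _ _) ?_
    ext1 i
    simp only [formB_apply]
    rw [hv.1, hv.2 ⟨i + 1, by omega⟩ (by simp), map_zero, map_zero]
    rfl
  have hsurj' : ∀ u', mixedA E F₁ F₂ h₁ h₂ u' = mixedB E F₁ F₂ h₁ h₂ (G w) u' →
      ∃ u, mixedA E F₁ F₂ h₁ h₂ u = mixedB E F₁ F₂ h₁ h₂ w u ∧ fderiv ℝ G w u = u' := by
    intro u' hu'
    rw [← mem_mixedCoordCartan_iff_eq] at hu'
    obtain ⟨u, hu, h⟩ := hsurj u' hu'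
    exact ⟨u, (mem_mixedCoordCartan_iff_eq _ _).1 hu, h⟩
  have h := @characteristic_preserved (MixedCoord E F₁ F₂ k₁ k₂)
    ((∀ i : Fin 0, SymMul E F₁ i) × (∀ i : Fin a₂, SymMul E F₂ i)) _ _ _ _
    (mixedA E F₁ F₂ h₁ h₂) (mixedB E F₁ F₂ h₁ h₂) (mixedSection E F₁ F₂ 0 a₂ k₁ k₂) G w
    (mixedA_mixedSection h₁ h₂) hG hK.forms
    hsurj' v ((mem_mixedCoordCartan_iff_eq _ _).1 hvK) hchar
  have hv' := hK.self_of_nhds v hvK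
  set v' := fderiv ℝ G w v
  have h' : ∀ u ∈ mixedCoordCartan h₁ h₂ (G w), ∀ i : Fin a₂,
      contract E F₂ i (v'.2.2 ⟨i + 1, by omega⟩) u.1 =
        contract E F₂ i (u.2.2 ⟨i + 1, by omega⟩) v'.1 := by
    intro u hu i
    have h3 := h (u := u) ((mem_mixedCoordCartan_iff_eq _ _).1 hu)
    rw [mixedB_apply, mixedB_apply] at h3
    have h4 := congrFun (congrArg Prod.snd h3) i
    simpa only [formB_apply] using h4
  obtain ⟨b, rfl⟩ : ∃ b, a₂ = b + 1 := ⟨a₂ - 1, by omega⟩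
  -- Testing against vertical vectors with arbitrary top entry `r` gives `r ⌟ v'.1 = 0` for all `r`,
  -- which is impossible for a nonzero horizontal part.
  have hv1 : v'.1 = 0 := by
    by_contra hne
    obtain ⟨r, hr⟩ := exists_contract_ne_zero (F := F₂) b hne
    apply hr
    have h5 := h' (0, 0, (cartanLift (b + 1) (((G w).1, (G w).2.2) : JetCoord E F₂ k₂) 0
          (Pi.single ⟨b + 1, by omega⟩ r)).2)
      ((mem_mixedCoordCartan _ _).2 ⟨zero_mem_coordCartan _ _, cartanLift_mem h₂ _ _ _⟩)
      (Fin.last b)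
    simp only [map_zero] at h5
    rw [cartanLift_of_le _ _ _ (by simp)] at h5
    change 0 = contract E F₂ b (Pi.single (M := fun i : Fin (k₂ + 1) => SymMul E F₂ i)
          (⟨b + 1, by omega⟩ : Fin (k₂ + 1)) r ⟨b + 1, by omega⟩) v'.1 at h5
    rw [Pi.single_eq_same] at h5
    exact h5.symm
  refine ⟨hv1, fun i hi => ?_⟩
  -- Without horizontal part, the contact equations kill the entries of order at most `b`. The entry
  -- of order `a₂ = b + 1` is killed by testing against the horizontal lifts of all `ξ`.
  rcases Nat.lt_or_eq_of_le hi with hi | hi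
  · have h6 := (mem_coordCartan _).1 ((mem_mixedCoordCartan _ _).1 hv').2 i hi
    simp only [hv1, map_zero] at h6
    exact h6
  · rw [show i = ⟨b + 1, by omega⟩ from Fin.ext hi]
    refine eq_zero_of_contract_eq_zero fun ξ => ?_
    have h5 := h' (ξ, 0, (cartanLift (b + 1) (((G w).1, (G w).2.2) : JetCoord E F₂ k₂) ξ 0).2)
      ((mem_mixedCoordCartan _ _).2 ⟨(mem_coordCartan _).2 fun i hi =>
        absurd hi (Nat.not_lt_zero _), cartanLift_mem h₂ _ _ _⟩) (Fin.last b)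
    rw [hv1, map_zero] at h5
    exact h5

/-- Expansion in a basis of `E` writes a linear map as a sum of maps of rank at most one. -/
theorem symMul_one_mem [FiniteDimensional ℝ E] {P : Submodule ℝ (SymMul E F 1)}
    (hP : ∀ l y, powForm E 1 l y ∈ P) (p : SymMul E F 1) : p ∈ P := by
  let b := Module.finBasis ℝ E
  have : p = ∑ j, powForm E 1 (LinearMap.toContinuousLinearMap (b.coord j))
      (p.1 (fun _ => b j)) := by
    refine symMul_ext fun v => ?_
    rw [AddSubmonoidClass.coe_finsetSum, sum_apply]
    simp only [powForm_apply, Fin.prod_univ_one]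
    have h1 : ∀ x, p.1 (fun _ => x) = (contract E F 0 p x).1 0 := by
      intro x
      rw [contract_apply]
      congr 1
      ext j
      rw [Subsingleton.elim j 0]; rfl
    have h2 : v = fun _ => v 0 := by ext j; rw [Subsingleton.elim j 0]
    rw [h2]
    simp only [h1]
    conv_lhs => rw [← b.sum_repr (v 0), map_sum]
    rw [AddSubmonoidClass.coe_finsetSum, sum_apply]
    refine Finset.sum_congr rfl fun j _ => ?_
    rw [map_smul]
    rfl
  rw [this]
  exact Submodule.sum_mem _ fun j _ => hP _ _

set_option maxHeartbeats 1000000 in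
/-- If the second target has dimension at least two, the vectors of rank at most one in the Cartan
distribution of order `(0, 1)` span the vertical vectors of the projection to jets of order zero,
which are hence preserved. -/
theorem PreservesNear.sndVertical_zero [FiniteDimensional ℝ E] (hF : 1 < Module.finrank ℝ F₂)
    {h₁ : 0 ≤ k₁} {h₂ : 1 ≤ k₂} (hK : PreservesNear h₁ h₂ G w) (hG : ContDiffAt ℝ 2 G w)
    (hsurj : ∀ u' ∈ mixedCoordCartan h₁ h₂ (G w), ∃ u ∈ mixedCoordCartan h₁ h₂ w,
      fderiv ℝ G w u = u')
    {v : MixedCoord E F₁ F₂ k₁ k₂} (hv : v ∈ JetSpace.sndVertical k₁ k₂ 0) :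
    fderiv ℝ G w v ∈ JetSpace.sndVertical k₁ k₂ 0 := by
  have hsurj' : ∀ u', mixedA E F₁ F₂ h₁ h₂ u' = mixedB E F₁ F₂ h₁ h₂ (G w) u' →
      ∃ u, mixedA E F₁ F₂ h₁ h₂ u = mixedB E F₁ F₂ h₁ h₂ w u ∧ fderiv ℝ G w u = u' := by
    intro u' hu'
    rw [← mem_mixedCoordCartan_iff_eq] at hu'
    obtain ⟨u, hu, h⟩ := hsurj u' hu'
    exact ⟨u, (mem_mixedCoordCartan_iff_eq _ _).1 hu, h⟩
  let ι : Fin (k₂ + 1) := ⟨1, by omega⟩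
  -- If the first-order entry of the vertical vector `v` is `l ⊗ y`, the contraction of `dθ` with
  -- `v` is `u ↦ l u.1 • y` up to sign, so it has rank at most one, and the image of `v` has the
  -- same property.
  have rank : ∀ v : MixedCoord E F₁ F₂ k₁ k₂, v ∈ JetSpace.sndVertical k₁ k₂ 0 →
      (∃ l y, v.2.2 ι = powForm E 1 l y) →
      fderiv ℝ G w v ∈ JetSpace.sndVertical k₁ k₂ 0 := by
    rintro v hv ⟨l, y, hy⟩
    have hvK : v ∈ mixedCoordCartan h₁ h₂ w := mem_mixedCoordCartan_of_sndVertical le_rfl hv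
    obtain ⟨q, hq⟩ := @rank_one_preserved (MixedCoord E F₁ F₂ k₁ k₂)
        ((∀ i : Fin 0, SymMul E F₁ i) × (∀ i : Fin 1, SymMul E F₂ i)) _ _ _ _
        (mixedA E F₁ F₂ h₁ h₂) (mixedB E F₁ F₂ h₁ h₂) (mixedSection E F₁ F₂ 0 1 k₁ k₂) G w
        (mixedA_mixedSection h₁ h₂) hG hK.forms hsurj' v
          ((mem_mixedCoordCartan_iff_eq _ _).1 hvK) (by
        refine ⟨(0, fun i => Fin.cases (motive := fun i : Fin 1 => SymMul E F₂ i)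
          (powForm E 0 l y) (fun j => j.elim0) i), fun u _ => ⟨l u.1, ?_⟩⟩
        rw [mixedB_apply, mixedB_apply]
        refine Prod.ext (Subsingleton.elim _ _) ?_
        ext1 i
        obtain rfl : i = 0 := Subsingleton.elim _ _
        change formB E F₂ h₂ _ _ 0 - formB E F₂ h₂ _ _ 0 = l u.1 • powForm E 0 l y
        rw [formB_apply, formB_apply, hv.1, map_zero, sub_zero, ← contract_powForm, ← hy]
        rfl)
    have hv' := hK.self_of_nhds v hvK
    set v' := fderiv ℝ G w v
    have hv1 : v'.1 = 0 := by
      by_contra hne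
      -- If the image had a horizontal part, pairing it with vertical vectors `l ⊗ y` would produce
      -- every element of `F₂`, contradicting rank one. The factor `-(l v'.1)⁻¹` is chosen so that
      -- the value is exactly `y`.
      obtain ⟨l, hl⟩ := exists_dual_vector ℝ v'.1 (norm_ne_zero_iff.2 hne)
      have hl' : l v'.1 ≠ 0 := by rw [hl.2]; simpa using hne
      have h5 : ∀ y : F₂, ∃ c : ℝ, c • (q.2 0).1 0 = y := by
        intro y
        obtain ⟨c, hc⟩ := hq (0, 0, (cartanLift 1 (((G w).1, (G w).2.2) : JetCoord E F₂ k₂) 0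
            (Pi.single ι (powForm E 1 l (-(l v'.1)⁻¹ • y)))).2) (by
          rw [← mem_mixedCoordCartan_iff_eq]
          exact ⟨zero_mem_coordCartan _ _, cartanLift_mem h₂ _ _ _⟩)
        rw [mixedB_apply, mixedB_apply] at hc
        have h6 := congrFun (congrArg Prod.snd hc) 0
        change formB E F₂ h₂ _ _ 0 - formB E F₂ h₂ _ _ 0 = c • q.2 0 at h6
        rw [formB_apply, formB_apply] at h6
        simp only [map_zero, zero_sub] at h6
        rw [cartanLift_of_le _ _ _ (by simp)] at h6
        change -contract E F₂ 0 (Pi.single (M := fun i : Fin (k₂ + 1) => SymMul E F₂ i)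
          ι (powForm E 1 l (-(l v'.1)⁻¹ • y)) ι) v'.1 = c • q.2 0 at h6
        rw [Pi.single_eq_same, contract_powForm] at h6
        have h7 := congrArg (fun p : SymMul E F₂ 0 => p.1 0) h6
        refine ⟨c, ?_⟩
        refine Eq.trans h7.symm ?_
        change -(l v'.1 • (∏ j : Fin 0, l 0) • (-(l v'.1)⁻¹ • y)) = y
        simp [smul_smul, hl']
      have := finrank_le_one ((q.2 0).1 0) h5
      omega
    refine ⟨hv1, fun i hi => ?_⟩
    have h6 := (mem_coordCartan _).1 ((mem_mixedCoordCartan _ _).1 hv').2 i (by omega)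
    simp only [hv1, map_zero] at h6
    exact h6
  -- `T` inserts a first-order entry. Its values are handled by linearity, since the maps `l ⊗ y`
  -- span; the remainder `v - T (v.2.2 ι)` has zero first-order entry and falls under `rank` with `l
  -- = 0`.
  let T : SymMul E F₂ 1 →ₗ[ℝ] MixedCoord E F₁ F₂ k₁ k₂ :=
    LinearMap.inr ℝ _ _ ∘ₗ LinearMap.inr ℝ _ _ ∘ₗ
      LinearMap.single ℝ (fun i : Fin (k₂ + 1) => SymMul E F₂ i) ι
  have hT0 : ∀ x i, i ≠ ι → (T x).2.2 i = 0 := fun x i hi => Pi.single_eq_of_ne hi _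
  have hT1 : ∀ x, (T x).2.2 ι = x := fun x =>
    Pi.single_eq_same (M := fun i : Fin (k₂ + 1) => SymMul E F₂ i) ι x
  have hTV : ∀ x, T x ∈ JetSpace.sndVertical k₁ k₂ 0 := fun x =>
    ⟨rfl, fun i hi => hT0 x i (by rintro rfl; simp [ι] at hi)⟩
  have hTx : ∀ x, fderiv ℝ G w (T x) ∈ JetSpace.sndVertical k₁ k₂ 0 := by
    intro x
    refine symMul_one_mem (P := (JetSpace.sndVertical k₁ k₂ 0).comap
      ((fderiv ℝ G w).toLinearMap ∘ₗ T)) (fun l y => ?_) x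
    exact rank _ (hTV _) ⟨l, y, hT1 _⟩
  have h1 : v = (v - T (v.2.2 ι)) + T (v.2.2 ι) := by simp
  rw [h1, map_add]
  refine Submodule.add_mem _ (rank _ (Submodule.sub_mem _ hv (hTV _)) ⟨0, 0, ?_⟩) (hTx _)
  change v.2.2 ι - (T (v.2.2 ι)).2.2 ι = _
  rw [hT1, sub_self]
  refine symMul_ext fun _ => ?_
  simp [powForm_apply]

end MixedCoordinates

/-! ### Differentials of maps in charts. -/

section ManifoldLemmas

variable {H : Type*} [NormedAddCommGroup H] [NormedSpace ℝ H] {A : Type*} [TopologicalSpace A]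
  [ChartedSpace H A]
  {H' : Type*} [NormedAddCommGroup H'] [NormedSpace ℝ H'] {B : Type*} [TopologicalSpace B]
  [ChartedSpace H' B]
  {K : Type*} [NormedAddCommGroup K] [NormedSpace ℝ K] {X : Type*} [TopologicalSpace X]
  [ChartedSpace K X]

/-- The differential of a chart. -/
def chartDeriv (c : OpenPartialHomeomorph A H) (θ : A) : TangentSpace 𝓘(ℝ, H) θ →L[ℝ] H :=
  mfderiv 𝓘(ℝ, H) 𝓘(ℝ, H) c θ

theorem mdiff {f : A → B} {θ : A}
    (hf : ContMDiffAt 𝓘(ℝ, H) 𝓘(ℝ, H') ∞ f θ) : MDifferentiableAt 𝓘(ℝ, H) 𝓘(ℝ, H') f θ :=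
  hf.mdifferentiableAt (by simp)

variable [IsManifold 𝓘(ℝ, H) ∞ A] [IsManifold 𝓘(ℝ, H') ∞ B] [IsManifold 𝓘(ℝ, K) ∞ X]
  {c : OpenPartialHomeomorph A H} {c' : OpenPartialHomeomorph B H'}

theorem contMDiffAt_of_mem_atlas (hc : c ∈ atlas H A) {θ : A} (hθ : θ ∈ c.source) :
    ContMDiffAt 𝓘(ℝ, H) 𝓘(ℝ, H) ∞ c θ :=
  (contMDiffOn_of_mem_maximalAtlas (StructureGroupoid.subset_maximalAtlas _ hc)).contMDiffAt
    (c.open_source.mem_nhds hθ)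

theorem contMDiffAt_symm_of_mem_atlas (hc : c ∈ atlas H A) {w : H} (hw : w ∈ c.target) :
    ContMDiffAt 𝓘(ℝ, H) 𝓘(ℝ, H) ∞ c.symm w :=
  (contMDiffOn_symm_of_mem_maximalAtlas (StructureGroupoid.subset_maximalAtlas _ hc)).contMDiffAt
    (c.open_target.mem_nhds hw)

theorem isManifold_one : IsManifold 𝓘(ℝ, H) 1 A :=
  IsManifold.of_le (n := ∞) (by exact_mod_cast le_top)

theorem chartDeriv_bijective (hc : c ∈ atlas H A) {θ : A} (hθ : θ ∈ c.source) :
    Bijective (chartDeriv c θ) := by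
  have : IsManifold 𝓘(ℝ, H) 1 A := isManifold_one
  exact (mdifferentiable_of_mem_atlas (I := 𝓘(ℝ, H)) hc).mfderiv_bijective hθ

theorem chartDeriv_eq_zero_iff (hc : c ∈ atlas H A) {θ : A} (hθ : θ ∈ c.source)
    {v : TangentSpace 𝓘(ℝ, H) θ} : chartDeriv c θ v = 0 ↔ v = 0 :=
  ⟨fun h => (chartDeriv_bijective hc hθ).1 (by rw [h, map_zero]), fun h => by rw [h, map_zero]⟩

/-- The differential of a map in charts. -/
theorem fderiv_chart (hc : c ∈ atlas H A) (hc' : c' ∈ atlas H' B) {Φ : A → B} {θ : A}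
    (hΦ : ContMDiffAt 𝓘(ℝ, H) 𝓘(ℝ, H') ∞ Φ θ) (hθ : θ ∈ c.source) (hθ' : Φ θ ∈ c'.source)
    (v : TangentSpace 𝓘(ℝ, H) θ) :
    fderiv ℝ (c' ∘ Φ ∘ c.symm) (c θ) (chartDeriv c θ v) =
      chartDeriv c' (Φ θ) (mfderiv 𝓘(ℝ, H) 𝓘(ℝ, H') Φ θ v) := by
  have h1 := mdiff (contMDiffAt_of_mem_atlas hc hθ)
  have h2 := mdiff (contMDiffAt_of_mem_atlas hc' hθ')
  have hs := contMDiffAt_symm_of_mem_atlas hc (c.map_source hθ)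
  have hΦ2 : ContMDiffAt 𝓘(ℝ, H) 𝓘(ℝ, H') ∞ Φ (c.symm (c θ)) := by rwa [c.left_inv hθ]
  have h3 : ContMDiffAt 𝓘(ℝ, H') 𝓘(ℝ, H') ∞ c' (Φ (c.symm (c θ))) := by
    rw [c.left_inv hθ]; exact contMDiffAt_of_mem_atlas hc' hθ'
  have h4 : ContMDiffAt 𝓘(ℝ, H) 𝓘(ℝ, H') ∞ (c' ∘ Φ ∘ c.symm) (c θ) :=
    ContMDiffAt.comp _ h3 (ContMDiffAt.comp _ hΦ2 hs)
  have h5 := mfderiv_comp θ (mdiff h4) h1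
  have h6 := mfderiv_comp θ h2 (mdiff hΦ)
  have h7 : (c' ∘ Φ ∘ c.symm) ∘ c =ᶠ[𝓝 θ] c' ∘ Φ := by
    filter_upwards [c.open_source.mem_nhds hθ] with z hz
    simp [c.left_inv hz]
  rw [h7.mfderiv_eq, h6, mfderiv_eq_fderiv] at h5
  exact (congrArg (fun L => L v) h5).symm

/-- In the charts `c` and `c'`, the map `π` is the linear map `P`. -/
def LinearInCharts (π : A → B) (c : OpenPartialHomeomorph A H) (c' : OpenPartialHomeomorph B H')
    (P : H →L[ℝ] H') : Prop :=
  ∀ θ ∈ c.source, π θ ∈ c'.source ∧ c' (π θ) = P (c θ)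

namespace LinearInCharts

variable {π : A → B} {P : H →L[ℝ] H'}

theorem contMDiffAt (h : LinearInCharts π c c' P) (hc : c ∈ atlas H A) (hc' : c' ∈ atlas H' B)
    {θ : A} (hθ : θ ∈ c.source) : ContMDiffAt 𝓘(ℝ, H) 𝓘(ℝ, H') ∞ π θ := by
  have h1 : π =ᶠ[𝓝 θ] c'.symm ∘ P ∘ c := by
    filter_upwards [c.open_source.mem_nhds hθ] with z hz
    rw [Function.comp_apply, Function.comp_apply, ← (h z hz).2, c'.left_inv (h z hz).1]
  refine ContMDiffAt.congr_of_eventuallyEq ?_ h1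
  have h2 : P (c θ) ∈ c'.target := by
    rw [← (h θ hθ).2]; exact c'.map_source (h θ hθ).1
  exact ContMDiffAt.comp θ (contMDiffAt_symm_of_mem_atlas hc' h2)
    (ContMDiffAt.comp θ P.contDiff.contMDiff.contMDiffAt (contMDiffAt_of_mem_atlas hc hθ))

/-- All projections between jet spaces are linear in matching charts. Hence kernels and images of
their differentials reduce to linear algebra of coordinates. -/
theorem chartDeriv_mfderiv (h : LinearInCharts π c c' P) (hc : c ∈ atlas H A)
    (hc' : c' ∈ atlas H' B) {θ : A} (hθ : θ ∈ c.source) (v : TangentSpace 𝓘(ℝ, H) θ) :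
    chartDeriv c' (π θ) (mfderiv 𝓘(ℝ, H) 𝓘(ℝ, H') π θ v) = P (chartDeriv c θ v) := by
  rw [← fderiv_chart hc hc' (h.contMDiffAt hc hc' hθ) hθ (h θ hθ).1]
  have h1 : c' ∘ π ∘ c.symm =ᶠ[𝓝 (c θ)] P := by
    filter_upwards [c.open_target.mem_nhds (c.map_source hθ)] with w hw
    rw [Function.comp_apply, Function.comp_apply, (h _ (c.map_target hw)).2, c.right_inv hw]
  rw [h1.fderiv_eq, P.fderiv]

theorem mfderiv_eq_zero_iff (h : LinearInCharts π c c' P) (hc : c ∈ atlas H A)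
    (hc' : c' ∈ atlas H' B) {θ : A} (hθ : θ ∈ c.source) (v : TangentSpace 𝓘(ℝ, H) θ) :
    mfderiv 𝓘(ℝ, H) 𝓘(ℝ, H') π θ v = 0 ↔ P (chartDeriv c θ v) = 0 := by
  rw [← h.chartDeriv_mfderiv hc hc' hθ, chartDeriv_eq_zero_iff hc' (h θ hθ).1]

theorem mfderiv_surjective (h : LinearInCharts π c c' P) (hc : c ∈ atlas H A)
    (hc' : c' ∈ atlas H' B) (hP : Surjective P) {θ : A} (hθ : θ ∈ c.source) :
    Surjective (mfderiv 𝓘(ℝ, H) 𝓘(ℝ, H') π θ) := by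
  intro u
  obtain ⟨w, hw⟩ := hP (chartDeriv c' (π θ) u)
  obtain ⟨v, hv⟩ := (chartDeriv_bijective hc hθ).2 w
  refine ⟨v, (chartDeriv_bijective hc' (h θ hθ).1).1 ?_⟩
  rw [h.chartDeriv_mfderiv hc hc' hθ, hv, hw]

/-- In the chart, the section is the affine lift through `θ` itself, which stays in the target of
the chart for points near `π θ`. -/
theorem exists_section (h : LinearInCharts π c c' P) (hc : c ∈ atlas H A) (hc' : c' ∈ atlas H' B)
    {R : H' →L[ℝ] H} (hR : ∀ u, P (R u) = u) {θ : A} (hθ : θ ∈ c.source) :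
    ∃ σ : B → A, ContMDiffAt 𝓘(ℝ, H') 𝓘(ℝ, H) ∞ σ (π θ) ∧ ∀ᶠ b in 𝓝 (π θ), π (σ b) = b := by
  let r : H' → H := fun u => R (u - P (c θ)) + c θ
  have hr : ContDiff ℝ ∞ r := (R.contDiff.comp (contDiff_id.sub contDiff_const)).add contDiff_const
  have hr0 : r (c' (π θ)) = c θ := by simp [r, (h θ hθ).2]
  have hrt : r (c' (π θ)) ∈ c.target := by rw [hr0]; exact c.map_source hθ
  refine ⟨c.symm ∘ r ∘ c', ?_, ?_⟩
  · exact ContMDiffAt.comp _ (contMDiffAt_symm_of_mem_atlas hc hrt)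
      (ContMDiffAt.comp _ hr.contMDiff.contMDiffAt (contMDiffAt_of_mem_atlas hc' (h θ hθ).1))
  · have h1 : ∀ᶠ b in 𝓝 (π θ), r (c' b) ∈ c.target :=
      (hr.continuous.continuousAt.comp (c'.continuousAt (h θ hθ).1)).eventually
        (c.open_target.mem_nhds hrt)
    filter_upwards [h1, c'.open_source.mem_nhds (h θ hθ).1] with b hb hb'
    have h2 := h _ (c.map_target hb)
    refine c'.injOn h2.1 hb' (h2.2.trans ?_)
    rw [c.right_inv hb]
    simp [r, hR]

end LinearInCharts

/-- A map with vanishing differential is locally constant. -/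
theorem isLocallyConstant_of_mfderiv_eq_zero {f : X → B} (hf : ContMDiff 𝓘(ℝ, K) 𝓘(ℝ, H') ∞ f)
    (h0 : ∀ x v, mfderiv 𝓘(ℝ, K) 𝓘(ℝ, H') f x v = 0) : IsLocallyConstant f := by
  rw [IsLocallyConstant.iff_eventually_eq]
  intro x
  have hcx := chart_mem_atlas K x
  have hcf := chart_mem_atlas H' (f x)
  set e := chartAt K x
  set e' := chartAt H' (f x)
  have hx : x ∈ e.source := mem_chart_source K x
  have hfx : f x ∈ e'.source := mem_chart_source H' (f x)
  have h1 : ∀ᶠ w in 𝓝 (e x), w ∈ e.target ∧ f (e.symm w) ∈ e'.source := by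
    refine Filter.Eventually.and (e.open_target.mem_nhds (e.map_source hx)) ?_
    have : ContinuousAt (f ∘ e.symm) (e x) := hf.continuous.continuousAt.comp
      (e.continuousAt_symm (e.map_source hx))
    refine this.eventually (e'.open_source.mem_nhds ?_)
    simpa [e.left_inv hx] using hfx
  obtain ⟨ε, hε, hball⟩ := Metric.eventually_nhds_iff_ball.1 h1
  have hd : ∀ w ∈ Metric.ball (e x) ε,
      HasFDerivAt (e' ∘ f ∘ e.symm) (0 : K →L[ℝ] H') w := by
    intro w hw
    obtain ⟨hw1, hw2⟩ := hball w hw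
    have h2 : ContMDiffAt 𝓘(ℝ, K) 𝓘(ℝ, H') ∞ (e' ∘ f ∘ e.symm) w :=
      ContMDiffAt.comp _ (contMDiffAt_of_mem_atlas hcf hw2)
        (ContMDiffAt.comp _ hf.contMDiffAt (contMDiffAt_symm_of_mem_atlas hcx hw1))
    have h3 := (mdifferentiableAt_iff_differentiableAt.1 (mdiff h2)).hasFDerivAt
    convert! h3
    ext1 u
    obtain ⟨v, rfl⟩ := (chartDeriv_bijective hcx (e.map_target hw1)).2 u
    have h4 := fderiv_chart hcx hcf (hf.contMDiffAt (x := e.symm w)) (e.map_target hw1) hw2 v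
    rw [e.right_inv hw1] at h4
    rw [h4, h0, map_zero]
    rfl
  have hconst : ∀ w ∈ Metric.ball (e x) ε, (e' ∘ f ∘ e.symm) w = (e' ∘ f ∘ e.symm) (e x) := by
    intro w hw
    exact (convex_ball (e x) ε).is_const_of_fderivWithin_eq_zero
      (fun z hz => (hd z hz).differentiableAt.differentiableWithinAt)
      (fun z hz => ((hd z hz).hasFDerivWithinAt).fderivWithin
        (Metric.isOpen_ball.uniqueDiffWithinAt hz)) hw (Metric.mem_ball_self hε)
  have h5 : ∀ᶠ y in 𝓝 x, y ∈ e.source ∧ e y ∈ Metric.ball (e x) ε :=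
    Filter.Eventually.and (e.open_source.mem_nhds hx) ((e.continuousAt hx).eventually (Metric.ball_mem_nhds _ hε))
  filter_upwards [h5] with y ⟨hy1, hy2⟩
  have h6 := hconst _ hy2
  simp only [Function.comp_apply, e.left_inv hy1, e.left_inv hx] at h6
  have h7 := (hball _ hy2).2
  rw [e.left_inv hy1] at h7
  exact e'.injOn h7 hfx h6

end ManifoldLemmas

/-! ### From vertical vectors to fibres, and descent along a submersion. -/

section Fibres

variable {H : Type*} [NormedAddCommGroup H] [NormedSpace ℝ H] {A : Type*} [TopologicalSpace A]
  [ChartedSpace H A]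
  {H' : Type*} [NormedAddCommGroup H'] [NormedSpace ℝ H'] {B : Type*} [TopologicalSpace B]
  [ChartedSpace H' B]
  {K : Type*} [NormedAddCommGroup K] [NormedSpace ℝ K] {X : Type*} [TopologicalSpace X]
  [ChartedSpace K X]

/-- If the vertical vectors of `π` are annihilated by the differential of `Ψ`, then `Ψ` is constant
along connected families in the fibres of `π`. -/
theorem eq_of_fibre_family {H'' : Type*} [NormedAddCommGroup H''] [NormedSpace ℝ H''] {C : Type*}
    [TopologicalSpace C] [ChartedSpace H'' C] [IsManifold 𝓘(ℝ, H'') ∞ C]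
    [IsManifold 𝓘(ℝ, K) ∞ X] [PreconnectedSpace X]
    {π : A → B} (hπ : ContMDiff 𝓘(ℝ, H) 𝓘(ℝ, H') ∞ π) {Ψ : A → C}
    (hΨ : ContMDiff 𝓘(ℝ, H) 𝓘(ℝ, H'') ∞ Ψ)
    (hker : ∀ θ v, mfderiv 𝓘(ℝ, H) 𝓘(ℝ, H') π θ v = 0 → mfderiv 𝓘(ℝ, H) 𝓘(ℝ, H'') Ψ θ v = 0)
    {γ : X → A} (hγ : ContMDiff 𝓘(ℝ, K) 𝓘(ℝ, H) ∞ γ) (hconst : ∀ x y, π (γ x) = π (γ y))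
    (x y : X) : Ψ (γ x) = Ψ (γ y) := by
  refine (isLocallyConstant_of_mfderiv_eq_zero (hΨ.comp hγ) fun z v => ?_).apply_eq_of_preconnectedSpace
    x y
  rw [mfderiv_comp z (mdiff hΨ.contMDiffAt) (mdiff hγ.contMDiffAt)]
  refine hker _ _ ?_
  have h1 := mfderiv_comp z (mdiff (hπ.contMDiffAt (x := γ z))) (mdiff hγ.contMDiffAt)
  -- The family stays in one fibre, so its velocities are vertical.
  have h2 : π ∘ γ = fun _ => π (γ z) := funext fun y => hconst y z
  rw [h2, mfderiv_const] at h1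
  exact (congrArg (fun L => L v) h1).symm

/-- A diffeomorphism mapping fibres of `π` to fibres descends to a diffeomorphism. -/
theorem exists_descent {π : A → B} (hπ : ContMDiff 𝓘(ℝ, H) 𝓘(ℝ, H') ∞ π)
    (hsec : ∀ b, ∃ σ : B → A, ContMDiffAt 𝓘(ℝ, H') 𝓘(ℝ, H) ∞ σ b ∧ ∀ᶠ b' in 𝓝 b, π (σ b') = b')
    (Φ : A ≃ₘ⟮𝓘(ℝ, H), 𝓘(ℝ, H)⟯ A)
    (h1 : ∀ θ θ', π θ = π θ' → π (Φ θ) = π (Φ θ'))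
    (h2 : ∀ θ θ', π θ = π θ' → π (Φ.symm θ) = π (Φ.symm θ')) :
    ∃ Φ₀ : B ≃ₘ⟮𝓘(ℝ, H'), 𝓘(ℝ, H')⟯ B, ∀ θ, Φ₀ (π θ) = π (Φ θ) := by
  -- The descended map at `b` is `π ∘ Φ ∘ σ b` evaluated at `b`, with a different section at each
  -- point. Since `Φ` respects fibres, near `b` it coincides with the smooth map built from the
  -- single section `σ b`.
  choose σ hσ1 hσ2 using hsec
  have hs : ∀ b, π (σ b b) = b := fun b => (hσ2 b).self_of_nhds
  have hsm : ∀ Ψ : A ≃ₘ⟮𝓘(ℝ, H), 𝓘(ℝ, H)⟯ A, (∀ θ θ', π θ = π θ' → π (Ψ θ) = π (Ψ θ')) →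
      ContMDiff 𝓘(ℝ, H') 𝓘(ℝ, H') ∞ (fun b => π (Ψ (σ b b))) := by
    intro Ψ hΨ b
    refine ContMDiffAt.congr_of_eventuallyEq (f := π ∘ Ψ ∘ σ b) ?_ ?_
    · exact ContMDiffAt.comp b hπ.contMDiffAt (ContMDiffAt.comp b Ψ.contMDiff.contMDiffAt (hσ1 b))
    · filter_upwards [hσ2 b] with b' hb'
      exact hΨ _ _ ((hs b').trans hb'.symm)
  exact ⟨{ toFun := fun b => π (Φ (σ b b))
           invFun := fun b => π (Φ.symm (σ b b))
           left_inv := fun b => by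
            exact (h2 _ _ (hs (π (Φ (σ b b))))).trans (by rw [Φ.symm_apply_apply, hs])
           right_inv := fun b => by
            exact (h1 _ _ (hs (π (Φ.symm (σ b b))))).trans (by rw [Φ.apply_symm_apply, hs])
           contMDiff_toFun := hsm Φ h1
           contMDiff_invFun := hsm Φ.symm h2 }, fun θ => h1 _ _ (hs _)⟩

end Fibres

/-! ### Charts of jet spaces, in which the projections are linear. -/

section JetCharts

variable {E : Type*} [NormedAddCommGroup E] [NormedSpace ℝ E]
  {M : Type*} [TopologicalSpace M] [ChartedSpace E M] [IsManifold 𝓘(ℝ, E) ∞ M]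
  {F : Type*} [NormedAddCommGroup F] [NormedSpace ℝ F] [FiniteDimensional ℝ F]
  {N : Type*} [TopologicalSpace N] [ChartedSpace F N] [IsManifold 𝓘(ℝ, F) ∞ N]
  {F₁ : Type*} [NormedAddCommGroup F₁] [NormedSpace ℝ F₁] [FiniteDimensional ℝ F₁]
  {N₁ : Type*} [TopologicalSpace N₁] [ChartedSpace F₁ N₁] [IsManifold 𝓘(ℝ, F₁) ∞ N₁]
  {F₂ : Type*} [NormedAddCommGroup F₂] [NormedSpace ℝ F₂] [FiniteDimensional ℝ F₂]
  {N₂ : Type*} [TopologicalSpace N₂] [ChartedSpace F₂ N₂] [IsManifold 𝓘(ℝ, F₂) ∞ N₂]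
  {k j k₁ k₂ j₁ j₂ : ℕ}

theorem LinearInCharts.comp {H H' H'' A B C : Type*} [NormedAddCommGroup H] [NormedSpace ℝ H]
    [TopologicalSpace A] [NormedAddCommGroup H'] [NormedSpace ℝ H'] [TopologicalSpace B]
    [NormedAddCommGroup H''] [NormedSpace ℝ H''] [TopologicalSpace C]
    {c : OpenPartialHomeomorph A H} {c' : OpenPartialHomeomorph B H'}
    {c'' : OpenPartialHomeomorph C H''} {π : A → B} {π' : B → C} {P : H →L[ℝ] H'}
    {P' : H' →L[ℝ] H''} (h' : LinearInCharts π' c' c'' P') (h : LinearInCharts π c c' P) :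
    LinearInCharts (π' ∘ π) c c'' (P' ∘L P) := by
  intro θ hθ
  obtain ⟨h1, h2⟩ := h θ hθ
  obtain ⟨h3, h4⟩ := h' _ h1
  exact ⟨h3, by rw [Function.comp_apply, h4, h2]; rfl⟩

variable (E F) in
/-- The chart of the jet space as an open partial homeomorphism. -/
def jetOPH (k : ℕ) (a : M) (b : N) : OpenPartialHomeomorph (Jet E M F N k) (JetCoord E F k) :=
  (jetCore E M F N k).openPartialHomeomorph (jetChart k a b) ⟨(a, b), rfl⟩

theorem jetOPH_mem_atlas (k : ℕ) (a : M) (b : N) :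
    jetOPH E F k a b ∈ atlas (JetCoord E F k) (Jet E M F N k) :=
  Set.mem_iUnion.2 ⟨jetChart k a b, Set.mem_iUnion.2 ⟨⟨(a, b), rfl⟩, rfl⟩⟩

theorem mem_jetOPH_self (θ : Jet E M F N k) : θ ∈ (jetOPH E F k θ.base θ.value).source :=
  ⟨mem_chart_source E θ.base, mem_chart_source F θ.value⟩

theorem mem_jetOPH_target {a : M} {b : N} {w : JetCoord E F k} :
    w ∈ (jetOPH E F k a b).target ↔
      w.1 ∈ (chartAt E a).target ∧ (w.2 0).1 0 ∈ (chartAt F b).target := Iff.rfl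

theorem jetOPH_jetOf {a : M} {b : N} {s : M → N} {x : M}
    (hs : SmoothNear E F s x) (ha : x ∈ (chartAt E a).source) (hb : s x ∈ (chartAt F b).source) :
    jetOPH E F k a b (jetOf E F k s x) =
      (chartAt E a x, derivs k (localRep E F a b s) (chartAt E a x)) := jetChart_jetOf hs ha hb

variable (F) in
/-- The chart of the mixed jet space as an open partial homeomorphism. -/
def mixedOPH (E F₁ F₂ : Type*) [NormedAddCommGroup E] [NormedSpace ℝ E]
    {M : Type*} [TopologicalSpace M] [ChartedSpace E M] [IsManifold 𝓘(ℝ, E) ∞ M]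
    [NormedAddCommGroup F₁] [NormedSpace ℝ F₁] [FiniteDimensional ℝ F₁]
    {N₁ : Type*} [TopologicalSpace N₁] [ChartedSpace F₁ N₁] [IsManifold 𝓘(ℝ, F₁) ∞ N₁]
    [NormedAddCommGroup F₂] [NormedSpace ℝ F₂] [FiniteDimensional ℝ F₂]
    {N₂ : Type*} [TopologicalSpace N₂] [ChartedSpace F₂ N₂] [IsManifold 𝓘(ℝ, F₂) ∞ N₂]
    (k₁ k₂ : ℕ) (a : M) (b₁ : N₁) (b₂ : N₂) :
    OpenPartialHomeomorph (MixedJet E M F₁ N₁ F₂ N₂ k₁ k₂) (MixedCoord E F₁ F₂ k₁ k₂) :=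
  (mixedCore E M F₁ N₁ F₂ N₂ k₁ k₂).openPartialHomeomorph (mixedChart k₁ k₂ a b₁ b₂)
    ⟨(a, b₁, b₂), rfl⟩

theorem mixedOPH_mem_atlas (k₁ k₂ : ℕ) (a : M) (b₁ : N₁) (b₂ : N₂) :
    mixedOPH E F₁ F₂ k₁ k₂ a b₁ b₂ ∈
      atlas (MixedCoord E F₁ F₂ k₁ k₂) (MixedJet E M F₁ N₁ F₂ N₂ k₁ k₂) :=
  Set.mem_iUnion.2 ⟨mixedChart k₁ k₂ a b₁ b₂, Set.mem_iUnion.2 ⟨⟨(a, b₁, b₂), rfl⟩, rfl⟩⟩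

theorem mem_mixedOPH_self (θ : MixedJet E M F₁ N₁ F₂ N₂ k₁ k₂) :
    θ ∈ (mixedOPH E F₁ F₂ k₁ k₂ θ.base θ.fst.value θ.snd.value).source :=
  (mixedCore E M F₁ N₁ F₂ N₂ k₁ k₂).mem_chart_source θ

variable (E F) in
/-- The restriction to derivatives of order at most `j`. -/
def truncCoord (h : j ≤ k) : JetCoord E F k →L[ℝ] JetCoord E F j :=
  (ContinuousLinearMap.fst ℝ _ _).prod (ContinuousLinearMap.pi fun i =>
    (ContinuousLinearMap.proj (R := ℝ) (φ := fun i : Fin (k + 1) => SymMul E F i)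
      ⟨i, by omega⟩) ∘L ContinuousLinearMap.snd ℝ _ _)

/-- The contact equations of order less than `j` involve only entries of order at most `j`. -/
theorem mem_coordCartan_trunc (h : j ≤ k) {w v : JetCoord E F k} :
    truncCoord E F h v ∈ coordCartan le_rfl (truncCoord E F h w) ↔ v ∈ coordCartan h w := by
  rw [mem_coordCartan, mem_coordCartan]
  rfl

theorem Jet.trunc_base (h : j ≤ k) (θ : Jet E M F N k) : (θ.trunc h).base = θ.base := rfl

theorem Jet.trunc_value (h : j ≤ k) (θ : Jet E M F N k) : (θ.trunc h).value = θ.value := by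
  rw [θ.value_eq_rep]
  exact jetOf_value _ _ _

theorem Jet.trunc_self (h : k ≤ k) (θ : Jet E M F N k) : θ.trunc h = θ := θ.jetOf_rep

theorem linearInCharts_trunc (h : j ≤ k) (a : M) (b : N) :
    LinearInCharts (Jet.trunc h : Jet E M F N k → Jet E M F N j) (jetOPH E F k a b)
      (jetOPH E F j a b) (truncCoord E F h) := by
  rintro θ ⟨h1, h2⟩
  refine ⟨⟨h1, by rwa [Jet.trunc_value]⟩, ?_⟩
  have h3 : θ.rep θ.base ∈ (chartAt F b).source := by rwa [← θ.value_eq_rep]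
  exact jetOPH_jetOf θ.smoothNear_rep h1 h3

theorem linearInCharts_base (a : M) (b : N) :
    LinearInCharts (Jet.base : Jet E M F N k → M) (jetOPH E F k a b) (chartAt E a)
      (ContinuousLinearMap.fst ℝ _ _) := fun _ h => ⟨h.1, rfl⟩

variable (E F) in
/-- The coordinates of the target point of a jet. -/
def valueCoord (k : ℕ) : JetCoord E F k →L[ℝ] F :=
  (ContinuousMultilinearMap.apply ℝ (fun _ : Fin ((0 : Fin (k + 1)) : ℕ) => E) F 0) ∘L
    (SymMul E F ((0 : Fin (k + 1)) : ℕ)).subtypeL ∘L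
    (ContinuousLinearMap.proj (R := ℝ) (φ := fun i : Fin (k + 1) => SymMul E F i) 0) ∘L
      ContinuousLinearMap.snd ℝ _ _

theorem linearInCharts_value (a : M) (b : N) :
    LinearInCharts (Jet.value : Jet E M F N k → N) (jetOPH E F k a b) (chartAt F b)
      (valueCoord E F k) := by
  rintro θ ⟨h1, h2⟩
  refine ⟨h2, ?_⟩
  change _ = (derivs k (localRep E F a b θ.rep) (chartAt E a θ.base) 0).1 0
  rw [derivs_zero]
  simp [localRep, (chartAt E a).left_inv h1, θ.value_eq_rep]

theorem linearInCharts_fst (a : M) (b₁ : N₁) (b₂ : N₂) :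
    LinearInCharts (MixedJet.fst : MixedJet E M F₁ N₁ F₂ N₂ k₁ k₂ → Jet E M F₁ N₁ k₁)
      (mixedOPH E F₁ F₂ k₁ k₂ a b₁ b₂) (jetOPH E F₁ k₁ a b₁) (fstCoord E F₁ F₂ k₁ k₂) :=
  fun _ h => ⟨h.1, rfl⟩

theorem linearInCharts_snd (a : M) (b₁ : N₁) (b₂ : N₂) :
    LinearInCharts (MixedJet.snd : MixedJet E M F₁ N₁ F₂ N₂ k₁ k₂ → Jet E M F₂ N₂ k₂)
      (mixedOPH E F₁ F₂ k₁ k₂ a b₁ b₂) (jetOPH E F₂ k₂ a b₂) (sndCoord E F₁ F₂ k₁ k₂) := by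
  intro θ h
  refine ⟨h.2, Prod.ext ?_ rfl⟩
  change chartAt E a θ.snd.base = chartAt E a θ.fst.base
  rw [θ.base_eq]

variable (E F₁ F₂) in
/-- The restriction to derivatives of lower order of both components. -/
def mixedTruncCoord (h₁ : j₁ ≤ k₁) (h₂ : j₂ ≤ k₂) :
    MixedCoord E F₁ F₂ k₁ k₂ →L[ℝ] MixedCoord E F₁ F₂ j₁ j₂ :=
  (ContinuousLinearMap.fst ℝ _ _).prod
    ((ContinuousLinearMap.snd ℝ _ _ ∘L truncCoord E F₁ h₁ ∘L fstCoord E F₁ F₂ k₁ k₂).prod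
      (ContinuousLinearMap.snd ℝ _ _ ∘L truncCoord E F₂ h₂ ∘L sndCoord E F₁ F₂ k₁ k₂))

theorem linearInCharts_mixedTrunc (h₁ : j₁ ≤ k₁) (h₂ : j₂ ≤ k₂) (a : M) (b₁ : N₁) (b₂ : N₂) :
    LinearInCharts (MixedJet.trunc h₁ h₂ :
      MixedJet E M F₁ N₁ F₂ N₂ k₁ k₂ → MixedJet E M F₁ N₁ F₂ N₂ j₁ j₂)
      (mixedOPH E F₁ F₂ k₁ k₂ a b₁ b₂) (mixedOPH E F₁ F₂ j₁ j₂ a b₁ b₂)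
      (mixedTruncCoord E F₁ F₂ h₁ h₂) := by
  intro θ h
  have e1 := linearInCharts_trunc h₁ a b₁ θ.fst h.1
  have e2 := linearInCharts_trunc h₂ a b₂ θ.snd h.2
  have e3 := congrArg Prod.snd e1.2
  have e4 := congrArg Prod.snd e2.2
  exact ⟨⟨e1.1, e2.1⟩, Prod.ext rfl (Prod.ext e3 e4)⟩

theorem contMDiff_trunc (h : j ≤ k) :
    ContMDiff 𝓘(ℝ, JetCoord E F k) 𝓘(ℝ, JetCoord E F j) ∞
      (Jet.trunc h : Jet E M F N k → Jet E M F N j) := fun θ =>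
  (linearInCharts_trunc h θ.base θ.value).contMDiffAt (jetOPH_mem_atlas _ _ _)
    (jetOPH_mem_atlas _ _ _) (mem_jetOPH_self θ)

theorem contMDiff_base :
    ContMDiff 𝓘(ℝ, JetCoord E F k) 𝓘(ℝ, E) ∞ (Jet.base : Jet E M F N k → M) := fun θ =>
  (linearInCharts_base θ.base θ.value).contMDiffAt (jetOPH_mem_atlas _ _ _)
    (chart_mem_atlas _ _) (mem_jetOPH_self θ)

theorem contMDiff_value :
    ContMDiff 𝓘(ℝ, JetCoord E F k) 𝓘(ℝ, F) ∞ (Jet.value : Jet E M F N k → N) := fun θ =>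
  (linearInCharts_value θ.base θ.value).contMDiffAt (jetOPH_mem_atlas _ _ _)
    (chart_mem_atlas _ _) (mem_jetOPH_self θ)

theorem contMDiff_fst : ContMDiff 𝓘(ℝ, MixedCoord E F₁ F₂ k₁ k₂) 𝓘(ℝ, JetCoord E F₁ k₁) ∞
    (MixedJet.fst : MixedJet E M F₁ N₁ F₂ N₂ k₁ k₂ → Jet E M F₁ N₁ k₁) := fun θ =>
  (linearInCharts_fst θ.base θ.fst.value θ.snd.value).contMDiffAt (mixedOPH_mem_atlas _ _ _ _ _)
    (jetOPH_mem_atlas _ _ _) (mem_mixedOPH_self θ)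

theorem contMDiff_snd : ContMDiff 𝓘(ℝ, MixedCoord E F₁ F₂ k₁ k₂) 𝓘(ℝ, JetCoord E F₂ k₂) ∞
    (MixedJet.snd : MixedJet E M F₁ N₁ F₂ N₂ k₁ k₂ → Jet E M F₂ N₂ k₂) := fun θ =>
  (linearInCharts_snd θ.base θ.fst.value θ.snd.value).contMDiffAt (mixedOPH_mem_atlas _ _ _ _ _)
    (jetOPH_mem_atlas _ _ _) (mem_mixedOPH_self θ)

theorem contMDiff_mixedTrunc (h₁ : j₁ ≤ k₁) (h₂ : j₂ ≤ k₂) :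
    ContMDiff 𝓘(ℝ, MixedCoord E F₁ F₂ k₁ k₂) 𝓘(ℝ, MixedCoord E F₁ F₂ j₁ j₂) ∞
      (MixedJet.trunc h₁ h₂ :
        MixedJet E M F₁ N₁ F₂ N₂ k₁ k₂ → MixedJet E M F₁ N₁ F₂ N₂ j₁ j₂) := fun θ =>
  (linearInCharts_mixedTrunc h₁ h₂ θ.base θ.fst.value θ.snd.value).contMDiffAt
    (mixedOPH_mem_atlas _ _ _ _ _) (mixedOPH_mem_atlas _ _ _ _ _) (mem_mixedOPH_self θ)

/-- Jet prolongations in charts. -/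
theorem jetOPH_comp_jetOf {a : M} {b : N} {s : M → N} {x : M}
    (hs : SmoothNear E F s x) (ha : x ∈ (chartAt E a).source) (hb : s x ∈ (chartAt F b).source) :
    ∀ᶠ z in 𝓝 x, jetOf E F k s z ∈ (jetOPH E F k a b).source ∧
      jetOPH E F k a b (jetOf E F k s z) =
        (chartAt E a z, derivs k (localRep E F a b s) (chartAt E a z)) := by
  have h1 : ∀ᶠ z in 𝓝 x, s z ∈ (chartAt F b).source :=
    hs.self_of_nhds.continuousAt.eventually ((chartAt F b).open_source.mem_nhds hb)
  filter_upwards [h1, (chartAt E a).open_source.mem_nhds ha, hs.eventually_nhds] with z hz hz' hsz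
  exact ⟨⟨hz', by rwa [jetOf_value]⟩, jetOPH_jetOf hsz hz' hz⟩

theorem contMDiffAt_derivs_localRep {a : M} {b : N} {s : M → N} {x : M}
    (hs : SmoothNear E F s x) (ha : x ∈ (chartAt E a).source) (hb : s x ∈ (chartAt F b).source) :
    ContDiffAt ℝ ∞ (fun y => ((y, derivs k (localRep E F a b s) y) : JetCoord E F k))
      (chartAt E a x) :=
  contDiffAt_id.prodMk (contDiffAt_derivs (contDiffAt_localRep hs.self_of_nhds ha hb))

/-- In charts the prolongation is the smooth map `y ↦ (y, derivs k (localRep s) y)`. -/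
theorem contMDiffAt_jetOf {s : M → N} {x : M} (hs : SmoothNear E F s x) :
    ContMDiffAt 𝓘(ℝ, E) 𝓘(ℝ, JetCoord E F k) ∞ (jetOf E F k s) x := by
  have ha := mem_chart_source E x
  have hb := mem_chart_source F (s x)
  have h1 := jetOPH_comp_jetOf (k := k) hs ha hb
  have h2 : jetOf E F k s =ᶠ[𝓝 x] (jetOPH E F k x (s x)).symm ∘
      (fun y => ((y, derivs k (localRep E F x (s x) s) y) : JetCoord E F k)) ∘ chartAt E x := by
    filter_upwards [h1] with z ⟨hz1, hz2⟩
    rw [Function.comp_apply, Function.comp_apply, ← hz2, OpenPartialHomeomorph.left_inv _ hz1]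
  refine ContMDiffAt.congr_of_eventuallyEq ?_ h2
  have h3 := h1.self_of_nhds
  refine ContMDiffAt.comp x (contMDiffAt_symm_of_mem_atlas (jetOPH_mem_atlas _ _ _) ?_)
    (ContMDiffAt.comp x (contMDiffAt_derivs_localRep hs ha hb).contMDiffAt
      (contMDiffAt_of_mem_atlas (chart_mem_atlas E x) ha))
  simp only [Function.comp_apply]
  rw [← h3.2]
  exact OpenPartialHomeomorph.map_source _ h3.1

theorem contMDiffAt_mixedJetOf {s₁ : M → N₁} {s₂ : M → N₂} {x : M} (hs₁ : SmoothNear E F₁ s₁ x)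
    (hs₂ : SmoothNear E F₂ s₂ x) :
    ContMDiffAt 𝓘(ℝ, E) 𝓘(ℝ, MixedCoord E F₁ F₂ k₁ k₂) ∞ (mixedJetOf E F₁ F₂ k₁ k₂ s₁ s₂) x := by
  have ha := mem_chart_source E x
  have hb₁ := mem_chart_source F₁ (s₁ x)
  have hb₂ := mem_chart_source F₂ (s₂ x)
  have h1 := (jetOPH_comp_jetOf (k := k₁) hs₁ ha hb₁).and (jetOPH_comp_jetOf (k := k₂) hs₂ ha hb₂)
  let c := mixedOPH E F₁ F₂ k₁ k₂ x (s₁ x) (s₂ x)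
  have h4 : ∀ᶠ z in 𝓝 x, mixedJetOf E F₁ F₂ k₁ k₂ s₁ s₂ z ∈ c.source ∧
      c (mixedJetOf E F₁ F₂ k₁ k₂ s₁ s₂ z) =
      (fun y => ((y, derivs k₁ (localRep E F₁ x (s₁ x) s₁) y,
        derivs k₂ (localRep E F₂ x (s₂ x) s₂) y) : MixedCoord E F₁ F₂ k₁ k₂)) (chartAt E x z) := by
    filter_upwards [h1] with z ⟨⟨hz1, hz2⟩, ⟨hz3, hz4⟩⟩
    have e2 := congrArg Prod.snd hz2
    have e4 := congrArg Prod.snd hz4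
    exact ⟨⟨hz1, hz3⟩, Prod.ext rfl (Prod.ext e2 e4)⟩
  have h2 : mixedJetOf E F₁ F₂ k₁ k₂ s₁ s₂ =ᶠ[𝓝 x] c.symm ∘
      (fun y => ((y, derivs k₁ (localRep E F₁ x (s₁ x) s₁) y,
        derivs k₂ (localRep E F₂ x (s₂ x) s₂) y) : MixedCoord E F₁ F₂ k₁ k₂)) ∘ chartAt E x := by
    filter_upwards [h4] with z ⟨hz1, hz2⟩
    rw [Function.comp_apply, Function.comp_apply, ← hz2, OpenPartialHomeomorph.left_inv _ hz1]
  refine ContMDiffAt.congr_of_eventuallyEq ?_ h2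
  have h3 := h4.self_of_nhds
  have h5 : ContDiffAt ℝ ∞ (fun y => ((y, derivs k₁ (localRep E F₁ x (s₁ x) s₁) y,
        derivs k₂ (localRep E F₂ x (s₂ x) s₂) y) : MixedCoord E F₁ F₂ k₁ k₂)) (chartAt E x x) :=
    contDiffAt_id.prodMk
      ((contDiffAt_derivs (contDiffAt_localRep hs₁.self_of_nhds ha hb₁)).prodMk
        (contDiffAt_derivs (contDiffAt_localRep hs₂.self_of_nhds ha hb₂)))
  refine ContMDiffAt.comp x (contMDiffAt_symm_of_mem_atlas (mixedOPH_mem_atlas _ _ _ _ _) ?_)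
    (ContMDiffAt.comp x h5.contMDiffAt (contMDiffAt_of_mem_atlas (chart_mem_atlas E x) ha))
  have h6 := OpenPartialHomeomorph.map_source _ h3.1
  rw [h3.2] at h6
  exact h6

end JetCharts

/-! ### Diffeomorphisms preserving a distribution. -/

section PreservedDistributions

variable {H : Type*} [NormedAddCommGroup H] [NormedSpace ℝ H] {A : Type*} [TopologicalSpace A]
  [ChartedSpace H A]

/-- The differential of `Φ` preserves the distribution `D`. -/
def Preserves (D : A → Submodule ℝ H) (Φ : A → A) : Prop :=
  ∀ θ (v : H), v ∈ D θ → (mfderiv 𝓘(ℝ, H) 𝓘(ℝ, H) Φ θ v : H) ∈ D (Φ θ)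

variable (Φ : A ≃ₘ⟮𝓘(ℝ, H), 𝓘(ℝ, H)⟯ A) {D : A → Submodule ℝ H}

theorem mfderiv_mfderiv_symm (θ : A) (v : H) :
    (mfderiv 𝓘(ℝ, H) 𝓘(ℝ, H) Φ θ (mfderiv 𝓘(ℝ, H) 𝓘(ℝ, H) Φ.symm (Φ θ) v : H) : H) = v := by
  have h1 := mfderiv_comp (Φ θ) (mdiff (Φ.contMDiff.contMDiffAt (x := Φ.symm (Φ θ))))
    (mdiff (Φ.symm.contMDiff.contMDiffAt (x := Φ θ)))
  have h2 : Φ ∘ Φ.symm = id := funext Φ.apply_symm_apply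
  rw [h2, mfderiv_id] at h1
  -- The base points `Φ.symm (Φ θ)` and `θ` agree only propositionally; generalising the point
  -- avoids a rewrite in dependent tangent spaces.
  have h3 : ∀ θ₁, θ₁ = θ → ∀ u : H, (mfderiv 𝓘(ℝ, H) 𝓘(ℝ, H) Φ θ₁ u : H) =
      mfderiv 𝓘(ℝ, H) 𝓘(ℝ, H) Φ θ u := by
    rintro _ rfl _; rfl
  exact (h3 _ (Φ.symm_apply_apply θ) _).symm.trans
    (congrArg (fun L : H →L[ℝ] H => L v) h1).symm

theorem mfderiv_symm_mfderiv (θ : A) (v : H) :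
    (mfderiv 𝓘(ℝ, H) 𝓘(ℝ, H) Φ.symm (Φ θ) (mfderiv 𝓘(ℝ, H) 𝓘(ℝ, H) Φ θ v : H) : H) = v := by
  have h1 := mfderiv_comp θ (mdiff (Φ.symm.contMDiff.contMDiffAt (x := Φ θ)))
    (mdiff (Φ.contMDiff.contMDiffAt (x := θ)))
  have h2 : Φ.symm ∘ Φ = id := funext Φ.symm_apply_apply
  rw [h2, mfderiv_id] at h1
  exact (congrArg (fun L : H →L[ℝ] H => L v) h1).symm

theorem Preserves.exists_mfderiv_eq (hD : Preserves D Φ.symm) (θ : A) {v : H} (hv : v ∈ D (Φ θ)) :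
    ∃ u ∈ D θ, (mfderiv 𝓘(ℝ, H) 𝓘(ℝ, H) Φ θ u : H) = v := by
  refine ⟨(mfderiv 𝓘(ℝ, H) 𝓘(ℝ, H) Φ.symm (Φ θ) v : H), ?_, mfderiv_mfderiv_symm Φ θ v⟩
  have := hD (Φ θ) v hv
  rwa [Φ.symm_apply_apply] at this

/-- Equality of distributions amounts to an inclusion for `Φ` and one for its inverse. The
inclusions are what the derivation and descent arguments carry along. -/
theorem map_eq_iff_preserves :
    (∀ θ, (D θ).map (mfderiv 𝓘(ℝ, H) 𝓘(ℝ, H) Φ θ : H →L[ℝ] H).toLinearMap = D (Φ θ)) ↔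
      Preserves D Φ ∧ Preserves D Φ.symm := by
  constructor
  · intro h
    refine ⟨fun θ v hv => ?_, fun θ v hv => ?_⟩
    · rw [← h]
      exact Submodule.mem_map_of_mem hv
    · obtain ⟨θ, rfl⟩ := Φ.surjective θ
      change v ∈ D (Φ θ) at hv
      change (mfderiv 𝓘(ℝ, H) 𝓘(ℝ, H) Φ.symm (Φ θ) v : H) ∈ D (Φ.symm (Φ θ))
      rw [← h] at hv
      obtain ⟨u, hu, rfl⟩ := hv
      rw [Φ.symm_apply_apply]
      have := mfderiv_symm_mfderiv Φ θ u
      change (mfderiv 𝓘(ℝ, H) 𝓘(ℝ, H) Φ.symm (Φ θ) (mfderiv 𝓘(ℝ, H) 𝓘(ℝ, H) Φ θ u : H) : H) ∈ D θ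
      rwa [this]
  · rintro ⟨h1, h2⟩ θ
    refine le_antisymm ?_ fun v hv => ?_
    · rintro _ ⟨u, hu, rfl⟩
      exact h1 θ u hu
    · obtain ⟨u, hu, hv'⟩ := h2.exists_mfderiv_eq Φ θ hv
      exact ⟨u, hu, hv'⟩

end PreservedDistributions

/-! ### The Cartan distribution in charts. -/

section CartanCharts

variable {E : Type*} [NormedAddCommGroup E] [NormedSpace ℝ E]
  {M : Type*} [TopologicalSpace M] [ChartedSpace E M] [IsManifold 𝓘(ℝ, E) ∞ M]
  {F : Type*} [NormedAddCommGroup F] [NormedSpace ℝ F] [FiniteDimensional ℝ F]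
  {N : Type*} [TopologicalSpace N] [ChartedSpace F N] [IsManifold 𝓘(ℝ, F) ∞ N]
  {F₁ : Type*} [NormedAddCommGroup F₁] [NormedSpace ℝ F₁] [FiniteDimensional ℝ F₁]
  {N₁ : Type*} [TopologicalSpace N₁] [ChartedSpace F₁ N₁] [IsManifold 𝓘(ℝ, F₁) ∞ N₁]
  {F₂ : Type*} [NormedAddCommGroup F₂] [NormedSpace ℝ F₂] [FiniteDimensional ℝ F₂]
  {N₂ : Type*} [TopologicalSpace N₂] [ChartedSpace F₂ N₂] [IsManifold 𝓘(ℝ, F₂) ∞ N₂]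
  {k a₁ a₂ k₁ k₂ : ℕ}

/-- The differential of a jet prolongation in charts. -/
theorem chartDeriv_mfderiv_jetOf {a : M} {b : N} {s : M → N} {x : M}
    (hs : SmoothNear E F s x) (ha : x ∈ (chartAt E a).source) (hb : s x ∈ (chartAt F b).source)
    (ξ : TangentSpace 𝓘(ℝ, E) x) :
    chartDeriv (jetOPH E F k a b) (jetOf E F k s x)
      (mfderiv 𝓘(ℝ, E) 𝓘(ℝ, JetCoord E F k) (jetOf E F k s) x ξ) =
    (chartDeriv (chartAt E a) x ξ, fun i : Fin (k + 1) => contract E F i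
      (derivs (k + 1) (localRep E F a b s) (chartAt E a x) ⟨i + 1, by omega⟩)
        (chartDeriv (chartAt E a) x ξ)) := by
  have h1 := jetOPH_comp_jetOf (k := k) hs ha hb
  set T : E → JetCoord E F k := fun y => (y, derivs k (localRep E F a b s) y) with hT
  have h2 : jetOPH E F k a b ∘ jetOf E F k s =ᶠ[𝓝 x] T ∘ chartAt E a := by
    filter_upwards [h1] with z hz using hz.2
  have hTd : HasFDerivAt T ((ContinuousLinearMap.id ℝ E).prod (ContinuousLinearMap.pi
      fun i : Fin (k + 1) => contract E F i
      (derivs (k + 1) (localRep E F a b s) (chartAt E a x) ⟨i + 1, by omega⟩))) (chartAt E a x) :=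
    (hasFDerivAt_id _).prodMk (hasFDerivAt_pi.2 fun i =>
      hasFDerivAt_derivs (contDiffAt_localRep hs.self_of_nhds ha hb) i (k + 1) (by omega))
  have hc := contMDiffAt_of_mem_atlas (jetOPH_mem_atlas k a b) h1.self_of_nhds.1
  have h3 := mfderiv_comp x (mdiff hc) (mdiff (contMDiffAt_jetOf (k := k) hs))
  have h4 := mfderiv_comp x (hTd.hasMFDerivAt.mdifferentiableAt)
    (mdiff (contMDiffAt_of_mem_atlas (chart_mem_atlas E a) ha))
  rw [h2.mfderiv_eq, h4, hTd.hasMFDerivAt.mfderiv] at h3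
  exact (congrArg (fun L => L ξ) h3).symm

/-- The Cartan distribution in charts. -/
theorem mem_cartan_iff [FiniteDimensional ℝ E] [Nontrivial E] {a : M} {b : N} {θ : Jet E M F N k}
    (hθ : θ ∈ (jetOPH E F k a b).source) {v : TangentSpace 𝓘(ℝ, JetCoord E F k) θ} :
    v ∈ θ.cartan ↔
      chartDeriv (jetOPH E F k a b) θ v ∈ coordCartan le_rfl (jetOPH E F k a b θ) := by
  set c := jetOPH E F k a b with hc
  have hca : c ∈ atlas (JetCoord E F k) (Jet E M F N k) := jetOPH_mem_atlas k a b
  constructor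
  · intro hv
    have h1 : θ.cartan ≤ (coordCartan le_rfl (c θ)).comap (chartDeriv c θ).toLinearMap := by
      refine Submodule.span_le.2 ?_
      rintro _ ⟨s, hs, hsθ, ξ, rfl⟩
      have key : ∀ x (θ : Jet E M F N k) (ξ : TangentSpace 𝓘(ℝ, E) x), θ ∈ c.source →
          SmoothNear E F s x → jetOf E F k s x = θ →
          chartDeriv c θ (mfderiv 𝓘(ℝ, E) 𝓘(ℝ, JetCoord E F k) (jetOf E F k s) x ξ) ∈
            coordCartan le_rfl (c θ) := by
        rintro x _ ξ ⟨hθ1, hθ2⟩ hs rfl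
        have hb : s x ∈ (chartAt F b).source := by rwa [jetOf_value] at hθ2
        rw [chartDeriv_mfderiv_jetOf hs hθ1 hb ξ, jetOPH_jetOf hs hθ1 hb, mem_coordCartan]
        intro i hi
        rfl
      exact key _ _ ξ hθ hs hsθ
    exact h1 hv
  · intro hv
    have hF := FiniteDimensional.complete ℝ F
    set P := θ.cartan.map (chartDeriv c θ).toLinearMap with hP
    set w := c θ with hw
    have hwt : w ∈ c.target := c.map_source hθ
    -- Among maps with a given `k`-jet, the derivative `r` of order `k + 1` is arbitrary, as Taylor
    -- polynomials show. The tangent vector of the prolongation over `η` is then the lift of `η`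
    -- with top entry `r ⌟ η`.
    have lift : ∀ (η : E) (r : SymMul E F (k + 1)),
        cartanLift k w η (Pi.single (Fin.last k) (contract E F k r η)) ∈ P := by
      intro η r
      let p : ∀ i : Fin (k + 2), SymMul E F i := fun i => if h : (i : ℕ) < k + 1 then
        w.2 ⟨i, h⟩ else if h' : k + 1 = i then h' ▸ r else 0
      have hp1 : ∀ (i : ℕ) (h : i < k + 1), p ⟨i, by omega⟩ = w.2 ⟨i, h⟩ := fun i h => dif_pos h
      have hp2 : p ⟨k + 1, by omega⟩ = r := by simp [p]
      set T := taylorPoly w.1 p with hT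
      have hTs : ContDiff ℝ ∞ T := contDiff_taylorPoly _ _
      have hx := (chartAt E a).map_target hwt.1
      set x := (chartAt E a).symm w.1 with hxdef
      have hxw : chartAt E a x = w.1 := (chartAt E a).right_inv hwt.1
      have hTw : T w.1 ∈ (chartAt F b).target := by
        rw [hT, taylorPoly_self]
        exact hwt.2
      have hTx : T (chartAt E a x) ∈ (chartAt F b).target := by rwa [hxw]
      set s := (chartAt F b).symm ∘ T ∘ chartAt E a with hs
      have hss : SmoothNear E F s x := smoothNear_of_chart hTs hx hTx
      have hsb : s x ∈ (chartAt F b).source := (chartAt F b).map_target hTx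
      have hrep : localRep E F a b s =ᶠ[𝓝 w.1] T := localRep_of_chart hTs hwt.1 hTw
      have hd1 : derivs (k + 1) (localRep E F a b s) w.1 = p := by
        rw [derivs_congr hrep, hT, derivs_taylorPoly]
      have hd : derivs k (localRep E F a b s) w.1 = w.2 := by
        ext1 i
        have := congrFun hd1 ⟨i, by omega⟩
        rw [hp1 i i.2] at this
        exact this
      have hjs : jetOf E F k s x ∈ c.source := ⟨hx, by rwa [jetOf_value]⟩
      have hj : jetOf E F k s x = θ := by
        refine c.injOn hjs hθ ?_
        rw [hc, jetOPH_jetOf hss hx hsb, hxw, hd]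
      have key : ∀ θ' : Jet E M F N k, jetOf E F k s x = θ' →
          cartanLift k w η (Pi.single (Fin.last k) (contract E F k r η)) ∈
            θ'.cartan.map (chartDeriv c θ').toLinearMap := by
        rintro _ rfl
        obtain ⟨ξ, hξ⟩ := (chartDeriv_bijective (chart_mem_atlas E a) hx).2 η
        refine ⟨mfderiv 𝓘(ℝ, E) 𝓘(ℝ, JetCoord E F k) (jetOf E F k s) x ξ,
          Submodule.subset_span ⟨s, hss, rfl, ξ, rfl⟩, ?_⟩
        refine (chartDeriv_mfderiv_jetOf hss hx hsb ξ).trans ?_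
        rw [hξ, hxw, hd1]
        refine Prod.ext rfl (funext fun i => ?_)
        by_cases hi : (i : ℕ) < k
        · simp only [cartanLift]
          rw [dif_pos ⟨hi, hi⟩, hp1 (i + 1) (by omega)]
        · obtain rfl : i = Fin.last k := Fin.ext (by simp; omega)
          rw [cartanLift_of_le _ _ _ (by simp), Pi.single_eq_same]
          change contract E F k (p ⟨k + 1, _⟩) η = _
          rw [hp2]
      exact key θ hj
    have lin : ∀ η q q', cartanLift k w η (q + q') =
        cartanLift k w η q + ((0, Pi.single (Fin.last k) (q' (Fin.last k))) : JetCoord E F k) := by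
      intro η q q'
      refine Prod.ext (by simp [cartanLift]) (funext fun i => ?_)
      change _ = (cartanLift k w η q).2 i +
        Pi.single (M := fun i : Fin (k + 1) => SymMul E F i) (Fin.last k) (q' (Fin.last k)) i
      by_cases hi : (i : ℕ) < k
      · have hne : i ≠ Fin.last k := fun h => by simp [h] at hi
        rw [Pi.single_eq_of_ne hne, add_zero]
        simp only [cartanLift]
        rw [dif_pos ⟨hi, hi⟩, dif_pos ⟨hi, hi⟩]
      · obtain rfl : i = Fin.last k := Fin.ext (by simp; omega)
        rw [cartanLift_of_le _ _ _ (by simp), cartanLift_of_le _ _ _ (by simp), Pi.single_eq_same]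
        rfl
    have h0 : ∀ η, cartanLift k w η 0 ∈ P := by
      intro η
      have := lift η 0
      rwa [map_zero, zero_apply, Pi.single_zero] at this
    -- The lift for `r` minus the lift for `0` over the same `η` is the vertical vector `r ⌟ η` of
    -- order `k`; by `span_contract` these span all vertical vectors of top order.
    have htop : ∀ q : SymMul E F k, ((0, Pi.single (Fin.last k) q) : JetCoord E F k) ∈ P := by
      intro q
      have h1 : (⊤ : Submodule ℝ (SymMul E F k)) ≤ P.comap (LinearMap.inr ℝ E _ ∘ₗ
          LinearMap.single ℝ (fun i : Fin (k + 1) => SymMul E F i) (Fin.last k)) := by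
        rw [← span_contract (E := E) (F := F) k, Submodule.span_le]
        rintro _ ⟨r, η, rfl⟩
        change ((0, Pi.single (Fin.last k) (contract E F k r η)) : JetCoord E F k) ∈ P
        have h2 := lin η 0 (Pi.single (Fin.last k) (contract E F k r η))
        rw [zero_add, Pi.single_eq_same] at h2
        have h3 := Submodule.sub_mem _ (lift η r) (h0 η)
        rwa [h2, add_sub_cancel_left] at h3
      exact h1 (Submodule.mem_top (x := q))
    set u := chartDeriv c θ v with hu
    have hu2 : u = cartanLift k w u.1 0 + ((0, Pi.single (Fin.last k) (u.2 (Fin.last k))) :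
        JetCoord E F k) := by
      rw [← lin, zero_add]
      refine Prod.ext rfl (funext fun i => ?_)
      by_cases hi : (i : ℕ) < k
      · simp only [cartanLift]
        rw [dif_pos ⟨hi, hi⟩]
        exact (mem_coordCartan _).1 hv i hi
      · obtain rfl : i = Fin.last k := Fin.ext (by simp; omega)
        rw [cartanLift_of_le _ _ _ (by simp)]
    have huP : u ∈ P := by
      rw [hu2]
      exact Submodule.add_mem _ (h0 _) (htop _)
    obtain ⟨v', hv', hvv'⟩ := huP
    have : v' = v := (chartDeriv_bijective hca hθ).1 hvv'
    rwa [← this]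

/-- The Cartan distribution of order `(a₁, a₂)`, pulled back to the mixed jet space. -/
def MixedJet.cartanOf (h₁ : a₁ ≤ k₁) (h₂ : a₂ ≤ k₂) (θ : MixedJet E M F₁ N₁ F₂ N₂ k₁ k₂) :
    Submodule ℝ (MixedCoord E F₁ F₂ k₁ k₂) :=
  ((θ.fst.trunc h₁).cartan.comap
      (mfderiv 𝓘(ℝ, MixedCoord E F₁ F₂ k₁ k₂) 𝓘(ℝ, JetCoord E F₁ a₁)
        ((Jet.trunc h₁ : Jet E M F₁ N₁ k₁ → _) ∘
          (MixedJet.fst : MixedJet E M F₁ N₁ F₂ N₂ k₁ k₂ → _)) θ).toLinearMap) ⊓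
    ((θ.snd.trunc h₂).cartan.comap
      (mfderiv 𝓘(ℝ, MixedCoord E F₁ F₂ k₁ k₂) 𝓘(ℝ, JetCoord E F₂ a₂)
        ((Jet.trunc h₂ : Jet E M F₂ N₂ k₂ → _) ∘
          (MixedJet.snd : MixedJet E M F₁ N₁ F₂ N₂ k₁ k₂ → _)) θ).toLinearMap)

/-- This passes from the distribution defined through spans of graphs to explicit equations in
coordinates, to which the invariants apply. -/
theorem mem_cartanOf_iff [FiniteDimensional ℝ E] [Nontrivial E] (h₁ : a₁ ≤ k₁) (h₂ : a₂ ≤ k₂)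
    {a : M} {b₁ : N₁} {b₂ : N₂} {θ : MixedJet E M F₁ N₁ F₂ N₂ k₁ k₂}
    (hθ : θ ∈ (mixedOPH E F₁ F₂ k₁ k₂ a b₁ b₂).source)
    {v : TangentSpace 𝓘(ℝ, MixedCoord E F₁ F₂ k₁ k₂) θ} :
    v ∈ θ.cartanOf h₁ h₂ ↔ chartDeriv (mixedOPH E F₁ F₂ k₁ k₂ a b₁ b₂) θ v ∈
      mixedCoordCartan h₁ h₂ (mixedOPH E F₁ F₂ k₁ k₂ a b₁ b₂ θ) := by
  have l1 := (linearInCharts_trunc (E := E) (F := F₁) (N := N₁) h₁ a b₁).comp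
    (linearInCharts_fst
    (E := E) (M := M) (F₁ := F₁) (N₁ := N₁) (F₂ := F₂) (N₂ := N₂) (k₁ := k₁) (k₂ := k₂) a b₁ b₂)
  have l2 := (linearInCharts_trunc (E := E) (F := F₂) (N := N₂) h₂ a b₂).comp
    (linearInCharts_snd
    (E := E) (M := M) (F₁ := F₁) (N₁ := N₁) (F₂ := F₂) (N₂ := N₂) (k₁ := k₁) (k₂ := k₂) a b₁ b₂)
  have m1 := mem_cartan_iff (l1 θ hθ).1 (v := mfderiv 𝓘(ℝ, MixedCoord E F₁ F₂ k₁ k₂)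
    𝓘(ℝ, JetCoord E F₁ a₁) (Jet.trunc h₁ ∘ MixedJet.fst) θ v)
  have m2 := mem_cartan_iff (l2 θ hθ).1 (v := mfderiv 𝓘(ℝ, MixedCoord E F₁ F₂ k₁ k₂)
    𝓘(ℝ, JetCoord E F₂ a₂) (Jet.trunc h₂ ∘ MixedJet.snd) θ v)
  rw [l1.chartDeriv_mfderiv (mixedOPH_mem_atlas _ _ _ _ _) (jetOPH_mem_atlas _ _ _) hθ,
    (l1 θ hθ).2, ContinuousLinearMap.comp_apply, ContinuousLinearMap.comp_apply,
    mem_coordCartan_trunc] at m1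
  rw [l2.chartDeriv_mfderiv (mixedOPH_mem_atlas _ _ _ _ _) (jetOPH_mem_atlas _ _ _) hθ,
    (l2 θ hθ).2, ContinuousLinearMap.comp_apply, ContinuousLinearMap.comp_apply,
    mem_coordCartan_trunc] at m2
  rw [mem_mixedCoordCartan]
  exact and_congr m1 m2

theorem mem_mixedCartan_iff [FiniteDimensional ℝ E] [Nontrivial E]
    {a : M} {b₁ : N₁} {b₂ : N₂} {θ : MixedJet E M F₁ N₁ F₂ N₂ k₁ k₂}
    (hθ : θ ∈ (mixedOPH E F₁ F₂ k₁ k₂ a b₁ b₂).source)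
    {v : TangentSpace 𝓘(ℝ, MixedCoord E F₁ F₂ k₁ k₂) θ} :
    v ∈ θ.cartan ↔ chartDeriv (mixedOPH E F₁ F₂ k₁ k₂ a b₁ b₂) θ v ∈
      mixedCoordCartan le_rfl le_rfl (mixedOPH E F₁ F₂ k₁ k₂ a b₁ b₂ θ) := by
  have l1 := linearInCharts_fst
    (E := E) (M := M) (F₁ := F₁) (N₁ := N₁) (F₂ := F₂) (N₂ := N₂) (k₁ := k₁) (k₂ := k₂) a b₁ b₂
  have l2 := linearInCharts_snd
    (E := E) (M := M) (F₁ := F₁) (N₁ := N₁) (F₂ := F₂) (N₂ := N₂) (k₁ := k₁) (k₂ := k₂) a b₁ b₂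
  have m1 := mem_cartan_iff (l1 θ hθ).1 (v := mfderiv 𝓘(ℝ, MixedCoord E F₁ F₂ k₁ k₂)
    𝓘(ℝ, JetCoord E F₁ k₁) MixedJet.fst θ v)
  have m2 := mem_cartan_iff (l2 θ hθ).1 (v := mfderiv 𝓘(ℝ, MixedCoord E F₁ F₂ k₁ k₂)
    𝓘(ℝ, JetCoord E F₂ k₂) MixedJet.snd θ v)
  rw [l1.chartDeriv_mfderiv (mixedOPH_mem_atlas _ _ _ _ _) (jetOPH_mem_atlas _ _ _) hθ,
    (l1 θ hθ).2] at m1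
  rw [l2.chartDeriv_mfderiv (mixedOPH_mem_atlas _ _ _ _ _) (jetOPH_mem_atlas _ _ _) hθ,
    (l2 θ hθ).2] at m2
  rw [mem_mixedCoordCartan]
  exact and_congr m1 m2

theorem cartanOf_self [FiniteDimensional ℝ E] [Nontrivial E] (h₁ : k₁ ≤ k₁) (h₂ : k₂ ≤ k₂)
    (θ : MixedJet E M F₁ N₁ F₂ N₂ k₁ k₂) : θ.cartanOf h₁ h₂ = θ.cartan := by
  ext v
  exact (mem_cartanOf_iff h₁ h₂ (mem_mixedOPH_self θ)).trans
    (mem_mixedCartan_iff (mem_mixedOPH_self θ)).symm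

end CartanCharts

/-! ### Passing preserved structures to the base of a projection. -/

section Descent

variable {H : Type*} [NormedAddCommGroup H] [NormedSpace ℝ H] {A : Type*} [TopologicalSpace A]
  [ChartedSpace H A]
  {H' : Type*} [NormedAddCommGroup H'] [NormedSpace ℝ H'] {B : Type*} [TopologicalSpace B]
  [ChartedSpace H' B]

variable (H H') in
/-- The differential of `Φ` maps vertical vectors of `π` to vertical vectors. -/
def PreservesVertical (π : A → B) (Φ : A → A) : Prop :=
  ∀ θ (v : H), (mfderiv 𝓘(ℝ, H) 𝓘(ℝ, H') π θ v : H') = 0 →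
    (mfderiv 𝓘(ℝ, H) 𝓘(ℝ, H') π (Φ θ) (mfderiv 𝓘(ℝ, H) 𝓘(ℝ, H) Φ θ v : H) : H') = 0

theorem PreservesVertical.mfderiv_comp_eq_zero {π : A → B}
    (hπ : ContMDiff 𝓘(ℝ, H) 𝓘(ℝ, H') ∞ π) {Φ : A → A} (hΦ : ContMDiff 𝓘(ℝ, H) 𝓘(ℝ, H) ∞ Φ)
    (h : PreservesVertical H H' π Φ) (θ : A) (v : TangentSpace 𝓘(ℝ, H) θ)
    (hv : mfderiv 𝓘(ℝ, H) 𝓘(ℝ, H') π θ v = 0) :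
    mfderiv 𝓘(ℝ, H) 𝓘(ℝ, H') (π ∘ Φ) θ v = 0 := by
  rw [mfderiv_comp θ (mdiff hπ.contMDiffAt) (mdiff hΦ.contMDiffAt)]
  exact h θ v hv

theorem mfderiv_semiconj {π : A → B} (hπ : ContMDiff 𝓘(ℝ, H) 𝓘(ℝ, H') ∞ π) {Φ : A → A}
    (hΦ : ContMDiff 𝓘(ℝ, H) 𝓘(ℝ, H) ∞ Φ) {Φ₀ : B → B} (hΦ₀ : ContMDiff 𝓘(ℝ, H') 𝓘(ℝ, H') ∞ Φ₀)
    (h : ∀ θ, Φ₀ (π θ) = π (Φ θ)) (θ : A) (v : H) :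
    (mfderiv 𝓘(ℝ, H') 𝓘(ℝ, H') Φ₀ (π θ) (mfderiv 𝓘(ℝ, H) 𝓘(ℝ, H') π θ v : H') : H') =
      mfderiv 𝓘(ℝ, H) 𝓘(ℝ, H') π (Φ θ) (mfderiv 𝓘(ℝ, H) 𝓘(ℝ, H) Φ θ v : H) := by
  have h1 := mfderiv_comp θ (mdiff (hΦ₀.contMDiffAt (x := π θ))) (mdiff (hπ.contMDiffAt (x := θ)))
  have h2 := mfderiv_comp θ (mdiff (hπ.contMDiffAt (x := Φ θ))) (mdiff (hΦ.contMDiffAt (x := θ)))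
  rw [show Φ₀ ∘ π = π ∘ Φ from funext h, h2] at h1
  exact (congrArg (fun L : H →L[ℝ] H' => L v) h1).symm

/-- If `Φ` preserves the pull-back of a distribution and descends to `Φ₀`, then `Φ₀` preserves the
distribution. -/
theorem Preserves.descend {π : A → B} (hπ : ContMDiff 𝓘(ℝ, H) 𝓘(ℝ, H') ∞ π) (hs : Surjective π)
    (hds : ∀ θ (u : H'), ∃ v : H, (mfderiv 𝓘(ℝ, H) 𝓘(ℝ, H') π θ v : H') = u)
    {D : A → Submodule ℝ H} {D' : B → Submodule ℝ H'}
    (hD : ∀ θ (v : H), v ∈ D θ ↔ (mfderiv 𝓘(ℝ, H) 𝓘(ℝ, H') π θ v : H') ∈ D' (π θ)) {Φ : A → A}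
    (hΦ : ContMDiff 𝓘(ℝ, H) 𝓘(ℝ, H) ∞ Φ) {Φ₀ : B → B} (hΦ₀ : ContMDiff 𝓘(ℝ, H') 𝓘(ℝ, H') ∞ Φ₀)
    (h : ∀ θ, Φ₀ (π θ) = π (Φ θ)) (hP : Preserves D Φ) : Preserves D' Φ₀ := by
  intro b u hu
  obtain ⟨θ, rfl⟩ := hs b
  obtain ⟨v, rfl⟩ := hds θ u
  rw [mfderiv_semiconj hπ hΦ hΦ₀ h, h]
  exact (hD _ _).1 (hP θ v ((hD _ _).2 hu))

end Descent

/-! ### The invariants of mixed Lie transformations on the manifold. -/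

section MixedPreservation

variable {E : Type*} [NormedAddCommGroup E] [NormedSpace ℝ E]
  {M : Type*} [TopologicalSpace M] [ChartedSpace E M] [IsManifold 𝓘(ℝ, E) ∞ M]
  {F₁ : Type*} [NormedAddCommGroup F₁] [NormedSpace ℝ F₁] [FiniteDimensional ℝ F₁]
  {N₁ : Type*} [TopologicalSpace N₁] [ChartedSpace F₁ N₁] [IsManifold 𝓘(ℝ, F₁) ∞ N₁]
  {F₂ : Type*} [NormedAddCommGroup F₂] [NormedSpace ℝ F₂] [FiniteDimensional ℝ F₂]
  {N₂ : Type*} [TopologicalSpace N₂] [ChartedSpace F₂ N₂] [IsManifold 𝓘(ℝ, F₂) ∞ N₂]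
  {j a₁ a₂ k₁ k₂ : ℕ}

/-- The projection of a mixed jet to the jet of order `j` of its second component. -/
def MixedJet.sndTrunc (h : j ≤ k₂) (θ : MixedJet E M F₁ N₁ F₂ N₂ k₁ k₂) : Jet E M F₂ N₂ j :=
  θ.snd.trunc h

theorem linearInCharts_sndTrunc (h : j ≤ k₂) (a : M) (b₁ : N₁) (b₂ : N₂) :
    LinearInCharts (MixedJet.sndTrunc h : MixedJet E M F₁ N₁ F₂ N₂ k₁ k₂ → Jet E M F₂ N₂ j)
      (mixedOPH E F₁ F₂ k₁ k₂ a b₁ b₂) (jetOPH E F₂ j a b₂)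
      (truncCoord E F₂ h ∘L sndCoord E F₁ F₂ k₁ k₂) :=
  (linearInCharts_trunc (E := E) (F := F₂) (N := N₂) h a b₂).comp (linearInCharts_snd
    (E := E) (M := M) (F₁ := F₁) (N₁ := N₁) (F₂ := F₂) (N₂ := N₂) (k₁ := k₁) (k₂ := k₂) a b₁ b₂)

theorem contMDiff_sndTrunc (h : j ≤ k₂) :
    ContMDiff 𝓘(ℝ, MixedCoord E F₁ F₂ k₁ k₂) 𝓘(ℝ, JetCoord E F₂ j) ∞
      (MixedJet.sndTrunc h : MixedJet E M F₁ N₁ F₂ N₂ k₁ k₂ → Jet E M F₂ N₂ j) := fun θ =>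
  (linearInCharts_sndTrunc h θ.base θ.fst.value θ.snd.value).contMDiffAt
    (mixedOPH_mem_atlas _ _ _ _ _) (jetOPH_mem_atlas _ _ _) (mem_mixedOPH_self θ)

theorem mfderiv_sndTrunc_eq_zero_iff (h : j ≤ k₂) {a : M} {b₁ : N₁} {b₂ : N₂}
    {θ : MixedJet E M F₁ N₁ F₂ N₂ k₁ k₂} (hθ : θ ∈ (mixedOPH E F₁ F₂ k₁ k₂ a b₁ b₂).source)
    (v : TangentSpace 𝓘(ℝ, MixedCoord E F₁ F₂ k₁ k₂) θ) :
    mfderiv 𝓘(ℝ, MixedCoord E F₁ F₂ k₁ k₂) 𝓘(ℝ, JetCoord E F₂ j) (MixedJet.sndTrunc h) θ v = 0 ↔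
      chartDeriv (mixedOPH E F₁ F₂ k₁ k₂ a b₁ b₂) θ v ∈ sndVertical k₁ k₂ j := by
  rw [(linearInCharts_sndTrunc h a b₁ b₂).mfderiv_eq_zero_iff (mixedOPH_mem_atlas _ _ _ _ _)
    (jetOPH_mem_atlas _ _ _) hθ, mem_sndVertical, Prod.ext_iff]
  refine and_congr Iff.rfl (funext_iff.trans ?_)
  constructor
  · intro h1 i hi
    exact h1 ⟨i, by omega⟩
  · intro h1 i
    exact h1 ⟨i, by omega⟩ (by simp; omega)

theorem contDiffAt_mixedChart (Φ : MixedJetDiffeo E M F₁ N₁ F₂ N₂ k₁ k₂) {a a' : M} {b₁ b₁' : N₁}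
    {b₂ b₂' : N₂} {θ : MixedJet E M F₁ N₁ F₂ N₂ k₁ k₂}
    (hθ : θ ∈ (mixedOPH E F₁ F₂ k₁ k₂ a b₁ b₂).source)
    (hθ' : Φ θ ∈ (mixedOPH E F₁ F₂ k₁ k₂ a' b₁' b₂').source) :
    ContDiffAt ℝ 2 (mixedOPH E F₁ F₂ k₁ k₂ a' b₁' b₂' ∘ Φ ∘ (mixedOPH E F₁ F₂ k₁ k₂ a b₁ b₂).symm)
      (mixedOPH E F₁ F₂ k₁ k₂ a b₁ b₂ θ) := by
  set c := mixedOPH E F₁ F₂ k₁ k₂ a b₁ b₂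
  set c' := mixedOPH E F₁ F₂ k₁ k₂ a' b₁' b₂'
  have h1 : ContMDiffAt 𝓘(ℝ, MixedCoord E F₁ F₂ k₁ k₂) 𝓘(ℝ, MixedCoord E F₁ F₂ k₁ k₂) ∞
      (c' ∘ Φ ∘ c.symm) (c θ) := by
    refine ContMDiffAt.comp _ ?_ (ContMDiffAt.comp _ Φ.contMDiff.contMDiffAt
      (contMDiffAt_symm_of_mem_atlas (mixedOPH_mem_atlas _ _ _ _ _) (c.map_source hθ)))
    rw [Function.comp_apply, c.left_inv hθ]
    exact contMDiffAt_of_mem_atlas (mixedOPH_mem_atlas _ _ _ _ _) hθ'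
  exact h1.contDiffAt.of_le (by norm_cast)

variable [FiniteDimensional ℝ E] [Nontrivial E]

/-- The invariants are computed for the expression of `Φ` in a chart near `θ` and a chart near `Φ
θ`; this supplies their hypothesis. -/
theorem Preserves.preservesNear (Φ : MixedJetDiffeo E M F₁ N₁ F₂ N₂ k₁ k₂) {h₁ : a₁ ≤ k₁}
    {h₂ : a₂ ≤ k₂} (hΦ : Preserves (MixedJet.cartanOf h₁ h₂) Φ) {a a' : M} {b₁ b₁' : N₁}
    {b₂ b₂' : N₂} {θ : MixedJet E M F₁ N₁ F₂ N₂ k₁ k₂}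
    (hθ : θ ∈ (mixedOPH E F₁ F₂ k₁ k₂ a b₁ b₂).source)
    (hθ' : Φ θ ∈ (mixedOPH E F₁ F₂ k₁ k₂ a' b₁' b₂').source) :
    PreservesNear h₁ h₂
      (mixedOPH E F₁ F₂ k₁ k₂ a' b₁' b₂' ∘ Φ ∘ (mixedOPH E F₁ F₂ k₁ k₂ a b₁ b₂).symm)
      (mixedOPH E F₁ F₂ k₁ k₂ a b₁ b₂ θ) := by
  have hca := mixedOPH_mem_atlas (E := E) (F₁ := F₁) (F₂ := F₂) k₁ k₂ a b₁ b₂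
  have hca' := mixedOPH_mem_atlas (E := E) (F₁ := F₁) (F₂ := F₂) k₁ k₂ a' b₁' b₂'
  set c := mixedOPH E F₁ F₂ k₁ k₂ a b₁ b₂ with hc
  set c' := mixedOPH E F₁ F₂ k₁ k₂ a' b₁' b₂' with hc'
  have h1 : ∀ᶠ w in 𝓝 (c θ), w ∈ c.target ∧ Φ (c.symm w) ∈ c'.source := by
    refine Filter.Eventually.and (c.open_target.mem_nhds (c.map_source hθ)) ?_
    have : ContinuousAt (Φ ∘ c.symm) (c θ) := Φ.contMDiff.continuous.continuousAt.comp
      (c.continuousAt_symm (c.map_source hθ))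
    refine this.eventually (c'.open_source.mem_nhds ?_)
    rwa [Function.comp_apply, c.left_inv hθ]
  filter_upwards [h1] with w ⟨hw1, hw2⟩ u hu
  have hs := c.map_target hw1
  obtain ⟨v, rfl⟩ := (chartDeriv_bijective hca hs).2 u
  rw [← c.right_inv hw1] at hu ⊢
  rw [c.left_inv hs] at hu ⊢
  have h2 := fderiv_chart hca hca' Φ.contMDiff.contMDiffAt hs hw2 v
  have h3 := (mem_cartanOf_iff h₁ h₂ hw2).1 (hΦ _ v ((mem_cartanOf_iff h₁ h₂ hs).2 hu))
  rw [Function.comp_apply, Function.comp_apply, c.left_inv hs, h2]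
  exact h3

/-- One passage to the derived distribution lowers both orders; an order that has reached `0` stays
there. -/
theorem Preserves.cartanOf_sub_one (Φ : MixedJetDiffeo E M F₁ N₁ F₂ N₂ k₁ k₂) {h₁ : a₁ ≤ k₁}
    {h₂ : a₂ ≤ k₂} (hΦ : Preserves (MixedJet.cartanOf h₁ h₂) Φ) :
    Preserves (MixedJet.cartanOf ((Nat.sub_le a₁ 1).trans h₁) ((Nat.sub_le a₂ 1).trans h₂)) Φ := by
  have := FiniteDimensional.complete ℝ F₁
  have := FiniteDimensional.complete ℝ F₂
  intro θ v hv
  have hθ := mem_mixedOPH_self θ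
  have hθ' := mem_mixedOPH_self (Φ θ)
  refine (mem_cartanOf_iff _ _ hθ').2 ?_
  have h1 := (mem_cartanOf_iff _ _ hθ).1 hv
  have h2 := (hΦ.preservesNear Φ hθ hθ').lower (contDiffAt_mixedChart Φ hθ hθ') h1
  rw [Function.comp_apply, Function.comp_apply, OpenPartialHomeomorph.left_inv _ hθ] at h2
  exact mem_of_eq_of_mem (fderiv_chart (mixedOPH_mem_atlas _ _ _ _ _)
    (mixedOPH_mem_atlas _ _ _ _ _) Φ.contMDiff.contMDiffAt hθ hθ' v).symm h2

theorem Preserves.cartanOf_sub (Φ : MixedJetDiffeo E M F₁ N₁ F₂ N₂ k₁ k₂)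
    (hΦ : Preserves MixedJet.cartan Φ) (i : ℕ) :
    Preserves (MixedJet.cartanOf (Nat.sub_le k₁ i) (Nat.sub_le k₂ i)) Φ := by
  induction i with
  | zero =>
    intro θ v hv
    exact (cartanOf_self _ _ (Φ θ)).ge (hΦ θ v ((cartanOf_self _ _ θ).le hv))
  | succ i ih => exact ih.cartanOf_sub_one Φ

/-- Lie transformations preserve the Cartan distributions of lower order. -/
theorem Preserves.cartanOf (Φ : MixedJetDiffeo E M F₁ N₁ F₂ N₂ k₁ k₂)
    (hΦ : Preserves MixedJet.cartan Φ) (i : ℕ) {h₁ : a₁ ≤ k₁} {h₂ : a₂ ≤ k₂} (e₁ : a₁ = k₁ - i)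
    (e₂ : a₂ = k₂ - i) : Preserves (MixedJet.cartanOf h₁ h₂) Φ := by
  subst e₁ e₂
  exact hΦ.cartanOf_sub Φ i

/-- The inverse of `Φ` preserves the distribution too, so the differential is onto between the
distributions at `θ` and `Φ θ`. The characteristic and rank-one arguments need this to test against
all vectors at the image point. -/
theorem fderiv_mixedChart_surjective (Φ : MixedJetDiffeo E M F₁ N₁ F₂ N₂ k₁ k₂) {h₁ : a₁ ≤ k₁}
    {h₂ : a₂ ≤ k₂} (hΦ : Preserves (MixedJet.cartanOf h₁ h₂) Φ.symm) {a a' : M} {b₁ b₁' : N₁}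
    {b₂ b₂' : N₂} {θ : MixedJet E M F₁ N₁ F₂ N₂ k₁ k₂}
    (hθ : θ ∈ (mixedOPH E F₁ F₂ k₁ k₂ a b₁ b₂).source)
    (hθ' : Φ θ ∈ (mixedOPH E F₁ F₂ k₁ k₂ a' b₁' b₂').source) :
    ∀ u' ∈ mixedCoordCartan h₁ h₂ ((mixedOPH E F₁ F₂ k₁ k₂ a' b₁' b₂' ∘ Φ ∘
      (mixedOPH E F₁ F₂ k₁ k₂ a b₁ b₂).symm) (mixedOPH E F₁ F₂ k₁ k₂ a b₁ b₂ θ)),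
    ∃ u ∈ mixedCoordCartan h₁ h₂ (mixedOPH E F₁ F₂ k₁ k₂ a b₁ b₂ θ),
      fderiv ℝ (mixedOPH E F₁ F₂ k₁ k₂ a' b₁' b₂' ∘ Φ ∘ (mixedOPH E F₁ F₂ k₁ k₂ a b₁ b₂).symm)
        (mixedOPH E F₁ F₂ k₁ k₂ a b₁ b₂ θ) u = u' := by
  intro u' hu'
  rw [Function.comp_apply, Function.comp_apply, OpenPartialHomeomorph.left_inv _ hθ] at hu'
  obtain ⟨v', rfl⟩ := (chartDeriv_bijective (mixedOPH_mem_atlas _ _ _ _ _) hθ').2 u'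
  obtain ⟨v, hv, hvv'⟩ := hΦ.exists_mfderiv_eq Φ θ ((mem_cartanOf_iff h₁ h₂ hθ').2 hu')
  refine ⟨_, (mem_cartanOf_iff h₁ h₂ hθ).1 hv, ?_⟩
  exact (fderiv_chart (mixedOPH_mem_atlas _ _ _ _ _) (mixedOPH_mem_atlas _ _ _ _ _)
    Φ.contMDiff.contMDiffAt hθ hθ' v).trans (congrArg _ hvv')

/-- The vertical vectors of the projection to the jets of order `a₂` of the second component are
preserved. -/
theorem Preserves.preservesVertical_sndTrunc [Nontrivial F₂] (ha : 0 < a₂)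
    (Φ : MixedJetDiffeo E M F₁ N₁ F₂ N₂ k₁ k₂) {h₁ : 0 ≤ k₁} {h₂ : a₂ ≤ k₂}
    (hΦ : Preserves (MixedJet.cartanOf h₁ h₂) Φ)
    (hΦ' : Preserves (MixedJet.cartanOf h₁ h₂) Φ.symm) :
    PreservesVertical (MixedCoord E F₁ F₂ k₁ k₂) (JetCoord E F₂ a₂) (MixedJet.sndTrunc h₂) Φ := by
  intro θ v hv
  have hθ := mem_mixedOPH_self θ
  have hθ' := mem_mixedOPH_self (Φ θ)
  refine (mfderiv_sndTrunc_eq_zero_iff h₂ hθ' _).2 ?_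
  have h1 := (mfderiv_sndTrunc_eq_zero_iff h₂ hθ _).1 hv
  have h2 := (hΦ.preservesNear Φ hθ hθ').sndVertical ha (contDiffAt_mixedChart Φ hθ hθ')
    (fderiv_mixedChart_surjective Φ hΦ' hθ hθ') h1
  exact mem_of_eq_of_mem (fderiv_chart (mixedOPH_mem_atlas _ _ _ _ _)
    (mixedOPH_mem_atlas _ _ _ _ _) Φ.contMDiff.contMDiffAt hθ hθ' v).symm h2

/-- The dimension condition cannot be dropped: with a one-dimensional target every vector has rank
at most one, and contact transformations may mix base, value and first derivatives. -/
theorem Preserves.preservesVertical_sndTrunc_zero (hF : 1 < Module.finrank ℝ F₂)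
    (Φ : MixedJetDiffeo E M F₁ N₁ F₂ N₂ k₁ k₂) {h₁ : 0 ≤ k₁} {h₂ : 1 ≤ k₂} {h₀ : 0 ≤ k₂}
    (hΦ : Preserves (MixedJet.cartanOf h₁ h₂) Φ)
    (hΦ' : Preserves (MixedJet.cartanOf h₁ h₂) Φ.symm) :
    PreservesVertical (MixedCoord E F₁ F₂ k₁ k₂) (JetCoord E F₂ 0) (MixedJet.sndTrunc h₀) Φ := by
  intro θ v hv
  have hθ := mem_mixedOPH_self θ
  have hθ' := mem_mixedOPH_self (Φ θ)
  refine (mfderiv_sndTrunc_eq_zero_iff h₀ hθ' _).2 ?_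
  have h1 := (mfderiv_sndTrunc_eq_zero_iff h₀ hθ _).1 hv
  have h2 := (hΦ.preservesNear Φ hθ hθ').sndVertical_zero hF (contDiffAt_mixedChart Φ hθ hθ')
    (fderiv_mixedChart_surjective Φ hΦ' hθ hθ') h1
  exact mem_of_eq_of_mem (fderiv_chart (mixedOPH_mem_atlas _ _ _ _ _)
    (mixedOPH_mem_atlas _ _ _ _ _) Φ.contMDiff.contMDiffAt hθ hθ' v).symm h2

end MixedPreservation

/-! ### Integral manifolds transversal to the base, in coordinates. -/

section IntegralManifolds

variable {E : Type*} [NormedAddCommGroup E] [NormedSpace ℝ E] [FiniteDimensional ℝ E]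
  {F : Type*} [NormedAddCommGroup F] [NormedSpace ℝ F] {k : ℕ}

/-- A family of jets depending on its base point which is tangent to the Cartan distribution
consists of the jets of a single map. -/
theorem eventually_eq_derivs {p : E → ∀ i : Fin (k + 1), SymMul E F i} {u₀ : E}
    (hp : ∀ᶠ u in 𝓝 u₀, DifferentiableAt ℝ p u)
    (hC : ∀ᶠ u in 𝓝 u₀, ∀ η (i : ℕ) (hi : i < k), fderiv ℝ p u η ⟨i, by omega⟩ =
      contract E F i (p u ⟨i + 1, by omega⟩) η)
    (hs : ∀ᶠ u in 𝓝 u₀, ContDiffAt ℝ ∞ (fun u => (p u 0).1 0) u) :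
    ∀ᶠ u in 𝓝 u₀, p u = derivs k (fun u => (p u 0).1 0) u := by
  set f : E → F := fun u => (p u 0).1 0 with hf
  have key : ∀ (i : ℕ) (hi : i < k + 1), ∀ᶠ u in 𝓝 u₀, p u ⟨i, hi⟩ = derivs k f u ⟨i, hi⟩ := by
    intro i
    induction i with
    | zero =>
      intro hi
      refine Eventually.of_forall fun u => symMul_ext fun v => ?_
      have h0 := derivs_zero k f u
      rw [Subsingleton.elim v 0]
      exact h0.symm
    | succ i ih =>
      intro hi
      filter_upwards [(ih (by omega)).eventually_nhds, hp, hC, hs] with u h1 h2 h3 h4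
      -- By tangency, the entry of order `i + 1` contracted with `ξ` is the derivative of the entry
      -- of order `i`. The induction hypothesis holds on a neighbourhood, so this is also the
      -- derivative of the `i`-th derivative of `f`.
      refine sub_eq_zero.1 (eq_zero_of_contract_eq_zero fun ξ => ?_)
      rw [map_sub, sub_apply, sub_eq_zero, ← h3 ξ i (by omega)]
      have h5 := hasFDerivAt_derivs (k := k) h4 ⟨i, by omega⟩ k (by simp; omega)
      have h6 : (fun u => p u ⟨i, by omega⟩) =ᶠ[𝓝 u] fun u => derivs k f u ⟨i, by omega⟩ := h1
      have h7 := ((hasFDerivAt_pi'.1 h2.hasFDerivAt) ⟨i, by omega⟩).unique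
        (h5.congr_of_eventuallyEq h6)
      exact congrArg (fun L => L ξ) h7
  filter_upwards [eventually_all.2 fun i : Fin (k + 1) => key i i.2] with u hu
  exact funext hu

/-- A submanifold tangent to the Cartan distribution and transversal to the fibres over `E` is
the graph of a jet prolongation. -/
theorem exists_eq_derivs {Γ : E → JetCoord E F k} {y₀ : E}
    (hΓ : ∀ᶠ y in 𝓝 y₀, ContDiffAt ℝ ∞ Γ y)
    (hC : ∀ᶠ y in 𝓝 y₀, ∀ η, fderiv ℝ Γ y η ∈ coordCartan le_rfl (Γ y))
    (hinj : ∀ η, (fderiv ℝ Γ y₀ η).1 = 0 → η = 0) :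
    ∃ f : E → F, (∀ᶠ u in 𝓝 (Γ y₀).1, ContDiffAt ℝ ∞ f u) ∧
      ∀ᶠ y in 𝓝 y₀, (Γ y).2 = derivs k f (Γ y).1 := by
  have hE := FiniteDimensional.complete ℝ E
  -- Transversality makes the base component `h` a local diffeomorphism, so the submanifold can be
  -- reparametrised by its base point as `Γ ∘ h⁻¹`.
  set h : E → E := fun y => (Γ y).1 with hh
  have hd : ∀ y, ContDiffAt ℝ ∞ Γ y →
      HasFDerivAt h ((ContinuousLinearMap.fst ℝ E _) ∘L fderiv ℝ Γ y) y := fun y hy =>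
    HasFDerivAt.comp (g := ContinuousLinearMap.fst ℝ E (∀ i : Fin (k + 1), SymMul E F i)) y
      (ContinuousLinearMap.hasFDerivAt _) (hy.differentiableAt (by simp)).hasFDerivAt
  have hsm : ∀ y, ContDiffAt ℝ ∞ Γ y → ContDiffAt ℝ ∞ h y := fun y hy => contDiffAt_fst.comp y hy
  have hΓ₀ := hΓ.self_of_nhds
  set L₀ : E →L[ℝ] E := (ContinuousLinearMap.fst ℝ E _) ∘L fderiv ℝ Γ y₀ with hL₀
  have hker : LinearMap.ker L₀.toLinearMap = ⊥ := by
    refine LinearMap.ker_eq_bot'.2 fun η hη => hinj η hη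
  let e₀ : E ≃L[ℝ] E := (LinearEquiv.ofInjectiveEndo L₀.toLinearMap
    (LinearMap.ker_eq_bot.1 hker)).toContinuousLinearEquiv
  have he₀ : (e₀ : E →L[ℝ] E) = L₀ := by ext η; rfl
  have hd₀ : HasFDerivAt h (e₀ : E →L[ℝ] E) y₀ := by rw [he₀]; exact hd y₀ hΓ₀
  set φ := (hsm y₀ hΓ₀).toOpenPartialHomeomorph h hd₀ (by simp) with hφ
  have hφc : ∀ y, φ y = h y := fun y => rfl
  have hy₀ : y₀ ∈ φ.source := (hsm y₀ hΓ₀).mem_toOpenPartialHomeomorph_source hd₀ (by simp)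
  -- Transversality is assumed at `y₀` only. It spreads to nearby points because the invertible
  -- operators form an open set, and the inverse of `h` is thus smooth on a neighbourhood.
  have hinv : ∀ᶠ y in 𝓝 y₀, ∃ e : E ≃L[ℝ] E, (e : E →L[ℝ] E) =
      (ContinuousLinearMap.fst ℝ E _) ∘L fderiv ℝ Γ y := by
    have hcont : ContinuousAt (fun y => (ContinuousLinearMap.fst ℝ E
        (∀ i : Fin (k + 1), SymMul E F i)) ∘L fderiv ℝ Γ y) y₀ := by
      have h1 : ContinuousAt (fderiv ℝ Γ) y₀ :=
        (hΓ₀.fderiv_right (m := 0) (by simp)).continuousAt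
      exact (ContinuousLinearMap.compL ℝ E (JetCoord E F k) E
        (ContinuousLinearMap.fst ℝ E _)).continuous.continuousAt.comp h1
    refine hcont.eventually (?_ : ∀ᶠ L in 𝓝 L₀, ∃ e : E ≃L[ℝ] E, (e : E →L[ℝ] E) = L)
    rw [← he₀]
    exact ContinuousLinearEquiv.nhds e₀
  have hpush : ∀ {P : E → Prop}, (∀ᶠ y in 𝓝 y₀, P y) → ∀ᶠ u in 𝓝 (h y₀), P (φ.symm u) := by
    intro P hP
    have h1 := φ.continuousAt_symm (φ.map_source hy₀)
    refine h1.eventually ?_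
    rwa [φ.left_inv hy₀]
  have htgt : ∀ᶠ u in 𝓝 (h y₀), u ∈ φ.target := φ.open_target.mem_nhds (φ.map_source hy₀)
  set W : E → JetCoord E F k := Γ ∘ φ.symm with hW
  have hWs : ∀ᶠ u in 𝓝 (h y₀), ContDiffAt ℝ ∞ W u := by
    filter_upwards [htgt, hpush hΓ, hpush hinv] with u hu h1 ⟨e, he⟩
    refine h1.comp u (φ.contDiffAt_symm hu (f₀' := e) ?_ (hsm _ h1))
    rw [he]
    exact hd _ h1
  have hW1 : ∀ᶠ u in 𝓝 (h y₀), (W u).1 = u := by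
    filter_upwards [htgt] with u hu using φ.right_inv hu
  have hWC : ∀ᶠ u in 𝓝 (h y₀), ∀ η, fderiv ℝ W u η ∈ coordCartan le_rfl (W u) := by
    filter_upwards [htgt, hpush hΓ, hpush hinv, hpush hC] with u hu h1 ⟨e, he⟩ h3 η
    have h2 : DifferentiableAt ℝ φ.symm u := by
      refine (φ.contDiffAt_symm hu (f₀' := e) ?_ (hsm _ h1)).differentiableAt (n := ∞) (by simp)
      rw [he]
      exact hd _ h1
    have h4 := ((h1.differentiableAt (by simp)).hasFDerivAt.comp u h2.hasFDerivAt).fderiv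
    rw [hW, h4]
    exact h3 _
  have hp : ∀ᶠ u in 𝓝 (h y₀), ∀ η, (fderiv ℝ (fun u => (W u).2) u η = (fderiv ℝ W u η).2) ∧
      (fderiv ℝ W u η).1 = η := by
    filter_upwards [hWs, hW1.eventually_nhds] with u h1 h2 η
    have h3 := (h1.differentiableAt (by simp)).hasFDerivAt
    refine ⟨?_, ?_⟩
    · have h4 := ((ContinuousLinearMap.snd ℝ E _).hasFDerivAt.comp u h3).fderiv
      exact congrArg (fun L => L η) h4
    · have h4 := ((ContinuousLinearMap.fst ℝ E _).hasFDerivAt.comp u h3)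
      have h5 : ((ContinuousLinearMap.fst ℝ E _) ∘ W) =ᶠ[𝓝 u] id := h2
      have h6 := (h4.congr_of_eventuallyEq h5.symm).unique (hasFDerivAt_id u)
      exact congrArg (fun L => L η) h6
  have hfs : ∀ᶠ u in 𝓝 (h y₀), ContDiffAt ℝ ∞ (fun u => (((W u).2 0).1 0 : F)) u := by
    filter_upwards [hWs] with u hu
    exact (valueCoord E F k).contDiff.contDiffAt.comp u hu
  have hfin := eventually_eq_derivs (p := fun u => (W u).2) (u₀ := h y₀)
    (by
      filter_upwards [hWs] with u hu
      exact (contDiffAt_snd.comp u hu).differentiableAt (n := ∞) (by simp))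
    (by
      filter_upwards [hp, hWC] with u h1 h2 η i hi
      have h3 := (mem_coordCartan _).1 (h2 η) i hi
      rw [(h1 η).1, h3, (h1 η).2]) hfs
  refine ⟨_, hfs, ?_⟩
  have hcont : ContinuousAt h y₀ := (hsm y₀ hΓ₀).continuousAt
  filter_upwards [hcont.eventually hfin, φ.open_source.mem_nhds hy₀] with y h1 h2
  have h3 : W (h y) = Γ y := by
    rw [hW, Function.comp_apply, ← hφc, φ.left_inv h2]
  simp only [h3] at h1
  exact h1

end IntegralManifolds

/-! ### Integral manifolds transversal to the base, in jet spaces. -/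

section IntegralManifoldsOfJets

variable {E : Type*} [NormedAddCommGroup E] [NormedSpace ℝ E]
  {M : Type*} [TopologicalSpace M] [ChartedSpace E M] [IsManifold 𝓘(ℝ, E) ∞ M]
  {F : Type*} [NormedAddCommGroup F] [NormedSpace ℝ F] [FiniteDimensional ℝ F]
  {N : Type*} [TopologicalSpace N] [ChartedSpace F N] [IsManifold 𝓘(ℝ, F) ∞ N] {k : ℕ}

theorem contMDiffAt_of_chart_rep {a : M} {b : N} {f : E → F} {x : M}
    (ha : x ∈ (chartAt E a).source) (hf : ContDiffAt ℝ ∞ f (chartAt E a x))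
    (hb : f (chartAt E a x) ∈ (chartAt F b).target) :
    ContMDiffAt 𝓘(ℝ, E) 𝓘(ℝ, F) ∞ ((chartAt F b).symm ∘ f ∘ chartAt E a) x :=
  ContMDiffAt.comp x (contMDiffAt_symm_of_mem_atlas (chart_mem_atlas F b) hb)
    (ContMDiffAt.comp x hf.contMDiffAt (contMDiffAt_of_mem_atlas (chart_mem_atlas E a) ha))

theorem smoothNear_of_chart_rep {a : M} {b : N} {f : E → F} {x : M}
    (ha : x ∈ (chartAt E a).source) (hf : ∀ᶠ u in 𝓝 (chartAt E a x), ContDiffAt ℝ ∞ f u)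
    (hb : f (chartAt E a x) ∈ (chartAt F b).target) :
    SmoothNear E F ((chartAt F b).symm ∘ f ∘ chartAt E a) x := by
  have hc := (chartAt E a).continuousAt ha
  filter_upwards [(chartAt E a).open_source.mem_nhds ha, hc.eventually hf,
    (hf.self_of_nhds.continuousAt.comp hc).eventually ((chartAt F b).open_target.mem_nhds hb)]
    with z h1 h2 h3
  exact contMDiffAt_of_chart_rep h1 h2 h3

theorem localRep_of_chart_rep {a : M} {b : N} {f : E → F} {u : E}
    (ha : u ∈ (chartAt E a).target) (hf : ContinuousAt f u) (hb : f u ∈ (chartAt F b).target) :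
    localRep E F a b ((chartAt F b).symm ∘ f ∘ chartAt E a) =ᶠ[𝓝 u] f := by
  filter_upwards [(chartAt E a).open_target.mem_nhds ha,
    hf.eventually ((chartAt F b).open_target.mem_nhds hb)] with y hy hy'
  simp only [localRep, Function.comp_apply]
  rw [(chartAt E a).right_inv hy, (chartAt F b).right_inv hy']

variable [FiniteDimensional ℝ E] [Nontrivial E]

/-- A submanifold of the jet space tangent to the Cartan distribution and transversal to the
fibres over `M` is the graph of a jet prolongation. -/
theorem exists_eq_jetOf {γ : M → Jet E M F N k} {x : M}
    (hγ : ∀ᶠ z in 𝓝 x, ContMDiffAt 𝓘(ℝ, E) 𝓘(ℝ, JetCoord E F k) ∞ γ z)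
    (hC : ∀ᶠ z in 𝓝 x, ∀ ξ : TangentSpace 𝓘(ℝ, E) z,
      mfderiv 𝓘(ℝ, E) 𝓘(ℝ, JetCoord E F k) γ z ξ ∈ (γ z).cartan)
    (hinj : ∀ ξ : TangentSpace 𝓘(ℝ, E) x, mfderiv 𝓘(ℝ, JetCoord E F k) 𝓘(ℝ, E)
      (Jet.base : Jet E M F N k → M) (γ x)
      (mfderiv 𝓘(ℝ, E) 𝓘(ℝ, JetCoord E F k) γ x ξ) = 0 → ξ = 0) :
    ∃ t : M → N, SmoothNear E F t (γ x).base ∧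
      ∀ᶠ z in 𝓝 x, γ z = jetOf E F k t (γ z).base := by
  -- Two unrelated charts of `M` occur: `e` around the parameter `x`, and the chart around the base
  -- point of `γ x`.
  set e := chartAt E x with he
  have hea : e ∈ atlas E M := chart_mem_atlas E x
  have hx : x ∈ e.source := mem_chart_source E x
  set a := (γ x).base with ha
  set b := (γ x).value with hb
  set c := jetOPH E F k a b with hc
  have hca : c ∈ atlas (JetCoord E F k) (Jet E M F N k) := jetOPH_mem_atlas k a b
  have hγx : γ x ∈ c.source := mem_jetOPH_self (γ x)
  have hγs : ∀ᶠ z in 𝓝 x, γ z ∈ c.source :=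
    hγ.self_of_nhds.continuousAt.eventually (c.open_source.mem_nhds hγx)
  have hpush : ∀ {P : M → Prop}, (∀ᶠ z in 𝓝 x, P z) → ∀ᶠ y in 𝓝 (e x), P (e.symm y) := by
    intro P hP
    refine (e.continuousAt_symm (e.map_source hx)).eventually ?_
    rwa [e.left_inv hx]
  have htgt : ∀ᶠ y in 𝓝 (e x), y ∈ e.target := e.open_target.mem_nhds (e.map_source hx)
  set Γ : E → JetCoord E F k := c ∘ γ ∘ e.symm with hΓ
  have hΓx : Γ (e x) = c (γ x) := by rw [hΓ, Function.comp_apply, Function.comp_apply, e.left_inv hx]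
  obtain ⟨f, hf1, hf2⟩ := exists_eq_derivs (Γ := Γ) (y₀ := e x)
    (by
      filter_upwards [htgt, hpush hγ, hpush hγs] with y h1 h2 h3
      rw [← contMDiffAt_iff_contDiffAt]
      exact ContMDiffAt.comp y (contMDiffAt_of_mem_atlas hca h3)
        (ContMDiffAt.comp y h2 (contMDiffAt_symm_of_mem_atlas hea h1)))
    (by
      filter_upwards [htgt, hpush hγ, hpush hγs, hpush hC] with y h1 h2 h3 h4 η
      have hs := e.map_target h1
      obtain ⟨ξ, rfl⟩ := (chartDeriv_bijective hea hs).2 η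
      have h5 := fderiv_chart hea hca h2 hs h3 ξ
      rw [e.right_inv h1] at h5
      rw [hΓ, h5]
      exact (mem_cartan_iff h3).1 (h4 ξ))
    (by
      intro η hη
      obtain ⟨ξ, rfl⟩ := (chartDeriv_bijective hea hx).2 η
      rw [hΓ, fderiv_chart hea hca hγ.self_of_nhds hx hγx ξ] at hη
      rw [hinj ξ, map_zero]
      exact ((linearInCharts_base a b).mfderiv_eq_zero_iff hca (chart_mem_atlas _ _) hγx _).2 hη)
  rw [hΓx] at hf1
  have hpull : ∀ {P : E → Prop}, (∀ᶠ y in 𝓝 (e x), P y) → ∀ᶠ z in 𝓝 x, P (e z) := fun hP =>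
    (e.continuousAt hx).eventually hP
  have hbase : ContinuousAt (fun z => (γ z).base) x :=
    (contMDiff_base (E := E) (F := F) (N := N) (k := k)).continuous.continuousAt.comp
      hγ.self_of_nhds.continuousAt
  have hval : ∀ z, γ z ∈ c.source → (c (γ z)).2 = derivs k f (c (γ z)).1 →
      f (chartAt E a (γ z).base) ∈ (chartAt F b).target := by
    intro z hz hz'
    have h1 := (mem_jetOPH_target.1 (c.map_source hz)).2
    rw [hz', derivs_zero] at h1
    exact h1
  have hf3 : ∀ᶠ z in 𝓝 x, (c (γ z)).2 = derivs k f (c (γ z)).1 := by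
    filter_upwards [hpull hf2, e.open_source.mem_nhds hx] with z h1 h2
    rw [hΓ, Function.comp_apply, Function.comp_apply, e.left_inv h2] at h1
    exact h1
  have hsm := smoothNear_of_chart_rep hγx.1 hf1 (hval x hγx hf3.self_of_nhds)
  refine ⟨_, hsm, ?_⟩
  have hca' : ContinuousAt (fun z => chartAt E a (γ z).base) x :=
    ContinuousAt.comp (f := fun z => (γ z).base) ((chartAt E a).continuousAt hγx.1) hbase
  filter_upwards [hf3, hγs, hbase.eventually hsm.eventually_nhds, hca'.eventually hf1]
    with z h1 h2 h3 h4
  have h5 := hval z h2 h1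
  have h6 : ((chartAt F b).symm ∘ f ∘ chartAt E a) (γ z).base ∈ (chartAt F b).source :=
    (chartAt F b).map_target h5
  refine c.injOn h2 ⟨h2.1, by rwa [jetOf_value]⟩ ?_
  rw [hc, jetOPH_jetOf h3 h2.1 h6, derivs_congr (localRep_of_chart_rep
    ((chartAt E a).map_source h2.1) h4.continuousAt h5)]
  exact Prod.ext rfl h1

end IntegralManifoldsOfJets

/-! ### Fibres inside a single saturated chart. -/

section ChartSegments

variable {H : Type*} [NormedAddCommGroup H] [NormedSpace ℝ H] {A : Type*} [TopologicalSpace A]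
  [ChartedSpace H A] [IsManifold 𝓘(ℝ, H) ∞ A]
  {H' : Type*} [NormedAddCommGroup H'] [NormedSpace ℝ H'] {B : Type*} [TopologicalSpace B]
  [ChartedSpace H' B]
  {H'' : Type*} [NormedAddCommGroup H''] [NormedSpace ℝ H''] {C : Type*}
  [TopologicalSpace C] [ChartedSpace H'' C] [IsManifold 𝓘(ℝ, H'') ∞ C]

/-- If the domain of a chart is saturated and the vertical vectors of `π` are annihilated by the
differential of `Ψ`, then `Ψ` is constant on the fibres of `π` in this chart. -/
theorem LinearInCharts.eq_of_vertical {c : OpenPartialHomeomorph A H}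
    {c' : OpenPartialHomeomorph B H'} {π : A → B} {P : H →L[ℝ] H'} (hl : LinearInCharts π c c' P)
    (hc : c ∈ atlas H A) (hct : ∀ w, P w ∈ c'.target → w ∈ c.target)
    (hπ : ContMDiff 𝓘(ℝ, H) 𝓘(ℝ, H') ∞ π) {Ψ : A → C} (hΨ : ContMDiff 𝓘(ℝ, H) 𝓘(ℝ, H'') ∞ Ψ)
    (hker : ∀ θ v, mfderiv 𝓘(ℝ, H) 𝓘(ℝ, H') π θ v = 0 → mfderiv 𝓘(ℝ, H) 𝓘(ℝ, H'') Ψ θ v = 0)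
    {θ θ' : A} (hθ : θ ∈ c.source) (hθ' : θ' ∈ c.source) (h : π θ = π θ') : Ψ θ = Ψ θ' := by
  have h0 : P (c θ) = P (c θ') := by rw [← (hl θ hθ).2, ← (hl θ' hθ').2, h]
  -- The line through both points has constant image under `P`. Saturation keeps it in the target of
  -- the chart, so it joins the two points inside one fibre.
  let l : ℝ → H := fun s => c θ + s • (c θ' - c θ)
  have hl0 : ∀ s, P (l s) = c' (π θ) := fun s => by
    simp only [l]
    rw [map_add, map_smul, map_sub, h0, sub_self, smul_zero, add_zero, ← h0, (hl θ hθ).2]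
  have hlt : ∀ s, l s ∈ c.target := fun s => hct _ (by
    rw [hl0]; exact c'.map_source (hl θ hθ).1)
  have hls : ContDiff ℝ ∞ l := contDiff_const.add (contDiff_id.smul contDiff_const)
  have hγ : ContMDiff 𝓘(ℝ, ℝ) 𝓘(ℝ, H) ∞ (c.symm ∘ l) := fun s =>
    ContMDiffAt.comp s (contMDiffAt_symm_of_mem_atlas hc (hlt s)) hls.contMDiff.contMDiffAt
  have hconst : ∀ s, π ((c.symm ∘ l) s) = π θ := fun s => by
    have h1 := hl _ (c.map_target (hlt s))
    refine c'.injOn h1.1 (hl θ hθ).1 (h1.2.trans ?_)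
    rw [c.right_inv (hlt s), hl0]
  have h2 := eq_of_fibre_family hπ hΨ hker hγ (fun x y => (hconst x).trans (hconst y).symm) 0 1
  simpa [l, c.left_inv hθ, c.left_inv hθ'] using h2

end ChartSegments

/-! ### The projection from mixed jets to mixed jets of order `(0, d)`. -/

section MixedDescent

variable {E : Type*} [NormedAddCommGroup E] [NormedSpace ℝ E]
  {M : Type*} [TopologicalSpace M] [ChartedSpace E M] [IsManifold 𝓘(ℝ, E) ∞ M]
  {F₁ : Type*} [NormedAddCommGroup F₁] [NormedSpace ℝ F₁] [FiniteDimensional ℝ F₁]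
  {N₁ : Type*} [TopologicalSpace N₁] [ChartedSpace F₁ N₁] [IsManifold 𝓘(ℝ, F₁) ∞ N₁]
  {F₂ : Type*} [NormedAddCommGroup F₂] [NormedSpace ℝ F₂] [FiniteDimensional ℝ F₂]
  {N₂ : Type*} [TopologicalSpace N₂] [ChartedSpace F₂ N₂] [IsManifold 𝓘(ℝ, F₂) ∞ N₂]
  {j₁ j₂ k₁ k₂ : ℕ}

/-- Maps whose differential annihilates the vertical vectors of the projection to mixed jets of
lower order are constant on the fibres of this projection. -/
theorem MixedJet.eq_of_trunc_eq {H : Type*} [NormedAddCommGroup H] [NormedSpace ℝ H] {C : Type*}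
    [TopologicalSpace C] [ChartedSpace H C] [IsManifold 𝓘(ℝ, H) ∞ C] (h₁ : j₁ ≤ k₁) (h₂ : j₂ ≤ k₂)
    {Ψ : MixedJet E M F₁ N₁ F₂ N₂ k₁ k₂ → C}
    (hΨ : ContMDiff 𝓘(ℝ, MixedCoord E F₁ F₂ k₁ k₂) 𝓘(ℝ, H) ∞ Ψ)
    (hker : ∀ θ v, mfderiv 𝓘(ℝ, MixedCoord E F₁ F₂ k₁ k₂) 𝓘(ℝ, MixedCoord E F₁ F₂ j₁ j₂)
      (MixedJet.trunc h₁ h₂ : MixedJet E M F₁ N₁ F₂ N₂ k₁ k₂ → _) θ v = 0 →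
      mfderiv 𝓘(ℝ, MixedCoord E F₁ F₂ k₁ k₂) 𝓘(ℝ, H) Ψ θ v = 0)
    {θ θ' : MixedJet E M F₁ N₁ F₂ N₂ k₁ k₂} (h : θ.trunc h₁ h₂ = θ'.trunc h₁ h₂) : Ψ θ = Ψ θ' := by
  have hθ := mem_mixedOPH_self θ
  -- The target of a jet chart restricts only the base point and the values, all of which survive
  -- truncation. The chart is therefore saturated.
  refine (linearInCharts_mixedTrunc h₁ h₂ θ.base θ.fst.value θ.snd.value).eq_of_vertical
    (mixedOPH_mem_atlas _ _ _ _ _) (fun w hw => hw) (contMDiff_mixedTrunc h₁ h₂) hΨ hker hθ ?_ h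
  have e1 : θ.fst.trunc h₁ = θ'.fst.trunc h₁ := congrArg MixedJet.fst h
  have e2 : θ.snd.trunc h₂ = θ'.snd.trunc h₂ := congrArg MixedJet.snd h
  refine ⟨⟨?_, ?_⟩, ⟨?_, ?_⟩⟩
  · rw [← Jet.trunc_base h₁, ← e1]
    exact hθ.1.1
  · rw [← Jet.trunc_value h₁ θ'.fst, ← e1, Jet.trunc_value]
    exact hθ.1.2
  · rw [← Jet.trunc_base h₂, ← e2]
    exact hθ.2.1
  · rw [← Jet.trunc_value h₂ θ'.snd, ← e2, Jet.trunc_value]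
    exact hθ.2.2

variable (E F₁ F₂) in
/-- Extension of the coordinates of a mixed jet by zero. -/
def mixedExtendCoord (j₁ j₂ k₁ k₂ : ℕ) : MixedCoord E F₁ F₂ j₁ j₂ →L[ℝ] MixedCoord E F₁ F₂ k₁ k₂ :=
  (ContinuousLinearMap.id ℝ E).prodMap ((extendZero E F₁ (j₁ + 1) k₁).prodMap
    (extendZero E F₂ (j₂ + 1) k₂))

theorem mixedTruncCoord_mixedExtendCoord (h₁ : j₁ ≤ k₁) (h₂ : j₂ ≤ k₂)
    (w : MixedCoord E F₁ F₂ j₁ j₂) :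
    mixedTruncCoord E F₁ F₂ h₁ h₂ (mixedExtendCoord E F₁ F₂ j₁ j₂ k₁ k₂ w) = w := by
  refine Prod.ext rfl (Prod.ext (funext fun i => ?_) (funext fun i => ?_))
  · exact extendZero_of_lt (F := F₁) w.2.1 (i := ⟨i, by omega⟩) i.2
  · exact extendZero_of_lt (F := F₂) w.2.2 (i := ⟨i, by omega⟩) i.2

theorem mfderiv_mixedTrunc_surjective (h₁ : j₁ ≤ k₁) (h₂ : j₂ ≤ k₂)
    (θ : MixedJet E M F₁ N₁ F₂ N₂ k₁ k₂) : Surjective (mfderiv 𝓘(ℝ, MixedCoord E F₁ F₂ k₁ k₂)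
      𝓘(ℝ, MixedCoord E F₁ F₂ j₁ j₂) (MixedJet.trunc h₁ h₂ : MixedJet E M F₁ N₁ F₂ N₂ k₁ k₂ → _) θ) :=
  (linearInCharts_mixedTrunc h₁ h₂ θ.base θ.fst.value θ.snd.value).mfderiv_surjective
    (mixedOPH_mem_atlas _ _ _ _ _) (mixedOPH_mem_atlas _ _ _ _ _)
    (fun w => ⟨_, mixedTruncCoord_mixedExtendCoord h₁ h₂ w⟩) (mem_mixedOPH_self θ)

theorem MixedJet.trunc_surjective (h₁ : j₁ ≤ k₁) (h₂ : j₂ ≤ k₂) :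
    Surjective (MixedJet.trunc h₁ h₂ :
      MixedJet E M F₁ N₁ F₂ N₂ k₁ k₂ → MixedJet E M F₁ N₁ F₂ N₂ j₁ j₂) := by
  intro b
  refine ⟨⟨jetOf E F₁ k₁ b.fst.rep b.fst.base, jetOf E F₂ k₂ b.snd.rep b.snd.base, b.base_eq⟩, ?_⟩
  refine MixedJet.ext ?_ ?_
  · exact (Jet.trunc_jetOf h₁ b.fst.smoothNear_rep).trans b.fst.jetOf_rep
  · exact (Jet.trunc_jetOf h₂ b.snd.smoothNear_rep).trans b.snd.jetOf_rep

theorem exists_section_mixedTrunc (h₁ : j₁ ≤ k₁) (h₂ : j₂ ≤ k₂)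
    (b : MixedJet E M F₁ N₁ F₂ N₂ j₁ j₂) :
    ∃ σ : MixedJet E M F₁ N₁ F₂ N₂ j₁ j₂ → MixedJet E M F₁ N₁ F₂ N₂ k₁ k₂,
      ContMDiffAt 𝓘(ℝ, MixedCoord E F₁ F₂ j₁ j₂) 𝓘(ℝ, MixedCoord E F₁ F₂ k₁ k₂) ∞ σ b ∧
      ∀ᶠ b' in 𝓝 b, (σ b').trunc h₁ h₂ = b' := by
  obtain ⟨θ, rfl⟩ := MixedJet.trunc_surjective h₁ h₂ b
  exact (linearInCharts_mixedTrunc h₁ h₂ θ.base θ.fst.value θ.snd.value).exists_section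
    (mixedOPH_mem_atlas _ _ _ _ _) (mixedOPH_mem_atlas _ _ _ _ _)
    (mixedTruncCoord_mixedExtendCoord h₁ h₂) (mem_mixedOPH_self θ)

variable [FiniteDimensional ℝ E] [Nontrivial E]

/-- The pulled-back distribution is a preimage under truncation, which is the form required by
`Preserves.descend`. -/
theorem mem_cartanOf_iff_mfderiv_trunc (h₁ : j₁ ≤ k₁) (h₂ : j₂ ≤ k₂)
    (θ : MixedJet E M F₁ N₁ F₂ N₂ k₁ k₂) (v : TangentSpace 𝓘(ℝ, MixedCoord E F₁ F₂ k₁ k₂) θ) :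
    v ∈ θ.cartanOf h₁ h₂ ↔ mfderiv 𝓘(ℝ, MixedCoord E F₁ F₂ k₁ k₂) 𝓘(ℝ, MixedCoord E F₁ F₂ j₁ j₂)
      (MixedJet.trunc h₁ h₂ : MixedJet E M F₁ N₁ F₂ N₂ k₁ k₂ → _) θ v ∈
        (θ.trunc h₁ h₂).cartan := by
  have hθ := mem_mixedOPH_self θ
  have l := linearInCharts_mixedTrunc (E := E) (F₁ := F₁) (F₂ := F₂) h₁ h₂ θ.base θ.fst.value θ.snd.value
  rw [mem_cartanOf_iff h₁ h₂ hθ, mem_mixedCartan_iff (l θ hθ).1, l.chartDeriv_mfderiv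
    (mixedOPH_mem_atlas _ _ _ _ _) (mixedOPH_mem_atlas _ _ _ _ _) hθ, (l θ hθ).2]
  simp only [mem_mixedCoordCartan, mem_coordCartan]
  rfl

/-- The vertical vectors of the projection to `J^{0, j₂}` in terms of Cartan distributions. -/
theorem mfderiv_mixedTrunc_eq_zero_iff (h₁ : 1 ≤ k₁) (h₂ : j₂ + 1 ≤ k₂)
    (θ : MixedJet E M F₁ N₁ F₂ N₂ k₁ k₂) (v : TangentSpace 𝓘(ℝ, MixedCoord E F₁ F₂ k₁ k₂) θ) :
    mfderiv 𝓘(ℝ, MixedCoord E F₁ F₂ k₁ k₂) 𝓘(ℝ, MixedCoord E F₁ F₂ 0 j₂)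
      (MixedJet.trunc (Nat.zero_le k₁) (Nat.le_of_succ_le h₂) :
        MixedJet E M F₁ N₁ F₂ N₂ k₁ k₂ → _) θ v = 0 ↔
      v ∈ θ.cartanOf h₁ h₂ ∧ chartDeriv (mixedOPH E F₁ F₂ k₁ k₂ θ.base θ.fst.value θ.snd.value) θ v ∈
        sndVertical k₁ k₂ j₂ := by
  have hθ := mem_mixedOPH_self θ
  have l := linearInCharts_mixedTrunc (E := E) (F₁ := F₁) (F₂ := F₂) (Nat.zero_le k₁) (Nat.le_of_succ_le h₂) θ.base θ.fst.value
    θ.snd.value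
  rw [mem_cartanOf_iff h₁ h₂ hθ, l.mfderiv_eq_zero_iff (mixedOPH_mem_atlas _ _ _ _ _)
    (mixedOPH_mem_atlas _ _ _ _ _) hθ, mem_sndVertical, mem_mixedCoordCartan, mem_coordCartan,
    mem_coordCartan]
  set u := chartDeriv (mixedOPH E F₁ F₂ k₁ k₂ θ.base θ.fst.value θ.snd.value) θ v
  constructor
  · intro hu
    have e1 : u.1 = 0 := congrArg Prod.fst hu
    have e2 : u.2.1 ⟨0, by omega⟩ = 0 := congrFun (congrArg (fun z => z.2.1) hu) 0
    have e3 : ∀ i (hi : i ≤ j₂), u.2.2 ⟨i, by omega⟩ = 0 := fun i hi =>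
      congrFun (congrArg (fun z => z.2.2) hu) ⟨i, by omega⟩
    refine ⟨⟨fun i hi => ?_, fun i hi => ?_⟩, e1, fun i hi => e3 i hi⟩
    · obtain rfl : i = 0 := by omega
      simp only [e1, e2, map_zero]
    · simp only [e1, e3 i (by omega), map_zero]
  -- With no horizontal part, the contact equation of order zero kills the value of the first
  -- component. This is the information that `sndVertical` alone does not contain.
  · rintro ⟨⟨h3, -⟩, e1, h4⟩
    refine Prod.ext e1 (Prod.ext (funext fun i => ?_) (funext fun i => ?_))
    · obtain rfl : i = 0 := Subsingleton.elim (α := Fin 1) _ _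
      have h5 := h3 0 (by omega)
      simp only [e1, map_zero] at h5
      exact h5
    · exact h4 ⟨i, by omega⟩ (by simp; omega)

/-- The vertical vectors in the Cartan distribution. -/
theorem mfderiv_mixedTrunc_eq_zero_of_cartan (h₁ : 1 ≤ k₁) (h₂ : j₂ + 1 ≤ k₂)
    (θ : MixedJet E M F₁ N₁ F₂ N₂ k₁ k₂) {v : TangentSpace 𝓘(ℝ, MixedCoord E F₁ F₂ k₁ k₂) θ}
    (hv : v ∈ θ.cartan)
    (h0 : (chartDeriv (mixedOPH E F₁ F₂ k₁ k₂ θ.base θ.fst.value θ.snd.value) θ v).1 = 0) :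
    mfderiv 𝓘(ℝ, MixedCoord E F₁ F₂ k₁ k₂) 𝓘(ℝ, MixedCoord E F₁ F₂ 0 j₂)
      (MixedJet.trunc (Nat.zero_le k₁) (Nat.le_of_succ_le h₂) :
        MixedJet E M F₁ N₁ F₂ N₂ k₁ k₂ → _) θ v = 0 := by
  have hθ := mem_mixedOPH_self θ
  rw [mfderiv_mixedTrunc_eq_zero_iff h₁ h₂, mem_cartanOf_iff h₁ h₂ hθ]
  rw [mem_mixedCartan_iff hθ] at hv
  rw [mem_mixedCoordCartan, mem_coordCartan, mem_coordCartan] at hv ⊢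
  refine ⟨⟨fun i hi => hv.1 i (by omega), fun i hi => hv.2 i (by omega)⟩, h0, fun i hi => ?_⟩
  have h3 := hv.2 i (by omega)
  simp only [h0, map_zero] at h3
  exact h3

/-- The vertical vectors are the intersection of two preserved objects: the distribution of order
`(1, d + 1)`, obtained after `k₁ - 1` derivations, and the characteristics of order `(0, d)`,
obtained after `k₁`. Here `d > 0` guarantees that contact forms of the second component remain when
those of the first are used up. -/
theorem Preserves.preservesVertical_mixedTrunc [Nontrivial F₂] (hk₁ : 1 ≤ k₁) {d : ℕ} (hd : 0 < d)
    (hk : k₂ = k₁ + d) (h₂ : d ≤ k₂) (Φ : MixedJetDiffeo E M F₁ N₁ F₂ N₂ k₁ k₂)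
    (hΦ : Preserves MixedJet.cartan Φ) (hΦ' : Preserves MixedJet.cartan Φ.symm) :
    PreservesVertical (MixedCoord E F₁ F₂ k₁ k₂) (MixedCoord E F₁ F₂ 0 d)
      (MixedJet.trunc (Nat.zero_le k₁) h₂) Φ := by
  intro θ v hv
  have hd1 : d + 1 ≤ k₂ := by omega
  replace hv := (mfderiv_mixedTrunc_eq_zero_iff hk₁ hd1 θ v).1 hv
  refine (mfderiv_mixedTrunc_eq_zero_iff hk₁ hd1 (Φ θ) _).2 ?_
  refine ⟨hΦ.cartanOf Φ (k₁ - 1) (by omega) (by omega) θ v hv.1, ?_⟩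
  have h3 := Preserves.preservesVertical_sndTrunc hd Φ (h₁ := Nat.zero_le k₁) (h₂ := h₂)
    (hΦ.cartanOf Φ k₁ (by omega) (by omega)) (hΦ'.cartanOf Φ.symm k₁ (by omega) (by omega))
  exact (mfderiv_sndTrunc_eq_zero_iff h₂ (mem_mixedOPH_self (Φ θ)) _).1
    (h3 θ v ((mfderiv_sndTrunc_eq_zero_iff h₂ (mem_mixedOPH_self θ) _).2 hv.2))

end MixedDescent

/-- Verticality of an image vector is pulled back through the inverse. This is how transversality of
the image of a graph is obtained. -/
theorem PreservesVertical.of_symm {H : Type*} [NormedAddCommGroup H] [NormedSpace ℝ H]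
    {A : Type*} [TopologicalSpace A] [ChartedSpace H A]
    {H' : Type*} [NormedAddCommGroup H'] [NormedSpace ℝ H'] {B : Type*} [TopologicalSpace B]
    [ChartedSpace H' B] {π : A → B} {Φ : A ≃ₘ⟮𝓘(ℝ, H), 𝓘(ℝ, H)⟯ A}
    (h : PreservesVertical H H' π Φ.symm) (θ : A) (v : H)
    (hv : (mfderiv 𝓘(ℝ, H) 𝓘(ℝ, H') π (Φ θ) (mfderiv 𝓘(ℝ, H) 𝓘(ℝ, H) Φ θ v : H) : H') = 0) :
    (mfderiv 𝓘(ℝ, H) 𝓘(ℝ, H') π θ v : H') = 0 := by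
  have h1 := h (Φ θ) _ hv
  rw [mfderiv_symm_mfderiv] at h1
  have h2 : ∀ θ₁, θ₁ = θ → (mfderiv 𝓘(ℝ, H) 𝓘(ℝ, H') π θ₁ v : H') =
      mfderiv 𝓘(ℝ, H) 𝓘(ℝ, H') π θ v := by
    rintro _ rfl; rfl
  exact (h2 _ (Φ.symm_apply_apply θ)).symm.trans h1

/-! ### Mixed Lie transformations are prolongations. -/

section MixedProlongation

variable {E : Type*} [NormedAddCommGroup E] [NormedSpace ℝ E]
  {M : Type*} [TopologicalSpace M] [ChartedSpace E M] [IsManifold 𝓘(ℝ, E) ∞ M]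
  {F : Type*} [NormedAddCommGroup F] [NormedSpace ℝ F] [FiniteDimensional ℝ F]
  {N : Type*} [TopologicalSpace N] [ChartedSpace F N] [IsManifold 𝓘(ℝ, F) ∞ N]
  {F₁ : Type*} [NormedAddCommGroup F₁] [NormedSpace ℝ F₁] [FiniteDimensional ℝ F₁]
  {N₁ : Type*} [TopologicalSpace N₁] [ChartedSpace F₁ N₁] [IsManifold 𝓘(ℝ, F₁) ∞ N₁]
  {F₂ : Type*} [NormedAddCommGroup F₂] [NormedSpace ℝ F₂] [FiniteDimensional ℝ F₂]
  {N₂ : Type*} [TopologicalSpace N₂] [ChartedSpace F₂ N₂] [IsManifold 𝓘(ℝ, F₂) ∞ N₂]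
  {k d k₁ k₂ : ℕ}

theorem mfderiv_jetOf_mem_cartan {s : M → N} {x : M} (hs : SmoothNear E F s x)
    (ξ : TangentSpace 𝓘(ℝ, E) x) :
    mfderiv 𝓘(ℝ, E) 𝓘(ℝ, JetCoord E F k) (jetOf E F k s) x ξ ∈ (jetOf E F k s x).cartan :=
  Submodule.subset_span ⟨s, hs, rfl, ξ, rfl⟩

theorem mfderiv_base_mfderiv_jetOf {s : M → N} {x : M} (hs : SmoothNear E F s x)
    (ξ : TangentSpace 𝓘(ℝ, E) x) :
    mfderiv 𝓘(ℝ, JetCoord E F k) 𝓘(ℝ, E) (Jet.base : Jet E M F N k → M) (jetOf E F k s x)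
      (mfderiv 𝓘(ℝ, E) 𝓘(ℝ, JetCoord E F k) (jetOf E F k s) x ξ) = ξ := by
  have h1 := mfderiv_comp x (mdiff (contMDiff_base.contMDiffAt (x := jetOf E F k s x)))
    (mdiff (contMDiffAt_jetOf (k := k) hs))
  have h2 : (Jet.base : Jet E M F N k → M) ∘ jetOf E F k s = id := rfl
  rw [h2, mfderiv_id] at h1
  exact (congrArg (fun L => L ξ) h1).symm

theorem mfderiv_fst_mfderiv_mixedJetOf {s₁ : M → N₁} {s₂ : M → N₂} {x : M}
    (hs₁ : SmoothNear E F₁ s₁ x) (hs₂ : SmoothNear E F₂ s₂ x) (ξ : TangentSpace 𝓘(ℝ, E) x) :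
    mfderiv 𝓘(ℝ, MixedCoord E F₁ F₂ k₁ k₂) 𝓘(ℝ, JetCoord E F₁ k₁)
      (MixedJet.fst : MixedJet E M F₁ N₁ F₂ N₂ k₁ k₂ → _) (mixedJetOf E F₁ F₂ k₁ k₂ s₁ s₂ x)
      (mfderiv 𝓘(ℝ, E) 𝓘(ℝ, MixedCoord E F₁ F₂ k₁ k₂) (mixedJetOf E F₁ F₂ k₁ k₂ s₁ s₂) x ξ) =
      mfderiv 𝓘(ℝ, E) 𝓘(ℝ, JetCoord E F₁ k₁) (jetOf E F₁ k₁ s₁) x ξ := by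
  have h1 := mfderiv_comp x
    (mdiff (contMDiff_fst.contMDiffAt (x := mixedJetOf E F₁ F₂ k₁ k₂ s₁ s₂ x)))
    (mdiff (contMDiffAt_mixedJetOf (k₁ := k₁) (k₂ := k₂) hs₁ hs₂))
  exact (congrArg (fun L => L ξ) h1).symm

theorem mfderiv_snd_mfderiv_mixedJetOf {s₁ : M → N₁} {s₂ : M → N₂} {x : M}
    (hs₁ : SmoothNear E F₁ s₁ x) (hs₂ : SmoothNear E F₂ s₂ x) (ξ : TangentSpace 𝓘(ℝ, E) x) :
    mfderiv 𝓘(ℝ, MixedCoord E F₁ F₂ k₁ k₂) 𝓘(ℝ, JetCoord E F₂ k₂)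
      (MixedJet.snd : MixedJet E M F₁ N₁ F₂ N₂ k₁ k₂ → _) (mixedJetOf E F₁ F₂ k₁ k₂ s₁ s₂ x)
      (mfderiv 𝓘(ℝ, E) 𝓘(ℝ, MixedCoord E F₁ F₂ k₁ k₂) (mixedJetOf E F₁ F₂ k₁ k₂ s₁ s₂) x ξ) =
      mfderiv 𝓘(ℝ, E) 𝓘(ℝ, JetCoord E F₂ k₂) (jetOf E F₂ k₂ s₂) x ξ := by
  have h1 := mfderiv_comp x
    (mdiff (contMDiff_snd.contMDiffAt (x := mixedJetOf E F₁ F₂ k₁ k₂ s₁ s₂ x)))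
    (mdiff (contMDiffAt_mixedJetOf (k₁ := k₁) (k₂ := k₂) hs₁ hs₂))
  exact (congrArg (fun L => L ξ) h1).symm

theorem mfderiv_mixedJetOf_mem_cartan {s₁ : M → N₁} {s₂ : M → N₂} {x : M}
    (hs₁ : SmoothNear E F₁ s₁ x) (hs₂ : SmoothNear E F₂ s₂ x) (ξ : TangentSpace 𝓘(ℝ, E) x) :
    mfderiv 𝓘(ℝ, E) 𝓘(ℝ, MixedCoord E F₁ F₂ k₁ k₂) (mixedJetOf E F₁ F₂ k₁ k₂ s₁ s₂) x ξ ∈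
      (mixedJetOf E F₁ F₂ k₁ k₂ s₁ s₂ x).cartan :=
  ⟨Submodule.mem_comap.2 <| mem_of_eq_of_mem (mfderiv_fst_mfderiv_mixedJetOf hs₁ hs₂ ξ)
      (mfderiv_jetOf_mem_cartan hs₁ ξ),
    Submodule.mem_comap.2 <| mem_of_eq_of_mem (mfderiv_snd_mfderiv_mixedJetOf hs₁ hs₂ ξ)
      (mfderiv_jetOf_mem_cartan hs₂ ξ)⟩

theorem mfderiv_base_mfderiv_fst_eq_zero_iff {a : M} {b₁ : N₁} {b₂ : N₂}
    {θ : MixedJet E M F₁ N₁ F₂ N₂ k₁ k₂} (hθ : θ ∈ (mixedOPH E F₁ F₂ k₁ k₂ a b₁ b₂).source)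
    (v : TangentSpace 𝓘(ℝ, MixedCoord E F₁ F₂ k₁ k₂) θ) :
    mfderiv 𝓘(ℝ, JetCoord E F₁ k₁) 𝓘(ℝ, E) (Jet.base : Jet E M F₁ N₁ k₁ → M) θ.fst
      (mfderiv 𝓘(ℝ, MixedCoord E F₁ F₂ k₁ k₂) 𝓘(ℝ, JetCoord E F₁ k₁) MixedJet.fst θ v) = 0 ↔
      (chartDeriv (mixedOPH E F₁ F₂ k₁ k₂ a b₁ b₂) θ v).1 = 0 := by
  have l := linearInCharts_fst
    (E := E) (M := M) (F₁ := F₁) (N₁ := N₁) (F₂ := F₂) (N₂ := N₂) (k₁ := k₁) (k₂ := k₂) a b₁ b₂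
  refine ((linearInCharts_base a b₁).mfderiv_eq_zero_iff (jetOPH_mem_atlas _ _ _)
    (chart_mem_atlas _ _) (l θ hθ).1 _).trans ?_
  rw [l.chartDeriv_mfderiv (mixedOPH_mem_atlas _ _ _ _ _) (jetOPH_mem_atlas _ _ _) hθ]
  rfl

theorem mfderiv_base_mfderiv_snd_eq_zero_iff {a : M} {b₁ : N₁} {b₂ : N₂}
    {θ : MixedJet E M F₁ N₁ F₂ N₂ k₁ k₂} (hθ : θ ∈ (mixedOPH E F₁ F₂ k₁ k₂ a b₁ b₂).source)
    (v : TangentSpace 𝓘(ℝ, MixedCoord E F₁ F₂ k₁ k₂) θ) :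
    mfderiv 𝓘(ℝ, JetCoord E F₂ k₂) 𝓘(ℝ, E) (Jet.base : Jet E M F₂ N₂ k₂ → M) θ.snd
      (mfderiv 𝓘(ℝ, MixedCoord E F₁ F₂ k₁ k₂) 𝓘(ℝ, JetCoord E F₂ k₂) MixedJet.snd θ v) = 0 ↔
      (chartDeriv (mixedOPH E F₁ F₂ k₁ k₂ a b₁ b₂) θ v).1 = 0 := by
  have l := linearInCharts_snd
    (E := E) (M := M) (F₁ := F₁) (N₁ := N₁) (F₂ := F₂) (N₂ := N₂) (k₁ := k₁) (k₂ := k₂) a b₁ b₂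
  refine ((linearInCharts_base a b₂).mfderiv_eq_zero_iff (jetOPH_mem_atlas _ _ _)
    (chart_mem_atlas _ _) (l θ hθ).1 _).trans ?_
  rw [l.chartDeriv_mfderiv (mixedOPH_mem_atlas _ _ _ _ _) (jetOPH_mem_atlas _ _ _) hθ]
  rfl

variable [FiniteDimensional ℝ E] [Nontrivial E]

/-- Lie transformations map graphs of jet prolongations to graphs of jet prolongations. -/
theorem exists_eq_mixedJetOf (h₁ : 1 ≤ k₁) (h₂ : d + 1 ≤ k₂)
    (Φ : MixedJetDiffeo E M F₁ N₁ F₂ N₂ k₁ k₂) (hΦ : Preserves MixedJet.cartan Φ)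
    (hV : PreservesVertical (MixedCoord E F₁ F₂ k₁ k₂) (MixedCoord E F₁ F₂ 0 d)
      (MixedJet.trunc (Nat.zero_le k₁) (Nat.le_of_succ_le h₂)) Φ.symm)
    {x : M} {s₁ : M → N₁} {s₂ : M → N₂} (hs₁ : SmoothNear E F₁ s₁ x) (hs₂ : SmoothNear E F₂ s₂ x) :
    ∃ (t₁ : M → N₁) (t₂ : M → N₂),
      SmoothNear E F₁ t₁ (Φ (mixedJetOf E F₁ F₂ k₁ k₂ s₁ s₂ x)).base ∧
      SmoothNear E F₂ t₂ (Φ (mixedJetOf E F₁ F₂ k₁ k₂ s₁ s₂ x)).base ∧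
      ∀ᶠ z in 𝓝 x, Φ (mixedJetOf E F₁ F₂ k₁ k₂ s₁ s₂ z) =
        mixedJetOf E F₁ F₂ k₁ k₂ t₁ t₂ (Φ (mixedJetOf E F₁ F₂ k₁ k₂ s₁ s₂ z)).base := by
  set γ := fun z => Φ (mixedJetOf E F₁ F₂ k₁ k₂ s₁ s₂ z) with hγdef
  set j := mixedJetOf E F₁ F₂ k₁ k₂ s₁ s₂ with hj
  have hev := hs₁.eventually_nhds.and hs₂.eventually_nhds
  have hjs : ∀ᶠ z in 𝓝 x, ContMDiffAt 𝓘(ℝ, E) 𝓘(ℝ, MixedCoord E F₁ F₂ k₁ k₂) ∞ j z := by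
    filter_upwards [hev] with z hz using contMDiffAt_mixedJetOf hz.1 hz.2
  have hγs : ∀ᶠ z in 𝓝 x, ContMDiffAt 𝓘(ℝ, E) 𝓘(ℝ, MixedCoord E F₁ F₂ k₁ k₂) ∞ γ z := by
    filter_upwards [hjs] with z hz using ContMDiffAt.comp z Φ.contMDiff.contMDiffAt hz
  have hd : ∀ᶠ z in 𝓝 x, ∀ ξ : TangentSpace 𝓘(ℝ, E) z,
      mfderiv 𝓘(ℝ, E) 𝓘(ℝ, MixedCoord E F₁ F₂ k₁ k₂) γ z ξ =
      mfderiv 𝓘(ℝ, MixedCoord E F₁ F₂ k₁ k₂) 𝓘(ℝ, MixedCoord E F₁ F₂ k₁ k₂) Φ (j z)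
        (mfderiv 𝓘(ℝ, E) 𝓘(ℝ, MixedCoord E F₁ F₂ k₁ k₂) j z ξ) := by
    filter_upwards [hjs] with z hz ξ
    have h1 := mfderiv_comp z (mdiff (Φ.contMDiff.contMDiffAt (x := j z))) (mdiff hz)
    exact congrArg (fun L => L ξ) h1
  have hγC : ∀ᶠ z in 𝓝 x, ∀ ξ : TangentSpace 𝓘(ℝ, E) z,
      mfderiv 𝓘(ℝ, E) 𝓘(ℝ, MixedCoord E F₁ F₂ k₁ k₂) γ z ξ ∈ (γ z).cartan := by
    filter_upwards [hev, hd] with z hz hdz ξ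
    exact mem_of_eq_of_mem (hdz ξ) (hΦ _ _ (mfderiv_mixedJetOf_mem_cartan hz.1 hz.2 ξ))
  have hfst : ∀ᶠ z in 𝓝 x, ∀ ξ : TangentSpace 𝓘(ℝ, E) z,
      mfderiv 𝓘(ℝ, E) 𝓘(ℝ, JetCoord E F₁ k₁) (fun z => (γ z).fst) z ξ =
      mfderiv 𝓘(ℝ, MixedCoord E F₁ F₂ k₁ k₂) 𝓘(ℝ, JetCoord E F₁ k₁) MixedJet.fst (γ z)
        (mfderiv 𝓘(ℝ, E) 𝓘(ℝ, MixedCoord E F₁ F₂ k₁ k₂) γ z ξ) := by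
    filter_upwards [hγs] with z hz ξ
    have h1 := mfderiv_comp z (mdiff (contMDiff_fst.contMDiffAt (x := γ z))) (mdiff hz)
    exact congrArg (fun L => L ξ) h1
  have hsnd : ∀ᶠ z in 𝓝 x, ∀ ξ : TangentSpace 𝓘(ℝ, E) z,
      mfderiv 𝓘(ℝ, E) 𝓘(ℝ, JetCoord E F₂ k₂) (fun z => (γ z).snd) z ξ =
      mfderiv 𝓘(ℝ, MixedCoord E F₁ F₂ k₁ k₂) 𝓘(ℝ, JetCoord E F₂ k₂) MixedJet.snd (γ z)
        (mfderiv 𝓘(ℝ, E) 𝓘(ℝ, MixedCoord E F₁ F₂ k₁ k₂) γ z ξ) := by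
    filter_upwards [hγs] with z hz ξ
    have h1 := mfderiv_comp z (mdiff (contMDiff_snd.contMDiffAt (x := γ z))) (mdiff hz)
    exact congrArg (fun L => L ξ) h1
  have hγx := mem_mixedOPH_self (γ x)
  -- A Cartan vector without horizontal part is vertical over `J^{0,d}`. Pulled back by `Φ`, the
  -- tangent vector of the original graph is then vertical as well; since it projects to `ξ`, this
  -- gives `ξ = 0`.
  have hinj : ∀ ξ : TangentSpace 𝓘(ℝ, E) x,
      (chartDeriv (mixedOPH E F₁ F₂ k₁ k₂ (γ x).base (γ x).fst.value (γ x).snd.value) (γ x)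
        (mfderiv 𝓘(ℝ, E) 𝓘(ℝ, MixedCoord E F₁ F₂ k₁ k₂) γ x ξ)).1 = 0 → ξ = 0 := by
    intro ξ hξ
    have h3 := mfderiv_mixedTrunc_eq_zero_of_cartan h₁ h₂ (γ x) (hγC.self_of_nhds ξ) hξ
    rw [hd.self_of_nhds ξ] at h3
    have h4 := hV.of_symm (j x) _ h3
    have h5 := ((mfderiv_mixedTrunc_eq_zero_iff h₁ h₂ (j x) _).1 h4).2.1
    have h6 := (mfderiv_base_mfderiv_fst_eq_zero_iff (mem_mixedOPH_self (j x)) _).2 h5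
    rw [mfderiv_fst_mfderiv_mixedJetOf hs₁ hs₂ ξ] at h6
    exact (mfderiv_base_mfderiv_jetOf hs₁ ξ).symm.trans h6
  obtain ⟨t₁, ht₁, ht₁'⟩ := exists_eq_jetOf (γ := fun z => (γ z).fst) (x := x)
    (by
      filter_upwards [hγs] with z hz using ContMDiffAt.comp z contMDiff_fst.contMDiffAt hz)
    (by
      filter_upwards [hγC, hfst] with z h1 h2 ξ
      exact mem_of_eq_of_mem (h2 ξ) (h1 ξ).1)
    (by
      intro ξ hξ
      rw [hfst.self_of_nhds ξ] at hξ
      exact hinj ξ ((mfderiv_base_mfderiv_fst_eq_zero_iff hγx _).1 hξ))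
  obtain ⟨t₂, ht₂, ht₂'⟩ := exists_eq_jetOf (γ := fun z => (γ z).snd) (x := x)
    (by
      filter_upwards [hγs] with z hz using ContMDiffAt.comp z contMDiff_snd.contMDiffAt hz)
    (by
      filter_upwards [hγC, hsnd] with z h1 h2 ξ
      exact mem_of_eq_of_mem (h2 ξ) (h1 ξ).2)
    (by
      intro ξ hξ
      rw [hsnd.self_of_nhds ξ] at hξ
      exact hinj ξ ((mfderiv_base_mfderiv_snd_eq_zero_iff hγx _).1 hξ))
  refine ⟨t₁, t₂, ht₁, ?_, ?_⟩
  · rw [← (γ x).base_eq] at ht₂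
    exact ht₂
  · filter_upwards [ht₁', ht₂'] with z h1 h2
    rw [← (γ z).base_eq] at h2
    exact MixedJet.ext h1 h2

theorem isMixedLie_iff (Φ : MixedJetDiffeo E M F₁ N₁ F₂ N₂ k₁ k₂) :
    IsMixedLie Φ ↔ Preserves MixedJet.cartan Φ ∧ Preserves MixedJet.cartan Φ.symm :=
  map_eq_iff_preserves Φ (D := MixedJet.cartan)

/-- Lie transformations of mixed jet spaces are prolongations. -/
theorem exists_mixedProlongation [Nontrivial F₂] (hk : k₁ < k₂)
    (Φ : MixedJetDiffeo E M F₁ N₁ F₂ N₂ k₁ k₂) (hΦ : IsMixedLie Φ) :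
    ∃ Φ₀ : MixedJetDiffeo E M F₁ N₁ F₂ N₂ 0 (k₂ - k₁), IsMixedLie Φ₀ ∧
      IsMixedProlongation (Nat.zero_le k₁) (Nat.sub_le k₂ k₁) Φ₀ Φ := by
  -- For `k₁ = 0` there is nothing to descend: `k₂ - 0` reduces to `k₂`, so `Φ` covers itself and no
  -- condition on graphs is imposed.
  rcases Nat.eq_zero_or_pos k₁ with rfl | hk₁
  · refine ⟨Φ, hΦ, fun θ => ?_, fun h => absurd h (lt_irrefl 0)⟩
    have h : ∀ θ : MixedJet E M F₁ N₁ F₂ N₂ 0 k₂,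
        θ.trunc (Nat.zero_le 0) (Nat.sub_le k₂ 0) = θ := fun θ =>
      MixedJet.ext (Jet.trunc_self le_rfl _) (Jet.trunc_self le_rfl _)
    exact (h _).trans (congrArg Φ (h θ).symm)
  obtain ⟨h1, h2⟩ := (isMixedLie_iff Φ).1 hΦ
  set d := k₂ - k₁ with hd
  have hd0 : 0 < d := by omega
  have hd1 : d + 1 ≤ k₂ := by omega
  have hd2 : d ≤ k₂ := Nat.sub_le k₂ k₁
  have v1 := h1.preservesVertical_mixedTrunc hk₁ hd0 (by omega) hd2 Φ h2
  have v2 := h2.preservesVertical_mixedTrunc hk₁ hd0 (by omega) hd2 Φ.symm h1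
  have hπ := contMDiff_mixedTrunc (E := E) (M := M) (F₁ := F₁) (N₁ := N₁) (F₂ := F₂) (N₂ := N₂)
    (Nat.zero_le k₁) hd2
  obtain ⟨Φ₀, hΦ₀⟩ := exists_descent hπ (exists_section_mixedTrunc (Nat.zero_le k₁) hd2) Φ
    (fun θ θ' h => MixedJet.eq_of_trunc_eq _ _ (hπ.comp Φ.contMDiff)
      (v1.mfderiv_comp_eq_zero hπ Φ.contMDiff) h)
    (fun θ θ' h => MixedJet.eq_of_trunc_eq _ _ (hπ.comp Φ.symm.contMDiff)
      (v2.mfderiv_comp_eq_zero hπ Φ.symm.contMDiff) h)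
  have hΦ₀' : ∀ θ, Φ₀.symm (MixedJet.trunc (Nat.zero_le k₁) hd2 θ) =
      MixedJet.trunc (Nat.zero_le k₁) hd2 (Φ.symm θ) := fun θ => by
    have h := hΦ₀ (Φ.symm θ)
    rw [Φ.apply_symm_apply] at h
    rw [← h, Φ₀.symm_apply_apply]
  refine ⟨Φ₀, (isMixedLie_iff Φ₀).2 ⟨?_, ?_⟩, fun θ => (hΦ₀ θ).symm, fun _ x s₁ s₂ hs₁ hs₂ => ?_⟩
  · exact (h1.cartanOf Φ k₁ (h₁ := Nat.zero_le k₁) (h₂ := hd2) (by omega) (by omega)).descend hπ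
      (MixedJet.trunc_surjective _ _) (mfderiv_mixedTrunc_surjective _ _)
      (mem_cartanOf_iff_mfderiv_trunc _ _) Φ.contMDiff Φ₀.contMDiff hΦ₀
  · exact (h2.cartanOf Φ.symm k₁ (h₁ := Nat.zero_le k₁) (h₂ := hd2) (by omega)
      (by omega)).descend hπ
      (MixedJet.trunc_surjective _ _) (mfderiv_mixedTrunc_surjective _ _)
      (mem_cartanOf_iff_mfderiv_trunc _ _) Φ.symm.contMDiff Φ₀.symm.contMDiff hΦ₀'
  -- The maps `t₁`, `t₂` found for `Φ` also serve for `Φ₀`: truncating the identity of graphs gives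
  -- the one in `J^{0,d}`.
  · obtain ⟨t₁, t₂, ht₁, ht₂, ht⟩ := exists_eq_mixedJetOf hk₁ hd1 Φ h1 v2 hs₁ hs₂
    have htr : ∀ {r₁ : M → N₁} {r₂ : M → N₂} {z : M}, SmoothNear E F₁ r₁ z → SmoothNear E F₂ r₂ z →
        (mixedJetOf E F₁ F₂ k₁ k₂ r₁ r₂ z).trunc (Nat.zero_le k₁) hd2 =
          mixedJetOf E F₁ F₂ 0 d r₁ r₂ z := fun h h' =>
      MixedJet.ext (Jet.trunc_jetOf (Nat.zero_le k₁) h) (Jet.trunc_jetOf hd2 h')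
    have hkey : ∀ {z : M}, SmoothNear E F₁ s₁ z → SmoothNear E F₂ s₂ z →
        Φ₀ (mixedJetOf E F₁ F₂ 0 d s₁ s₂ z) =
          (Φ (mixedJetOf E F₁ F₂ k₁ k₂ s₁ s₂ z)).trunc (Nat.zero_le k₁) hd2 := fun h h' => by
      rw [← htr h h', hΦ₀]
    have hbase : ContinuousAt (fun z => (Φ (mixedJetOf E F₁ F₂ k₁ k₂ s₁ s₂ z)).base) x := by
      have h3 := (contMDiffAt_mixedJetOf (k₁ := k₁) (k₂ := k₂) hs₁ hs₂).continuousAt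
      exact (contMDiff_base.continuous.comp (contMDiff_fst.continuous.comp
        Φ.contMDiff.continuous)).continuousAt.comp h3
    refine ⟨t₁, t₂, ?_, ?_, ?_, ?_⟩
    · rw [hkey hs₁ hs₂]
      exact ht₁
    · rw [hkey hs₁ hs₂]
      exact ht₂
    · filter_upwards [ht, hs₁.eventually_nhds, hs₂.eventually_nhds,
        hbase.eventually ht₁.eventually_nhds, hbase.eventually ht₂.eventually_nhds]
        with z e1 e2 e3 e4 e5
      rw [hkey e2 e3]
      refine (congrArg _ e1).trans ?_
      exact htr e4 e5
    · rw [hkey hs₁ hs₂]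
      exact ht.self_of_nhds

end MixedProlongation

/-! ### Jets of order zero and the splitting off of `N₁`. -/

section OrderZero

variable {E : Type*} [NormedAddCommGroup E] [NormedSpace ℝ E]
  {M : Type*} [TopologicalSpace M] [ChartedSpace E M] [IsManifold 𝓘(ℝ, E) ∞ M]
  {F : Type*} [NormedAddCommGroup F] [NormedSpace ℝ F] [FiniteDimensional ℝ F]
  {N : Type*} [TopologicalSpace N] [ChartedSpace F N] [IsManifold 𝓘(ℝ, F) ∞ N]
  {F₁ : Type*} [NormedAddCommGroup F₁] [NormedSpace ℝ F₁] [FiniteDimensional ℝ F₁]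
  {N₁ : Type*} [TopologicalSpace N₁] [ChartedSpace F₁ N₁] [IsManifold 𝓘(ℝ, F₁) ∞ N₁]
  {F₂ : Type*} [NormedAddCommGroup F₂] [NormedSpace ℝ F₂] [FiniteDimensional ℝ F₂]
  {N₂ : Type*} [TopologicalSpace N₂] [ChartedSpace F₂ N₂] [IsManifold 𝓘(ℝ, F₂) ∞ N₂] {k : ℕ}

variable (E F) in
/-- The coordinates of the `0`-jet of a constant map. -/
def constCoord : F →L[ℝ] (∀ i : Fin (0 + 1), SymMul E F i) :=
  -- The only index is `0`, where the product over no factors is `1`. The entry is therefore `y`,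
  -- and the functional `0` is immaterial.
  ContinuousLinearMap.pi fun i => ContinuousLinearMap.codRestrict
    (ContinuousMultilinearMap.smulRightL ℝ (fun _ : Fin i => E) F
      ((ContinuousMultilinearMap.mkPiAlgebra ℝ (Fin i) ℝ).compContinuousLinearMap
        fun _ => (0 : E →L[ℝ] ℝ))) (SymMul E F i) fun y => (powForm E i 0 y).2

theorem derivs_const (y : F) (u : E) : derivs 0 (fun _ : E => y) u = constCoord E F y := by
  ext1 i
  obtain rfl : i = 0 := Subsingleton.elim (α := Fin 1) _ _
  refine symMul_ext fun v => ?_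
  obtain rfl : v = 0 := Subsingleton.elim (α := Fin 0 → E) _ _
  refine (derivs_zero 0 (fun _ : E => y) u).trans ?_
  exact ((powForm_apply 0 (0 : E →L[ℝ] ℝ) y 0).trans (by simp)).symm

theorem jetOPH_const {a : M} {b : N} {x : M} {y : N} (ha : x ∈ (chartAt E a).source)
    (hb : y ∈ (chartAt F b).source) :
    jetOPH E F 0 a b (jetOf E F 0 (fun _ => y) x) =
      (chartAt E a x, constCoord E F (chartAt F b y)) :=
  (jetOPH_jetOf (smoothNear_const y x) ha hb).trans (Prod.ext rfl
    (derivs_const (E := E) (chartAt F b y) (chartAt E a x)))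

/-- This is the smooth map `M × N → J^0(M, N)` through which transformations of `J^0` become point
transformations. -/
theorem contMDiff_jetOf_const : ContMDiff (𝓘(ℝ, E).prod 𝓘(ℝ, F)) 𝓘(ℝ, JetCoord E F 0) ∞
    (fun p : M × N => jetOf E F 0 (fun _ : M => p.2) p.1) := by
  rintro ⟨x, y⟩
  set c := jetOPH E F 0 x y
  have hx := mem_chart_source E x
  have hy := mem_chart_source F y
  set G : M × N → JetCoord E F 0 := fun p =>
    (chartAt E x p.1, constCoord E F (chartAt F y p.2)) with hG
  have hsrc : ∀ᶠ p : M × N in 𝓝 (x, y), p.1 ∈ (chartAt E x).source ∧ p.2 ∈ (chartAt F y).source :=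
    prod_mem_nhds ((chartAt E x).open_source.mem_nhds hx) ((chartAt F y).open_source.mem_nhds hy)
  have h1 : (fun p : M × N => jetOf E F 0 (fun _ : M => p.2) p.1) =ᶠ[𝓝 (x, y)] c.symm ∘ G := by
    filter_upwards [hsrc] with p hp
    rw [Function.comp_apply, hG]
    simp only
    rw [← jetOPH_const hp.1 hp.2, c.left_inv]
    exact ⟨hp.1, by rw [jetOf_value]; exact hp.2⟩
  refine ContMDiffAt.congr_of_eventuallyEq ?_ h1
  have hGs : ContMDiffAt (𝓘(ℝ, E).prod 𝓘(ℝ, F)) 𝓘(ℝ, JetCoord E F 0) ∞ G (x, y) := by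
    refine ContMDiffAt.prodMk_space ?_ ?_
    · exact ContMDiffAt.comp (x, y) (contMDiffAt_of_mem_atlas (chart_mem_atlas E x) hx)
        contMDiffAt_fst
    · exact ContMDiffAt.comp (x, y) (g := constCoord E F)
        (constCoord E F).contDiff.contMDiff.contMDiffAt
        (ContMDiffAt.comp (x, y) (contMDiffAt_of_mem_atlas (chart_mem_atlas F y) hy)
          contMDiffAt_snd)
  refine ContMDiffAt.comp (x, y) (contMDiffAt_symm_of_mem_atlas (jetOPH_mem_atlas _ _ _) ?_) hGs
  simp only [hG]
  rw [← jetOPH_const hx hy]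
  exact c.map_source ⟨hx, by rw [jetOf_value]; exact hy⟩

/-- The identification `J^{0,k}(M, N₁ × N₂) = N₁ × J^k(M, N₂)` is smooth. -/
theorem contMDiff_mixedZeroEquiv_symm :
    ContMDiff (𝓘(ℝ, F₁).prod 𝓘(ℝ, JetCoord E F₂ k)) 𝓘(ℝ, MixedCoord E F₁ F₂ 0 k) ∞
      (mixedZeroEquiv E M F₁ N₁ F₂ N₂ k).symm := by
  rintro ⟨y, η⟩
  set c := mixedOPH E F₁ F₂ 0 k η.base y η.value
  set c₂ := jetOPH E F₂ k η.base η.value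
  have hη : η ∈ c₂.source := mem_jetOPH_self η
  have hy := mem_chart_source F₁ y
  set G : N₁ × Jet E M F₂ N₂ k → MixedCoord E F₁ F₂ 0 k := fun p =>
    ((c₂ p.2).1, constCoord E F₁ (chartAt F₁ y p.1), (c₂ p.2).2) with hG
  have key : ∀ p : N₁ × Jet E M F₂ N₂ k, p.1 ∈ (chartAt F₁ y).source → p.2 ∈ c₂.source →
      (mixedZeroEquiv E M F₁ N₁ F₂ N₂ k).symm p ∈ c.source ∧
        c ((mixedZeroEquiv E M F₁ N₁ F₂ N₂ k).symm p) = G p := by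
    intro p h1 h2
    refine ⟨⟨⟨h2.1, ?_⟩, h2⟩, Prod.ext rfl (Prod.ext ?_ rfl)⟩
    · change (jetOf E F₁ 0 (fun _ : M => p.1) p.2.base).value ∈ _
      rw [jetOf_value]
      exact h1
    · exact congrArg Prod.snd (jetOPH_const (E := E) (F := F₁) h2.1 h1)
  have hsrc : ∀ᶠ p : N₁ × Jet E M F₂ N₂ k in 𝓝 (y, η),
      p.1 ∈ (chartAt F₁ y).source ∧ p.2 ∈ c₂.source :=
    prod_mem_nhds ((chartAt F₁ y).open_source.mem_nhds hy) (c₂.open_source.mem_nhds hη)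
  have h1 : (mixedZeroEquiv E M F₁ N₁ F₂ N₂ k).symm =ᶠ[𝓝 (y, η)] c.symm ∘ G := by
    filter_upwards [hsrc] with p hp
    rw [Function.comp_apply, ← (key p hp.1 hp.2).2, c.left_inv (key p hp.1 hp.2).1]
  refine ContMDiffAt.congr_of_eventuallyEq ?_ h1
  have hc₂ : ContMDiffAt (𝓘(ℝ, F₁).prod 𝓘(ℝ, JetCoord E F₂ k)) 𝓘(ℝ, JetCoord E F₂ k) ∞
      (fun p : N₁ × Jet E M F₂ N₂ k => c₂ p.2) (y, η) :=
    ContMDiffAt.comp (y, η) (contMDiffAt_of_mem_atlas (jetOPH_mem_atlas _ _ _) hη) contMDiffAt_snd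
  have hGs : ContMDiffAt (𝓘(ℝ, F₁).prod 𝓘(ℝ, JetCoord E F₂ k)) 𝓘(ℝ, MixedCoord E F₁ F₂ 0 k) ∞ G
      (y, η) := by
    refine ContMDiffAt.prodMk_space ?_ (ContMDiffAt.prodMk_space ?_ ?_)
    · exact ContMDiffAt.comp (y, η) (g := Prod.fst) contDiff_fst.contMDiff.contMDiffAt hc₂
    · exact ContMDiffAt.comp (y, η) (g := constCoord E F₁)
        (constCoord E F₁).contDiff.contMDiff.contMDiffAt
        (ContMDiffAt.comp (y, η) (contMDiffAt_of_mem_atlas (chart_mem_atlas F₁ y) hy)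
          contMDiffAt_fst)
    · exact ContMDiffAt.comp (y, η) (g := Prod.snd) contDiff_snd.contMDiff.contMDiffAt hc₂
  refine ContMDiffAt.comp (y, η) (contMDiffAt_symm_of_mem_atlas (mixedOPH_mem_atlas _ _ _ _ _) ?_)
    hGs
  rw [← (key (y, η) hy hη).2]
  exact c.map_source (key (y, η) hy hη).1

end OrderZero

/-! ### Prolongation of transformations of pure jet spaces. -/

section PureProlongation

variable {E : Type*} [NormedAddCommGroup E] [NormedSpace ℝ E] [FiniteDimensional ℝ E] [Nontrivial E]
  {M : Type*} [TopologicalSpace M] [ChartedSpace E M] [IsManifold 𝓘(ℝ, E) ∞ M]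
  {F : Type*} [NormedAddCommGroup F] [NormedSpace ℝ F] [FiniteDimensional ℝ F]
  {N : Type*} [TopologicalSpace N] [ChartedSpace F N] [IsManifold 𝓘(ℝ, F) ∞ N] {j k : ℕ}

/-- Without horizontal part, the contact equations kill all entries of order less than `k`. The
entry of order `k` is free, so `j < k` must be strict. -/
theorem mfderiv_trunc_eq_zero_of_cartan (h : j < k) (θ : Jet E M F N k)
    {v : TangentSpace 𝓘(ℝ, JetCoord E F k) θ} (hv : v ∈ θ.cartan)
    (h0 : mfderiv 𝓘(ℝ, JetCoord E F k) 𝓘(ℝ, E) (Jet.base : Jet E M F N k → M) θ v = 0) :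
    mfderiv 𝓘(ℝ, JetCoord E F k) 𝓘(ℝ, JetCoord E F j) (Jet.trunc h.le : Jet E M F N k → _) θ v
      = 0 := by
  have hθ := mem_jetOPH_self θ
  rw [mem_cartan_iff hθ, mem_coordCartan] at hv
  have h1 : (chartDeriv (jetOPH E F k θ.base θ.value) θ v).1 = 0 :=
    ((linearInCharts_base θ.base θ.value).mfderiv_eq_zero_iff (jetOPH_mem_atlas _ _ _)
      (chart_mem_atlas _ _) hθ v).1 h0
  rw [(linearInCharts_trunc h.le θ.base θ.value).mfderiv_eq_zero_iff (jetOPH_mem_atlas _ _ _)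
      (jetOPH_mem_atlas _ _ _) hθ]
  refine Prod.ext h1 (funext fun i => ?_)
  have h2 := hv i (by omega)
  rw [h1, map_zero] at h2
  exact h2

theorem mfderiv_base_eq_zero_of_trunc (h : j ≤ k) (θ : Jet E M F N k)
    {v : TangentSpace 𝓘(ℝ, JetCoord E F k) θ}
    (h0 : mfderiv 𝓘(ℝ, JetCoord E F k) 𝓘(ℝ, JetCoord E F j)
      (Jet.trunc h : Jet E M F N k → _) θ v = 0) :
    mfderiv 𝓘(ℝ, JetCoord E F k) 𝓘(ℝ, E) (Jet.base : Jet E M F N k → M) θ v = 0 := by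
  have hθ := mem_jetOPH_self θ
  rw [(linearInCharts_trunc h θ.base θ.value).mfderiv_eq_zero_iff (jetOPH_mem_atlas _ _ _)
      (jetOPH_mem_atlas _ _ _) hθ] at h0
  exact ((linearInCharts_base θ.base θ.value).mfderiv_eq_zero_iff (jetOPH_mem_atlas _ _ _)
      (chart_mem_atlas _ _) hθ v).2 (congrArg Prod.fst h0)

theorem isLie_iff (g : JetDiffeo E M F N k) :
    IsLie g ↔ Preserves Jet.cartan g ∧ Preserves Jet.cartan g.symm :=
  map_eq_iff_preserves g (D := Jet.cartan)

/-- Lie transformations covering a transformation of jets of lower order map graphs of jet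
prolongations to graphs of jet prolongations. -/
theorem exists_eq_jetOf_of_lie (h : j < k) (g : JetDiffeo E M F N k) (hg : Preserves Jet.cartan g)
    (hV : PreservesVertical (JetCoord E F k) (JetCoord E F j) (Jet.trunc h.le) g.symm)
    {x : M} {s : M → N} (hs : SmoothNear E F s x) :
    ∃ t : M → N, SmoothNear E F t (g (jetOf E F k s x)).base ∧
      ∀ᶠ z in 𝓝 x, g (jetOf E F k s z) = jetOf E F k t (g (jetOf E F k s z)).base := by
  have hd : ∀ {z : M}, SmoothNear E F s z → ∀ ξ : TangentSpace 𝓘(ℝ, E) z,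
      mfderiv 𝓘(ℝ, E) 𝓘(ℝ, JetCoord E F k) (fun z => g (jetOf E F k s z)) z ξ =
      mfderiv 𝓘(ℝ, JetCoord E F k) 𝓘(ℝ, JetCoord E F k) g (jetOf E F k s z)
        (mfderiv 𝓘(ℝ, E) 𝓘(ℝ, JetCoord E F k) (jetOf E F k s) z ξ) := by
    intro z hz ξ
    have h1 := mfderiv_comp z (mdiff (g.contMDiff.contMDiffAt (x := jetOf E F k s z)))
      (mdiff (contMDiffAt_jetOf (k := k) hz))
    exact congrArg (fun L => L ξ) h1
  have hC : ∀ {z : M}, SmoothNear E F s z → ∀ ξ : TangentSpace 𝓘(ℝ, E) z,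
      mfderiv 𝓘(ℝ, E) 𝓘(ℝ, JetCoord E F k) (fun z => g (jetOf E F k s z)) z ξ ∈
        (g (jetOf E F k s z)).cartan := fun hz ξ =>
    mem_of_eq_of_mem (hd hz ξ) (hg _ _ (mfderiv_jetOf_mem_cartan hz ξ))
  refine exists_eq_jetOf (γ := fun z => g (jetOf E F k s z)) ?_ ?_ ?_
  · filter_upwards [hs.eventually_nhds] with z hz
    exact ContMDiffAt.comp z g.contMDiff.contMDiffAt (contMDiffAt_jetOf hz)
  · filter_upwards [hs.eventually_nhds] with z hz using hC hz
  · intro ξ hξ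
    have h1 := mfderiv_trunc_eq_zero_of_cartan h _ (hC hs ξ) hξ
    rw [hd hs ξ] at h1
    have h2 := mfderiv_base_eq_zero_of_trunc h.le _ (hV.of_symm (jetOf E F k s x) _ h1)
    rw [mfderiv_base_mfderiv_jetOf hs ξ] at h2
    exact h2

/-- A Lie transformation covering a transformation of jets of lower order is its prolongation. -/
theorem isProlongation_of_covers (h : j ≤ k) (f : JetDiffeo E M F N j) (g : JetDiffeo E M F N k)
    (hg : Preserves Jet.cartan g) (hfg : ∀ θ, f (θ.trunc h) = (g θ).trunc h) :
    IsProlongation h f g := by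
  refine ⟨fun θ => (hfg θ).symm, fun hjk x s hs => ?_⟩
  have hfg' : ∀ θ : Jet E M F N k, f.symm (θ.trunc h) = (g.symm θ).trunc h := fun θ => by
    have h1 := hfg (g.symm θ)
    rw [g.apply_symm_apply] at h1
    rw [← h1, f.symm_apply_apply]
  -- The inverse of `g` covers the inverse of `f`, so it maps vertical vectors to vertical vectors.
  have hV : PreservesVertical (JetCoord E F k) (JetCoord E F j) (Jet.trunc h) g.symm := by
    intro θ v hv
    rw [← mfderiv_semiconj (contMDiff_trunc h) g.symm.contMDiff f.symm.contMDiff hfg' θ v, hv]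
    exact map_zero _
  obtain ⟨t, ht, ht'⟩ := exists_eq_jetOf_of_lie hjk g hg hV hs
  have hkey : ∀ {z : M}, SmoothNear E F s z →
      f (jetOf E F j s z) = (g (jetOf E F k s z)).trunc h := fun hz => by
    rw [← hfg, Jet.trunc_jetOf h hz]
  have hbase : ContinuousAt (fun z => (g (jetOf E F k s z)).base) x :=
    (contMDiff_base.continuous.comp g.contMDiff.continuous).continuousAt.comp
      (contMDiffAt_jetOf (k := k) hs).continuousAt
  refine ⟨t, ?_, ?_, ?_⟩
  · rw [hkey hs]
    exact ht
  · filter_upwards [ht', hs.eventually_nhds, hbase.eventually ht.eventually_nhds] with z e1 e2 e3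
    rw [hkey e2]
    exact (congrArg _ e1).trans (Jet.trunc_jetOf h e3)
  · rw [hkey hs]
    exact ht'.self_of_nhds

end PureProlongation

/-! ### Descent to jets of the second component. -/

section SecondComponent

variable {E : Type*} [NormedAddCommGroup E] [NormedSpace ℝ E]
  {M : Type*} [TopologicalSpace M] [ChartedSpace E M] [IsManifold 𝓘(ℝ, E) ∞ M]
  {F₁ : Type*} [NormedAddCommGroup F₁] [NormedSpace ℝ F₁] [FiniteDimensional ℝ F₁]
  {N₁ : Type*} [TopologicalSpace N₁] [ChartedSpace F₁ N₁] [IsManifold 𝓘(ℝ, F₁) ∞ N₁]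
  {F₂ : Type*} [NormedAddCommGroup F₂] [NormedSpace ℝ F₂] [FiniteDimensional ℝ F₂]
  {N₂ : Type*} [TopologicalSpace N₂] [ChartedSpace F₂ N₂] [IsManifold 𝓘(ℝ, F₂) ∞ N₂]
  {j k k₁ : ℕ}

theorem mfderiv_sndTrunc_eq_zero_of_trunc (h : j ≤ k) (θ : MixedJet E M F₁ N₁ F₂ N₂ 0 k)
    (v : TangentSpace 𝓘(ℝ, MixedCoord E F₁ F₂ 0 k) θ)
    (hv : mfderiv 𝓘(ℝ, MixedCoord E F₁ F₂ 0 k) 𝓘(ℝ, MixedCoord E F₁ F₂ 0 j)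
      (MixedJet.trunc le_rfl h : MixedJet E M F₁ N₁ F₂ N₂ 0 k → _) θ v = 0) :
    mfderiv 𝓘(ℝ, MixedCoord E F₁ F₂ 0 k) 𝓘(ℝ, JetCoord E F₂ j) (MixedJet.sndTrunc h) θ v = 0 := by
  have h1 := mfderiv_comp θ (mdiff (contMDiff_snd.contMDiffAt (x := θ.trunc le_rfl h)))
    (mdiff ((contMDiff_mixedTrunc le_rfl h).contMDiffAt (x := θ)))
  have h2 : MixedJet.snd ∘ (MixedJet.trunc le_rfl h : MixedJet E M F₁ N₁ F₂ N₂ 0 k → _) =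
    MixedJet.sndTrunc h := rfl
  rw [h2] at h1
  rw [h1]
  exact (congrArg (mfderiv 𝓘(ℝ, MixedCoord E F₁ F₂ 0 j) 𝓘(ℝ, JetCoord E F₂ j) MixedJet.snd
    (θ.trunc le_rfl h)) hv).trans (ContinuousLinearMap.map_zero _)

/-- Maps whose differential annihilates the vertical vectors of the projection to jets of the
second component are constant on the fibres of this projection. -/
theorem MixedJet.eq_of_sndTrunc_eq [PreconnectedSpace N₁] {H : Type*} [NormedAddCommGroup H]
    [NormedSpace ℝ H] {C : Type*} [TopologicalSpace C] [ChartedSpace H C] [IsManifold 𝓘(ℝ, H) ∞ C]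
    (h : j ≤ k) {Ψ : MixedJet E M F₁ N₁ F₂ N₂ 0 k → C}
    (hΨ : ContMDiff 𝓘(ℝ, MixedCoord E F₁ F₂ 0 k) 𝓘(ℝ, H) ∞ Ψ)
    (hker : ∀ θ v, mfderiv 𝓘(ℝ, MixedCoord E F₁ F₂ 0 k) 𝓘(ℝ, JetCoord E F₂ j)
      (MixedJet.sndTrunc h : MixedJet E M F₁ N₁ F₂ N₂ 0 k → _) θ v = 0 →
      mfderiv 𝓘(ℝ, MixedCoord E F₁ F₂ 0 k) 𝓘(ℝ, H) Ψ θ v = 0)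
    {θ θ' : MixedJet E M F₁ N₁ F₂ N₂ 0 k} (hθ : θ.sndTrunc h = θ'.sndTrunc h) : Ψ θ = Ψ θ' := by
  set e := mixedZeroEquiv E M F₁ N₁ F₂ N₂ k with he
  have hγ : ContMDiff 𝓘(ℝ, F₁) 𝓘(ℝ, MixedCoord E F₁ F₂ 0 k) ∞
      (fun y : N₁ => e.symm (y, θ.snd)) :=
    contMDiff_mixedZeroEquiv_symm.comp (contMDiff_id.prodMk contMDiff_const)
  -- The passage from `θ` to `θ'` has two stages: along the connected manifold `N₁` with the second
  -- component fixed, until the values in `N₁` agree, and then inside a fibre of `J^{0,k} →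
  -- J^{0,j}`.
  have h1 := eq_of_fibre_family (contMDiff_sndTrunc h) hΨ hker hγ (fun _ _ => rfl)
    θ.fst.value θ'.fst.value
  have h2 : e.symm (θ.fst.value, θ.snd) = θ := e.symm_apply_apply θ
  rw [h2] at h1
  rw [h1]
  refine MixedJet.eq_of_trunc_eq le_rfl h hΨ
    (fun θ v hv => hker θ v (mfderiv_sndTrunc_eq_zero_of_trunc h θ v hv)) ?_
  have h3 : θ.snd.base = θ'.snd.base := congrArg (fun η : Jet E M F₂ N₂ j => η.base) hθ
  refine MixedJet.ext ?_ hθ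
  refine (Jet.trunc_self le_rfl _).trans ((?_ : _ = θ'.fst).trans (Jet.trunc_self le_rfl _).symm)
  change jetOf E F₁ 0 (fun _ => θ'.fst.value) θ.snd.base = θ'.fst
  rw [h3, ← θ'.base_eq, jetOf_zero_value]

variable (E F₁ F₂) in
/-- Extension of the coordinates of a jet of the second component by zero. -/
def sndExtendCoord (j k₁ k : ℕ) : JetCoord E F₂ j →L[ℝ] MixedCoord E F₁ F₂ k₁ k :=
  (ContinuousLinearMap.id ℝ E).prodMap
    ((0 : _ →L[ℝ] (∀ i : Fin (k₁ + 1), SymMul E F₁ i)).prod (extendZero E F₂ (j + 1) k))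

theorem truncCoord_sndExtendCoord (h : j ≤ k) (w : JetCoord E F₂ j) :
    (truncCoord E F₂ h ∘L sndCoord E F₁ F₂ k₁ k) (sndExtendCoord E F₁ F₂ j k₁ k w) = w :=
  Prod.ext rfl (funext fun i => extendZero_of_lt (F := F₂) w.2 (i := ⟨i, by omega⟩) i.2)

theorem mfderiv_sndTrunc_surjective (h : j ≤ k) (θ : MixedJet E M F₁ N₁ F₂ N₂ k₁ k) :
    Surjective (mfderiv 𝓘(ℝ, MixedCoord E F₁ F₂ k₁ k) 𝓘(ℝ, JetCoord E F₂ j)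
      (MixedJet.sndTrunc h : MixedJet E M F₁ N₁ F₂ N₂ k₁ k → _) θ) :=
  (linearInCharts_sndTrunc h θ.base θ.fst.value θ.snd.value).mfderiv_surjective
    (mixedOPH_mem_atlas _ _ _ _ _) (jetOPH_mem_atlas _ _ _)
    (fun w => ⟨_, truncCoord_sndExtendCoord h w⟩) (mem_mixedOPH_self θ)

theorem MixedJet.sndTrunc_surjective [Nonempty N₁] (h : j ≤ k) :
    Surjective (MixedJet.sndTrunc h : MixedJet E M F₁ N₁ F₂ N₂ k₁ k → Jet E M F₂ N₂ j) := by
  intro b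
  obtain ⟨y⟩ := ‹Nonempty N₁›
  exact ⟨⟨jetOf E F₁ k₁ (fun _ => y) b.base, jetOf E F₂ k b.rep b.base, rfl⟩,
    (Jet.trunc_jetOf h b.smoothNear_rep).trans b.jetOf_rep⟩

theorem exists_section_sndTrunc [Nonempty N₁] (h : j ≤ k) (b : Jet E M F₂ N₂ j) :
    ∃ σ : Jet E M F₂ N₂ j → MixedJet E M F₁ N₁ F₂ N₂ k₁ k,
      ContMDiffAt 𝓘(ℝ, JetCoord E F₂ j) 𝓘(ℝ, MixedCoord E F₁ F₂ k₁ k) ∞ σ b ∧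
      ∀ᶠ b' in 𝓝 b, (σ b').sndTrunc h = b' := by
  obtain ⟨θ, rfl⟩ := MixedJet.sndTrunc_surjective (E := E) (F₁ := F₁) (N₁ := N₁) (k₁ := k₁) h b
  exact (linearInCharts_sndTrunc h θ.base θ.fst.value θ.snd.value).exists_section
    (mixedOPH_mem_atlas _ _ _ _ _) (jetOPH_mem_atlas _ _ _)
    (truncCoord_sndExtendCoord h) (mem_mixedOPH_self θ)

/-- Diffeomorphisms preserving the vertical vectors descend to jets of the second component. -/
theorem exists_descent_sndTrunc [PreconnectedSpace N₁] [Nonempty N₁] (h : j ≤ k)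
    (Φ : MixedJetDiffeo E M F₁ N₁ F₂ N₂ 0 k)
    (v1 : PreservesVertical (MixedCoord E F₁ F₂ 0 k) (JetCoord E F₂ j) (MixedJet.sndTrunc h) Φ)
    (v2 : PreservesVertical (MixedCoord E F₁ F₂ 0 k) (JetCoord E F₂ j) (MixedJet.sndTrunc h)
      Φ.symm) :
    ∃ g : JetDiffeo E M F₂ N₂ j, ∀ θ, g (MixedJet.sndTrunc h θ) = MixedJet.sndTrunc h (Φ θ) :=
  exists_descent (contMDiff_sndTrunc h) (exists_section_sndTrunc h) Φ
    (fun _ _ hθ => MixedJet.eq_of_sndTrunc_eq h ((contMDiff_sndTrunc h).comp Φ.contMDiff)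
      (v1.mfderiv_comp_eq_zero (contMDiff_sndTrunc h) Φ.contMDiff) hθ)
    (fun _ _ hθ => MixedJet.eq_of_sndTrunc_eq h ((contMDiff_sndTrunc h).comp Φ.symm.contMDiff)
      (v2.mfderiv_comp_eq_zero (contMDiff_sndTrunc h) Φ.symm.contMDiff) hθ)

variable [FiniteDimensional ℝ E] [Nontrivial E]

/-- A first component of order zero carries no contact forms, so only the condition on the second
component remains. -/
theorem mem_cartanOf_iff_mfderiv_sndTrunc (h : j ≤ k) (θ : MixedJet E M F₁ N₁ F₂ N₂ 0 k)
    (v : TangentSpace 𝓘(ℝ, MixedCoord E F₁ F₂ 0 k) θ) :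
    v ∈ θ.cartanOf (Nat.zero_le 0) h ↔
      mfderiv 𝓘(ℝ, MixedCoord E F₁ F₂ 0 k) 𝓘(ℝ, JetCoord E F₂ j)
        (MixedJet.sndTrunc h : MixedJet E M F₁ N₁ F₂ N₂ 0 k → _) θ v ∈ (θ.sndTrunc h).cartan := by
  refine ⟨fun hv => hv.2, fun hv => ⟨?_, hv⟩⟩
  have l := (linearInCharts_trunc (E := E) (F := F₁) (N := N₁) (Nat.zero_le 0) θ.base
    θ.fst.value).comp (linearInCharts_fst (E := E) (M := M) (F₁ := F₁) (N₁ := N₁) (F₂ := F₂)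
    (N₂ := N₂) (k₁ := 0) (k₂ := k) θ.base θ.fst.value θ.snd.value)
  refine Submodule.mem_comap.2 ((mem_cartan_iff (l θ (mem_mixedOPH_self θ)).1).2 ?_)
  exact (mem_coordCartan _).2 fun i hi => absurd hi (Nat.not_lt_zero i)

/-- The transformation of jets of the second component induced by a Lie transformation. -/
theorem exists_lie_descent [PreconnectedSpace N₁] [Nonempty N₁] [Nontrivial F₂] (hj : 0 < j)
    (h : j ≤ k) (Φ : MixedJetDiffeo E M F₁ N₁ F₂ N₂ 0 k) (hΦ : IsMixedLie Φ) :
    ∃ g : JetDiffeo E M F₂ N₂ j, IsLie g ∧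
      ∀ θ, g (MixedJet.sndTrunc h θ) = MixedJet.sndTrunc h (Φ θ) := by
  obtain ⟨h1, h2⟩ := (isMixedLie_iff Φ).1 hΦ
  -- After `k - j` derivations the order is `(0, j)`, the first index staying `0` under truncated
  -- subtraction. As `j > 0`, its characteristics are the vertical vectors over `J^j(M, N₂)`.
  have c1 := h1.cartanOf Φ (k - j) (h₁ := Nat.zero_le 0) (h₂ := h) (by omega) (by omega)
  have c2 := h2.cartanOf Φ.symm (k - j) (h₁ := Nat.zero_le 0) (h₂ := h) (by omega) (by omega)
  obtain ⟨g, hg⟩ := exists_descent_sndTrunc h Φ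
    (Preserves.preservesVertical_sndTrunc hj Φ c1 c2)
    (Preserves.preservesVertical_sndTrunc hj Φ.symm c2 c1)
  have hg' : ∀ θ, g.symm (MixedJet.sndTrunc h θ) = MixedJet.sndTrunc h (Φ.symm θ) := fun θ => by
    have h := hg (Φ.symm θ)
    rw [Φ.apply_symm_apply] at h
    rw [← h, g.symm_apply_apply]
  exact ⟨g, (isLie_iff g).2
    ⟨c1.descend (contMDiff_sndTrunc h) (MixedJet.sndTrunc_surjective h)
      (mfderiv_sndTrunc_surjective h) (mem_cartanOf_iff_mfderiv_sndTrunc h) Φ.contMDiff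
      g.contMDiff hg,
    c2.descend (contMDiff_sndTrunc h) (MixedJet.sndTrunc_surjective h)
      (mfderiv_sndTrunc_surjective h) (mem_cartanOf_iff_mfderiv_sndTrunc h) Φ.symm.contMDiff
      g.symm.contMDiff hg'⟩, hg⟩

/-- The Cauchy characteristics stop at order one; the last step down to `J^0` comes from the vectors
of rank at most one. On `J^0` there are no contact forms to preserve, so only a diffeomorphism is
produced. -/
theorem exists_point_descent [PreconnectedSpace N₁] [Nonempty N₁] (hF : 1 < Module.finrank ℝ F₂)
    (hk : 0 < k) (Φ : MixedJetDiffeo E M F₁ N₁ F₂ N₂ 0 k) (hΦ : IsMixedLie Φ) :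
    ∃ g : JetDiffeo E M F₂ N₂ 0,
      ∀ θ, g (MixedJet.sndTrunc (Nat.zero_le k) θ) = MixedJet.sndTrunc (Nat.zero_le k) (Φ θ) := by
  obtain ⟨h1, h2⟩ := (isMixedLie_iff Φ).1 hΦ
  have hk1 : 1 ≤ k := hk
  have c1 := h1.cartanOf Φ (k - 1) (h₁ := Nat.zero_le 0) (h₂ := hk1) (by omega) (by omega)
  have c2 := h2.cartanOf Φ.symm (k - 1) (h₁ := Nat.zero_le 0) (h₂ := hk1) (by omega) (by omega)
  exact exists_descent_sndTrunc (Nat.zero_le k) Φ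
    (Preserves.preservesVertical_sndTrunc_zero hF Φ c1 c2)
    (Preserves.preservesVertical_sndTrunc_zero hF Φ.symm c2 c1)

end SecondComponent

/-! ### Transformations of `J^0` as point transformations. -/

section PointTransformations

variable {E : Type*} [NormedAddCommGroup E] [NormedSpace ℝ E]
  {M : Type*} [TopologicalSpace M] [ChartedSpace E M] [IsManifold 𝓘(ℝ, E) ∞ M]
  {F : Type*} [NormedAddCommGroup F] [NormedSpace ℝ F] [FiniteDimensional ℝ F]
  {N : Type*} [TopologicalSpace N] [ChartedSpace F N] [IsManifold 𝓘(ℝ, F) ∞ N] {k : ℕ}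

theorem contMDiff_pointMap {f : Jet E M F N 0 → Jet E M F N 0}
    (hf : ContMDiff 𝓘(ℝ, JetCoord E F 0) 𝓘(ℝ, JetCoord E F 0) ∞ f) :
    ContMDiff (𝓘(ℝ, E).prod 𝓘(ℝ, F)) (𝓘(ℝ, E).prod 𝓘(ℝ, F)) ∞ (fun p : M × N =>
      ((f (jetOf E F 0 (fun _ => p.2) p.1)).base, (f (jetOf E F 0 (fun _ => p.2) p.1)).value)) :=
  (contMDiff_base.comp (hf.comp contMDiff_jetOf_const)).prodMk
    (contMDiff_value.comp (hf.comp contMDiff_jetOf_const))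

/-- The transformation of `M × N` given by a transformation of `J^0(M, N)`. -/
def pointDiffeo (f : JetDiffeo E M F N 0) :
    (M × N) ≃ₘ⟮𝓘(ℝ, E).prod 𝓘(ℝ, F), 𝓘(ℝ, E).prod 𝓘(ℝ, F)⟯ (M × N) where
  toFun p := ((f (jetOf E F 0 (fun _ => p.2) p.1)).base, (f (jetOf E F 0 (fun _ => p.2) p.1)).value)
  invFun p := ((f.symm (jetOf E F 0 (fun _ => p.2) p.1)).base,
    (f.symm (jetOf E F 0 (fun _ => p.2) p.1)).value)
  left_inv p := by
    simp only [jetOf_zero_value, f.symm_apply_apply, jetOf_base, jetOf_value]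
  right_inv p := by
    simp only [jetOf_zero_value, f.apply_symm_apply, jetOf_base, jetOf_value]
  contMDiff_toFun := contMDiff_pointMap f.contMDiff
  contMDiff_invFun := contMDiff_pointMap f.symm.contMDiff

theorem pointDiffeo_apply (f : JetDiffeo E M F N 0) (θ : Jet E M F N 0) :
    pointDiffeo f (θ.base, θ.value) = ((f θ).base, (f θ).value) := by
  change ((f (jetOf E F 0 (fun _ => θ.value) θ.base)).base, _) = _
  rw [jetOf_zero_value]

/-- A jet of order zero is the pair of its base point and value, so the condition on graphs in `J^0`
becomes the condition on graphs in `M × N` by taking values. -/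
theorem isPointLift_of_isProlongation [FiniteDimensional ℝ E] [Nontrivial E]
    (f : JetDiffeo E M F N 0) {g : Jet E M F N k → Jet E M F N k}
    (h : IsProlongation (Nat.zero_le k) f g) : IsPointLift (pointDiffeo f) g := by
  have hj : ∀ (s : M → N) (x : M), pointDiffeo f (x, s x) =
      ((f (jetOf E F 0 s x)).base, (f (jetOf E F 0 s x)).value) := fun s x => by
    have h1 := pointDiffeo_apply f (jetOf E F 0 s x)
    rwa [jetOf_value, jetOf_base] at h1
  refine ⟨fun θ => ?_, fun hk x s hs => ?_⟩
  · have h1 := pointDiffeo_apply f (θ.trunc (Nat.zero_le k))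
    rw [Jet.trunc_value, Jet.trunc_base, ← h.1, Jet.trunc_value, Jet.trunc_base] at h1
    exact h1.symm
  · obtain ⟨t, h1, h2, h3⟩ := h.2 hk x s hs
    refine ⟨t, by rwa [hj], ?_, by rwa [hj]⟩
    filter_upwards [h2] with z hz
    rw [hj]
    exact (congrArg Jet.value hz).trans (jetOf_value _ _ _)

end PointTransformations

/-! ### The form of Lie transformations of `J^{0,k}`. -/

section LieTransformations

variable {E : Type*} [NormedAddCommGroup E] [NormedSpace ℝ E] [FiniteDimensional ℝ E] [Nontrivial E]
  {M : Type*} [TopologicalSpace M] [ChartedSpace E M] [IsManifold 𝓘(ℝ, E) ∞ M]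
  {F₁ : Type*} [NormedAddCommGroup F₁] [NormedSpace ℝ F₁] [FiniteDimensional ℝ F₁]
  {N₁ : Type*} [TopologicalSpace N₁] [ChartedSpace F₁ N₁] [IsManifold 𝓘(ℝ, F₁) ∞ N₁]
  {F₂ : Type*} [NormedAddCommGroup F₂] [NormedSpace ℝ F₂] [FiniteDimensional ℝ F₂]
  {N₂ : Type*} [TopologicalSpace N₂] [ChartedSpace F₂ N₂] [IsManifold 𝓘(ℝ, F₂) ∞ N₂] {j k : ℕ}

/-- This serves the degenerate case of an empty `N₁`, where the mixed jet space gives no information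
about `g`. -/
theorem isLie_refl : IsLie (Diffeomorph.refl 𝓘(ℝ, JetCoord E F₂ k) (Jet E M F₂ N₂ k) ∞) := by
  have h : Preserves Jet.cartan (id : Jet E M F₂ N₂ k → Jet E M F₂ N₂ k) := by
    intro θ v hv
    rw [mfderiv_id]
    exact hv
  exact (isLie_iff _).2 ⟨h, h⟩

theorem isProlongation_refl (h : j ≤ k) :
    IsProlongation h (Diffeomorph.refl 𝓘(ℝ, JetCoord E F₂ j) (Jet E M F₂ N₂ j) ∞)
      (Diffeomorph.refl 𝓘(ℝ, JetCoord E F₂ k) (Jet E M F₂ N₂ k) ∞) :=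
  isProlongation_of_covers h _ _ ((isLie_iff _).1 isLie_refl).1 fun _ => rfl

/-- The form of the Lie transformations of `J^{0,k}(M, N₁ × N₂)`. -/
theorem exists_lie_form [PreconnectedSpace N₁] [Nontrivial F₂] (hk : 0 < k)
    (Φ : MixedJetDiffeo E M F₁ N₁ F₂ N₂ 0 k) (hΦ : IsMixedLie Φ) :
    ∃ (Y : N₁ × Jet E M F₂ N₂ k → N₁) (g : JetDiffeo E M F₂ N₂ k),
      ContMDiff (𝓘(ℝ, F₁).prod 𝓘(ℝ, JetCoord E F₂ k)) 𝓘(ℝ, F₁) ∞ Y ∧ IsLie g ∧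
      (∀ (y : N₁) (θ : Jet E M F₂ N₂ k),
        mixedZeroEquiv E M F₁ N₁ F₂ N₂ k (Φ ((mixedZeroEquiv E M F₁ N₁ F₂ N₂ k).symm (y, θ))) =
          (Y (y, θ), g θ)) ∧
      (∃ f : JetDiffeo E M F₂ N₂ 1, IsLie f ∧ IsProlongation (Nat.one_le_of_lt hk) f g) ∧
      (1 < Module.finrank ℝ F₂ →
        ∃ f : (M × N₂) ≃ₘ⟮𝓘(ℝ, E).prod 𝓘(ℝ, F₂), 𝓘(ℝ, E).prod 𝓘(ℝ, F₂)⟯ (M × N₂),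
          IsPointLift f g) := by
  -- For empty `N₁` the formula is vacuous, yet `g` and the maps below it must still exist;
  -- identities are used.
  rcases isEmpty_or_nonempty N₁ with hN | hN
  · exact ⟨Prod.fst, Diffeomorph.refl _ _ _, _root_.contMDiff_fst, isLie_refl, fun y => isEmptyElim y,
      ⟨Diffeomorph.refl _ _ _, isLie_refl, isProlongation_refl _⟩, fun _ =>
      ⟨_, isPointLift_of_isProlongation _ (isProlongation_refl (Nat.zero_le k))⟩⟩
  set e := mixedZeroEquiv E M F₁ N₁ F₂ N₂ k with he
  obtain ⟨g, hg, hgΦ⟩ := exists_lie_descent hk le_rfl Φ hΦ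
  have hgs : ∀ θ, g (MixedJet.snd θ) = (Φ θ).snd := fun θ => by
    have h := hgΦ θ
    rwa [MixedJet.sndTrunc, MixedJet.sndTrunc, Jet.trunc_self, Jet.trunc_self] at h
  -- Both `f` and `g` are induced by the same `Φ`, and every jet is the second component of a mixed
  -- jet. Hence `g` covers `f`, and being Lie it is the prolongation of `f`.
  have hcov : ∀ {j : ℕ} (h : j ≤ k) (f : JetDiffeo E M F₂ N₂ j),
      (∀ θ, f (MixedJet.sndTrunc h θ) = MixedJet.sndTrunc h (Φ θ)) →
      IsProlongation h f g := by
    intro j h f hf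
    refine isProlongation_of_covers h f g ((isLie_iff g).1 hg).1 fun η => ?_
    obtain ⟨y⟩ := hN
    have h1 := hf (e.symm (y, η))
    have h2 : (e.symm (y, η)).snd = η := rfl
    rw [MixedJet.sndTrunc, MixedJet.sndTrunc, ← hgs, h2] at h1
    exact h1
  refine ⟨fun p => (Φ (e.symm p)).fst.value, g, ?_, hg, fun y θ => ?_, ?_, fun hF => ?_⟩
  · exact contMDiff_value.comp (JetSpace.contMDiff_fst.comp
      (Φ.contMDiff.comp contMDiff_mixedZeroEquiv_symm))
  · exact Prod.ext rfl (hgs (e.symm (y, θ))).symm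
  -- Descent to `J^1` works for every positive dimension of `N₂`.
  · obtain ⟨f, hf, hfΦ⟩ := exists_lie_descent one_pos (Nat.one_le_of_lt hk) Φ hΦ
    exact ⟨f, hf, hcov _ f hfΦ⟩
  · obtain ⟨f, hfΦ⟩ := exists_point_descent hF hk Φ hΦ
    exact ⟨_, isPointLift_of_isProlongation f (hcov _ f hfΦ)⟩

end LieTransformations

end JetSpace

end

open JetSpace in
theorem mainTheorem9
    {E : Type*} [NormedAddCommGroup E] [NormedSpace ℝ E] [FiniteDimensional ℝ E]
    {M : Type*} [TopologicalSpace M] [T2Space M] [SecondCountableTopology M]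
    [ChartedSpace E M] [IsManifold 𝓘(ℝ, E) ∞ M]
    {F₁ : Type*} [NormedAddCommGroup F₁] [NormedSpace ℝ F₁] [FiniteDimensional ℝ F₁]
    {N₁ : Type*} [TopologicalSpace N₁] [T2Space N₁] [SecondCountableTopology N₁]
    [ChartedSpace F₁ N₁] [IsManifold 𝓘(ℝ, F₁) ∞ N₁]
    {F₂ : Type*} [NormedAddCommGroup F₂] [NormedSpace ℝ F₂] [FiniteDimensional ℝ F₂]
    {N₂ : Type*} [TopologicalSpace N₂] [T2Space N₂] [SecondCountableTopology N₂]
    [ChartedSpace F₂ N₂] [IsManifold 𝓘(ℝ, F₂) ∞ N₂]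
    (hM : 0 < Module.finrank ℝ E) (hN₂ : 0 < Module.finrank ℝ F₂) :
    (∀ (k₁ k₂ : ℕ), k₁ < k₂ → ∀ Φ : MixedJetDiffeo E M F₁ N₁ F₂ N₂ k₁ k₂, IsMixedLie Φ →
      ∃ Φ₀ : MixedJetDiffeo E M F₁ N₁ F₂ N₂ 0 (k₂ - k₁), IsMixedLie Φ₀ ∧
        IsMixedProlongation (Nat.zero_le k₁) (Nat.sub_le k₂ k₁) Φ₀ Φ) ∧
    (PreconnectedSpace N₁ → ∀ (k : ℕ) (hk : 0 < k),
      ∀ Φ₀ : MixedJetDiffeo E M F₁ N₁ F₂ N₂ 0 k, IsMixedLie Φ₀ →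
      ∃ (Y : N₁ × Jet E M F₂ N₂ k → N₁) (g : JetDiffeo E M F₂ N₂ k),
        ContMDiff (𝓘(ℝ, F₁).prod 𝓘(ℝ, JetCoord E F₂ k)) 𝓘(ℝ, F₁) ∞ Y ∧ IsLie g ∧
        (∀ (y : N₁) (θ : Jet E M F₂ N₂ k),
          mixedZeroEquiv E M F₁ N₁ F₂ N₂ k (Φ₀ ((mixedZeroEquiv E M F₁ N₁ F₂ N₂ k).symm (y, θ))) =
            (Y (y, θ), g θ)) ∧
        (Module.finrank ℝ F₂ = 1 →
          ∃ f : JetDiffeo E M F₂ N₂ 1, IsLie f ∧ IsProlongation (Nat.one_le_of_lt hk) f g) ∧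
        (1 < Module.finrank ℝ F₂ →
          ∃ f : (M × N₂) ≃ₘ⟮𝓘(ℝ, E).prod 𝓘(ℝ, F₂), 𝓘(ℝ, E).prod 𝓘(ℝ, F₂)⟯ (M × N₂),
            IsPointLift f g)) := by
  -- Positivity of `dim M` enters through `span_contract`, and positivity of `dim N₂` through
  -- `exists_contract_ne_zero`.
  have hE : Nontrivial E := Module.nontrivial_of_finrank_pos hM
  have hF : Nontrivial F₂ := Module.nontrivial_of_finrank_pos hN₂
  refine ⟨fun k₁ k₂ hk Φ hΦ => exists_mixedProlongation hk Φ hΦ, fun hN k hk Φ hΦ => ?_⟩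
  obtain ⟨Y, g, h1, h2, h3, h4, h5⟩ := exists_lie_form hk Φ hΦ
  exact ⟨Y, g, h1, h2, h3, fun _ => h4, h5⟩
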